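/- **High-order regularization of the Stokeslet and stresslet integrals on the surface.** Let $\operatorname{erf}(r)=\frac{2}{\sqrt\pi}\int_0^r e^{-t^2}\,dt$, $$s_1(r)=\operatorname{erf}(r),\qquad s_2(r)=\operatorname{erf}(r)-\tfrac{2}{\sqrt\pi}\,r\,e^{-r^2},\qquad s_3(r)=\operatorname{erf}(r)-\tfrac{2}{\sqrt\pi}\,r\left(\tfrac23r^2+1\right)e^{-r^2},$$ and $$s_1^{\#}(r)=\operatorname{erf}(r)-\tfrac{2}{3\sqrt\pi}\,r\,(2r^2-5)\,e^{-r^2},\qquad s_2^{\#}(r)=\operatorname{erf}(r)-\tfrac{2}{3\sqrt\pi}\,r\,(4r^4-14r^2+3)\,e^{-r^2},$$ $$s_3^{\#}(r)=\operatorname{erf}(r)-\tfrac{2}{9\sqrt\pi}\,r\,(8r^6-36r^4+6r^2+9)\,e^{-r^2}.$$ Put $p_1=1$, $p_2=3$, $p_3=5$. 1. (Moment conditions.) For each $j\in\{1,2,3\}$ there is exactly one pair of real constants $(a,b)$ such that $s^{*}(r)=s_j(r)+a\,r\,s_j'(r)+b\,r^2s_j''(r)$ satisfies the two moment conditions $$\int_0^\infty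 \frac{s^{*}(\eta)-1}{\eta^{p_j}}\,\eta^{p_j}\,d\eta=0,\qquad \int_0^\infty \frac{s^{*}(\eta)-1}{\eta^{p_j}}\,\eta^{p_j+2}\,d\eta=0$$ (with convergent integrals), and for this pair $s^{*}=s_j^{\#}$. 2. (Smoothing factors.) For each $j$, $s_j^{\#}(\rho)\to1$ as $\rho\to\infty$, $s_j^{\#}(\rho)=O(\rho^{p_j})$ as $\rho\to0^+$, and for every $\delta>0$ the function $z\mapsto s_j^{\#}(|z|/\delta)/|z|^{p_j}$ extends to a $C^\infty$ function on $\mathbb R^3$. Let now $\Omega\subset\mathbb R^3$ be a bounded open set with $C^\infty$ boundary $\partial\Omega$ (locally $\Omega$ is $\{g<0\}$ with $g$ smooth and $\nabla g\ne0$), with outward unit normal $n$ and surface measure $dS$, and let $f,q:\partial\Omega\to\mathbb R^3$ be $C^\infty$. With $$S_{ij}(y,x)=\frac{\delta_{ij}}{|y-x|}+\frac{(y_i-x_i)(y_j-x_j)}{|y-x|^3},\qquad T_{ijk}(y,x)=-\frac{6(y_i-x_i)(y_j-x_j)(y_k-x_k)}{|y-x|^5},$$ define for $y\in\partial\Omega$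 (summing over repeated indices) $$u_i(y)=\frac1{8\pi}\int_{\partial\Omega}S_{ij}(y,x)f_j(x)\,dS(x),\qquad w_i(y)=\frac1{8\pi}\int_{\partial\Omega}T_{ijk}(y,x)q_j(x)n_k(x)\,dS(x),$$ and, for $\delta>0$ and with $r=|y-x|$, $$u_\delta(y)=\frac1{8\pi}\int_{\partial\Omega}\Big[f(x)\frac{s_1^{\#}(r/\delta)}{r}+\big(f(x)\cdot(y-x)\big)(y-x)\frac{s_2^{\#}(r/\delta)}{r^3}\Big]dS(x),$$ $$w_\delta(y)=-\frac3{4\pi}\int_{\partial\Omega}\big[(y-x)\cdot(q(x)-q(y))\big]\big[(y-x)\cdot n(x)\big](y-x)\frac{s_3^{\#}(r/\delta)}{r^5}\,dS(x)+\frac12\,q(y).$$ 3. (Stokeslet.) The integrals defining $u(y)$ and $u_\delta(y)$ converge absolutely for all $y\in\partial\Omega$ and $\delta>0$, and there is a constant $C$ (depending on $\Omega$ and $f$, but not on $\delta$ or $y$) with $|u_\delta(y)-u(y)|\le C\delta^5$ for all $\delta>0$ and $y\in\partial\Omega$. 4. (Stresslet.) The integrals defining $w(y)$ and $w_\delta(y)$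 converge absolutely for all $y\in\partial\Omega$ and $\delta>0$, and there is a constant $C$ (depending on $\Omega$ and $q$, but not on $\delta$ or $y$) with $|w_\delta(y)-w(y)|\le C\delta^5$ for all $\delta>0$ and $y\in\partial\Omega$. -/

import Mathlib

open Set Filter Topology MeasureTheory Asymptotics
open scoped ContDiff InnerProductSpace

namespace StokesReg

/-- Euclidean three-space. -/
abbrev E3 : Type := EuclideanSpace ℝ (Fin 3)

/-! ### Smooth closed surfaces `∂Ω` and their outward normal -/

/-- A bounded open subset of three-space with `C^∞` boundary: near each boundary point, `Ω` is the
sublevel set `{g < 0}` of a `C^∞` function `g` with nonvanishing gradient. The smooth closed surface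
is `frontier Ω`. -/
structure IsSmoothBoundedRegion (Ω : Set E3) : Prop where
  isOpen : IsOpen Ω
  isBounded : Bornology.IsBounded Ω
  smooth_boundary : ∀ p ∈ frontier Ω, ∃ (V : Set E3) (g : E3 → ℝ),
    IsOpen V ∧ p ∈ V ∧ ContDiffOn ℝ ∞ g V ∧ (∀ x ∈ V, gradient g x ≠ 0) ∧
      ∀ x ∈ V, x ∈ Ω ↔ g x < 0

/-- `ν` is the outward unit normal of `Ω` at the boundary point `x`: a unit vector such that rays
from `x` making an obtuse angle with `ν` start inside `Ω`, and rays making an acute angle with `ν`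
start outside the closure of `Ω`. -/
def IsOutwardUnitNormal (Ω : Set E3) (x ν : E3) : Prop :=
  ‖ν‖ = 1 ∧
  (∀ v : E3, ⟪v, ν⟫_ℝ < 0 → ∀ᶠ t : ℝ in 𝓝[>] 0, x + t • v ∈ Ω) ∧
  (∀ v : E3, 0 < ⟪v, ν⟫_ℝ → ∀ᶠ t : ℝ in 𝓝[>] 0, x + t • v ∉ closure Ω)

theorem IsOutwardUnitNormal.unique {Ω : Set E3} {x ν₁ ν₂ : E3}
    (h₁ : IsOutwardUnitNormal Ω x ν₁) (h₂ : IsOutwardUnitNormal Ω x ν₂) : ν₁ = ν₂ := by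
  by_contra hne
  have hlt : ⟪ν₁, ν₂⟫_ℝ < 1 := (inner_lt_one_iff_real_of_norm_eq_one h₁.1 h₂.1).2 hne
  have e₁ : ⟪ν₁, ν₁⟫_ℝ = 1 := by rw [real_inner_self_eq_norm_sq, h₁.1]; norm_num
  have e₂ : ⟪ν₂, ν₂⟫_ℝ = 1 := by rw [real_inner_self_eq_norm_sq, h₂.1]; norm_num
  have a₁ : ⟪ν₂ - ν₁, ν₁⟫_ℝ < 0 := by
    rw [inner_sub_left, e₁, real_inner_comm]; linarith
  have a₂ : 0 < ⟪ν₂ - ν₁, ν₂⟫_ℝ := by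
    rw [inner_sub_left, e₂]; linarith
  obtain ⟨t, ht₁, ht₂⟩ := ((h₁.2.1 _ a₁).and (h₂.2.2 _ a₂)).exists
  exact ht₂ (subset_closure ht₁)

theorem IsSmoothBoundedRegion.exists_normal {Ω : Set E3} (hΩ : IsSmoothBoundedRegion Ω)
    {x : E3} (hx : x ∈ frontier Ω) : ∃ ν, IsOutwardUnitNormal Ω x ν := by
  obtain ⟨V, g, hV, hxV, hg, hgrad, hiff⟩ := hΩ.smooth_boundary x hx
  have hgc : ContinuousAt g x := (hg.continuousOn.continuousAt (hV.mem_nhds hxV))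
  have hgx : g x = 0 := by
    apply le_antisymm
    · by_contra hpos
      push Not at hpos
      have h1 : ∀ᶠ z in 𝓝 x, 0 < g z := hgc.eventually_const_lt hpos
      have h2 : ∃ᶠ z in 𝓝 x, z ∈ Ω := mem_closure_iff_frequently.1 (frontier_subset_closure hx)
      obtain ⟨z, hz, hz1, hz2⟩ := (h2.and_eventually (h1.and (hV.mem_nhds hxV))).exists
      have := (hiff z hz2).1 hz
      linarith
    · by_contra hneg
      push Not at hneg
      have : x ∈ Ω := (hiff x hxV).2 hneg
      rw [hΩ.isOpen.frontier_eq] at hx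
      exact hx.2 this
  have hd : DifferentiableAt ℝ g x :=
    (hg.contDiffAt (hV.mem_nhds hxV)).differentiableAt (by simp)
  have hline : ∀ v : E3, HasDerivAt (fun t : ℝ => g (x + t • v)) ⟪gradient g x, v⟫_ℝ 0 := by
    intro v
    have h1 : HasDerivAt (fun t : ℝ => x + t • v) v 0 := by
      simpa using ((hasDerivAt_id (0 : ℝ)).smul_const v).const_add x
    have h2 : HasFDerivAt g (InnerProductSpace.toDual ℝ E3 (gradient g x)) (x + (0 : ℝ) • v) := by
      simpa using hd.hasGradientAt.hasFDerivAt
    have h3 := h2.comp_hasDerivAt (0 : ℝ) h1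
    rwa [InnerProductSpace.toDual_apply_apply] at h3
  have hmem : ∀ v : E3, ∀ᶠ t : ℝ in 𝓝[>] 0, x + t • v ∈ V := by
    intro v
    have hc : Tendsto (fun t : ℝ => x + t • v) (𝓝[>] 0) (𝓝 x) := by
      have : Continuous (fun t : ℝ => x + t • v) := by fun_prop
      have h := this.tendsto 0
      simp only [zero_smul, add_zero] at h
      exact h.mono_left nhdsWithin_le_nhds
    exact hc.eventually (hV.mem_nhds hxV)
  have hn : 0 < ‖gradient g x‖ := norm_pos_iff.2 (hgrad x hxV)
  have hslope : ∀ v : E3, Tendsto (fun t : ℝ => t⁻¹ * g (x + t • v)) (𝓝[>] 0)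
      (𝓝 ⟪gradient g x, v⟫_ℝ) := by
    intro v
    have h := (hline v).tendsto_slope_zero_right
    simpa [hgx] using h
  refine ⟨‖gradient g x‖⁻¹ • gradient g x, ?_, ?_, ?_⟩
  · rw [norm_smul, norm_inv, norm_norm, inv_mul_cancel₀ hn.ne']
  · intro v hv
    rw [inner_smul_right, real_inner_comm] at hv
    have hv' : ⟪gradient g x, v⟫_ℝ < 0 := by
      by_contra h
      push Not at h
      have : 0 ≤ ‖gradient g x‖⁻¹ * ⟪gradient g x, v⟫_ℝ := by positivity
      linarith
    filter_upwards [(hslope v).eventually_lt_const hv', hmem v, self_mem_nhdsWithin]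
      with t ht htV ht0
    have ht0' : 0 < t := ht0
    refine (hiff _ htV).2 ?_
    by_contra h
    push Not at h
    have : 0 ≤ t⁻¹ * g (x + t • v) := by positivity
    linarith
  · intro v hv
    rw [inner_smul_right, real_inner_comm] at hv
    have hv' : 0 < ⟪gradient g x, v⟫_ℝ := by
      by_contra h
      push Not at h
      have : ‖gradient g x‖⁻¹ * ⟪gradient g x, v⟫_ℝ ≤ 0 :=
        mul_nonpos_of_nonneg_of_nonpos (by positivity) h
      linarith
    filter_upwards [(hslope v).eventually_const_lt hv', hmem v, self_mem_nhdsWithin]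
      with t ht htV ht0 hcl
    have ht0' : 0 < t := ht0
    have hpos : 0 < g (x + t • v) := by
      by_contra h
      push Not at h
      have : t⁻¹ * g (x + t • v) ≤ 0 := mul_nonpos_of_nonneg_of_nonpos (by positivity) h
      linarith
    have hc : ContinuousAt g (x + t • v) := hg.continuousOn.continuousAt (hV.mem_nhds htV)
    obtain ⟨z, hz, hz1, hz2⟩ := ((mem_closure_iff_frequently.1 hcl).and_eventually
      ((hc.eventually_const_lt hpos).and (hV.mem_nhds htV))).exists
    have := (hiff z hz2).1 hz
    linarith

open Classical in
/-- The outward unit normal field of `∂Ω` (zero where there is none). -/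
noncomputable def outwardNormal (Ω : Set E3) (x : E3) : E3 :=
  if h : ∃ ν, IsOutwardUnitNormal Ω x ν then h.choose else 0

/-- The surface area measure `dS` on `∂Ω`: two-dimensional Hausdorff measure, normalized so as to
agree with Lebesgue measure on planes. -/
noncomputable def surfaceMeasure (Ω : Set E3) : Measure E3 :=
  (μHE[2] : Measure E3).restrict (frontier Ω)

/-! ### Stokeslet and stresslet, single and double layer integrals -/

/-- `S_{ij}(y, x)`. -/
noncomputable def stokeslet (y x : E3) (i j : Fin 3) : ℝ :=
  (if i = j then 1 else 0) / ‖y - x‖ + (y i - x i) * (y j - x j) / ‖y - x‖ ^ 3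

/-- `T_{ijk}(y, x)`. -/
noncomputable def stresslet (y x : E3) (i j k : Fin 3) : ℝ :=
  -(6 * (y i - x i) * (y j - x j) * (y k - x k)) / ‖y - x‖ ^ 5

/-- The vector with components `S_{ij}(y, x) f_j(x)` (summation over `j`). -/
noncomputable def singleLayerIntegrand (f : E3 → E3) (y x : E3) : E3 :=
  WithLp.toLp 2 fun i => ∑ j, stokeslet y x i j * f x j

/-- The vector with components `T_{ijk}(y, x) q_j(x) n_k(x)` (summation over `j` and `k`). -/
noncomputable def doubleLayerIntegrand (Ω : Set E3) (q : E3 → E3) (y x : E3) : E3 :=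
  WithLp.toLp 2 fun i => ∑ j, ∑ k, stresslet y x i j k * q x j * outwardNormal Ω x k

/-- The Stokeslet (single layer) integral `u(y)`. -/
noncomputable def singleLayer (Ω : Set E3) (f : E3 → E3) (y : E3) : E3 :=
  (1 / (8 * Real.pi)) • ∫ x, singleLayerIntegrand f y x ∂(surfaceMeasure Ω)

/-- The stresslet (double layer) integral `w(y)`. -/
noncomputable def doubleLayer (Ω : Set E3) (q : E3 → E3) (y : E3) : E3 :=
  (1 / (8 * Real.pi)) • ∫ x, doubleLayerIntegrand Ω q y x ∂(surfaceMeasure Ω)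

/-! ### Regularized integrals, for given smoothing factors -/

/-- The integrand of the Stokeslet integral regularized with factors `s₁`, `s₂`. -/
noncomputable def regSingleLayerIntegrand (s₁ s₂ : ℝ → ℝ) (δ : ℝ) (f : E3 → E3) (y x : E3) : E3 :=
  (s₁ (‖y - x‖ / δ) / ‖y - x‖) • f x +
    (⟪f x, y - x⟫_ℝ * (s₂ (‖y - x‖ / δ) / ‖y - x‖ ^ 3)) • (y - x)

/-- The regularized Stokeslet integral `u_δ(y)`. -/
noncomputable def regSingleLayer (s₁ s₂ : ℝ → ℝ) (δ : ℝ) (Ω : Set E3) (f : E3 → E3) (y : E3) : E3 :=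
  (1 / (8 * Real.pi)) • ∫ x, regSingleLayerIntegrand s₁ s₂ δ f y x ∂(surfaceMeasure Ω)

open Classical in
/-- `χ(y) = 8π, 4π, 0` for `y` inside, on, outside the surface `∂Ω`. -/
noncomputable def chi (Ω : Set E3) (y : E3) : ℝ :=
  if y ∈ frontier Ω then 4 * Real.pi else if y ∈ Ω then 8 * Real.pi else 0

/-- The integrand of the regularized, subtracted stresslet integral; `x₀` is the point of the
surface closest to `y`. -/
noncomputable def regDoubleLayerIntegrand (s₃ : ℝ → ℝ) (δ : ℝ) (Ω : Set E3) (q : E3 → E3)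
    (x₀ y x : E3) : E3 :=
  (⟪y - x, q x - q x₀⟫_ℝ * ⟪y - x, outwardNormal Ω x⟫_ℝ *
    (s₃ (‖y - x‖ / δ) / ‖y - x‖ ^ 5)) • (y - x)

/-- The regularized stresslet integral `w_δ(y)`; `x₀` is the point of the surface closest to `y`. -/
noncomputable def regDoubleLayer (s₃ : ℝ → ℝ) (δ : ℝ) (Ω : Set E3) (q : E3 → E3) (x₀ y : E3) : E3 :=
  (-(3 / (4 * Real.pi))) • ∫ x, regDoubleLayerIntegrand s₃ δ Ω q x₀ y x ∂(surfaceMeasure Ω) +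
    (1 / (8 * Real.pi) * chi Ω y) • q x₀

/-! ### Smoothing functions -/

/-- The error function. -/
noncomputable def erf (x : ℝ) : ℝ :=
  2 / √Real.pi * ∫ t in (0 : ℝ)..x, Real.exp (-t ^ 2)

noncomputable def s₁ (r : ℝ) : ℝ := erf r

noncomputable def s₂ (r : ℝ) : ℝ := erf r - 2 * r * Real.exp (-r ^ 2) / √Real.pi

noncomputable def s₃ (r : ℝ) : ℝ :=
  erf r - 2 * r * (2 / 3 * r ^ 2 + 1) * Real.exp (-r ^ 2) / √Real.pi

/-- `s₁^#`. -/
noncomputable def s₁High (r : ℝ) : ℝ :=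
  erf r - 2 / 3 * r * (2 * r ^ 2 - 5) * Real.exp (-r ^ 2) / √Real.pi

/-- `s₂^#`. -/
noncomputable def s₂High (r : ℝ) : ℝ :=
  erf r - 2 / 3 * r * (4 * r ^ 4 - 14 * r ^ 2 + 3) * Real.exp (-r ^ 2) / √Real.pi

/-- `s₃^#`. -/
noncomputable def s₃High (r : ℝ) : ℝ :=
  erf r - 2 / 9 * r * (8 * r ^ 6 - 36 * r ^ 4 + 6 * r ^ 2 + 9) * Real.exp (-r ^ 2) / √Real.pi

/-- The requirements on the factor `s` that regularizes `1 / r ^ p`: it tends to `1` at infinity,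
is `O(ρ ^ p)` for small `ρ`, and for each `δ > 0` the function `s(|z| / δ) / |z| ^ p` is smooth in
the vector `z` (i.e. extends smoothly over `z = 0`). -/
def IsSmoothingFactor (s : ℝ → ℝ) (p : ℕ) : Prop :=
  Tendsto s atTop (𝓝 1) ∧
  s =O[𝓝[>] 0] (fun ρ => ρ ^ p) ∧
  ∀ δ : ℝ, 0 < δ → ∃ k : E3 → ℝ, ContDiff ℝ ∞ k ∧ ∀ z : E3, z ≠ 0 → k z = s (‖z‖ / δ) / ‖z‖ ^ p

/-- The modification `s + a r s' + b r² s''`. -/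
noncomputable def modify (s : ℝ → ℝ) (a b r : ℝ) : ℝ :=
  s r + a * r * deriv s r + b * r ^ 2 * deriv (deriv s) r

/-- The integrand `φ(η) / η ^ p * η ^ m` with `φ = s - 1` of an on-surface moment integral. -/
noncomputable def momentIntegrand (s : ℝ → ℝ) (p m : ℕ) (η : ℝ) : ℝ :=
  (s η - 1) / η ^ p * η ^ m

/-- The moment integral `∫₀^∞ φ(η) / η ^ p * η ^ m dη` (with `φ = s - 1`) converges and vanishes. -/
def MomentVanishes (s : ℝ → ℝ) (p m : ℕ) : Prop :=
  IntegrableOn (momentIntegrand s p m) (Ioi 0) ∧ ∫ η in Ioi (0 : ℝ), momentIntegrand s p m η = 0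

/-- `t` is the high-order modification of the smoothing factor `s` of `1 / r ^ p`: there is exactly
one pair of constants `a`, `b` for which the two moment conditions hold for `s + a r s' + b r² s''`,
and the function obtained for these constants is `t`. -/
def IsHighOrderModification (s t : ℝ → ℝ) (p : ℕ) : Prop :=
  ∃ a b : ℝ, (∀ r, modify s a b r = t r) ∧ MomentVanishes t p p ∧ MomentVanishes t p (p + 2) ∧
    ∀ a' b' : ℝ, MomentVanishes (modify s a' b') p p → MomentVanishes (modify s a' b') p (p + 2) →
      a' = a ∧ b' = b

end StokesReg

namespace StokesReg

/-! ### Smooth dependence of integrals on parameters -/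

section Parametric

universe u
variable {H E : Type u} [NormedAddCommGroup H] [NormedSpace ℝ H] [FiniteDimensional ℝ H]
  [NormedAddCommGroup E] [NormedSpace ℝ E]

/-! Every smoothing factor here vanishes at zero, tends to one at infinity and has derivative r^(2k)
Q(r²) exp(-r²), with k = 0, 1, 2 and p = 2k + 1 (`IsGaussProfile`). For the basic factors Q is
constant; for the high-order ones Q(S) = c (S² - (2k+4) S + (k+1)(k+2)). Hence s(r) = r^p Λ(r²) with
Λ smooth, which gives the smoothing properties. The moment conditions follow by one integration by
parts: the n-th moment of the modified factor is (a - 1/(n+1) - (n+2) b) times a positive integral,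
and n = 0, 2 give two independent linear equations for a and b.

For the error estimates, each component of the difference of the integrands is, up to sign, a sum of
terms N(y,x) (s(r/δ) - 1)/r^(2k+1), where N is a smooth function of x times 2k factors of the form
g(x) - g(y). The special quadratic Q makes the δ-derivative of (s(r/δ) - 1)/r^(2k+1) equal to -c δ⁴
times the second τ-derivative of exp(-r²/τ)/τ^(k+1) at τ = δ². It is therefore enough to bound,
uniformly in y and τ, the second τ-derivative of τ^(-k-1) ∫ N exp(-r²/τ) dS. The δ-derivative of the
error is then O(δ⁴), the error tends to zero with δ by dominated convergence, and the mean value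
inequality gives O(δ⁵) (`exists_abs_integral_diffProd_mul_le`).

The uniform bound is local. Over a graph with small slope, the planar offset from y is an invertible
smooth matrix times half the gradient of r², so integration by parts against the Gaussian trades two
orders of vanishing for one factor τ (`exists_gaussInt_eq_mul`). After k rounds the quantity has the
form τ⁻¹ ∫ G exp(-r²/τ), which is bounded because the planar Gaussian has mass πτ. This form is
stable under d/dτ (`exists_hasDerivAt_gaussInt_div`): a field along which r² has derivative 2r² has
divergence 2 to leading order, which cancels the derivative of τ⁻¹, and the remainder vanishes to
first order and so gains the missing τ. Two such derivatives give the bound.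

The stresslet also needs the on-surface Gauss identity (`integral_gauss`), by which subtracting q(y)
from the density costs exactly q(y)/2. With 1/r⁵ replaced by s₃(r/δ)/r⁵ the relevant vector field is
smooth and its divergence is a rescaled Gaussian moment. The divergence theorem turns the surface
integral into a Gaussian integral over (Ω - y)/δ, which tends to a half-space as δ → 0. The surface
measure is a Hausdorff measure, so the area formula for graphs and the divergence theorem are
derived along the way. -/

theorem hasFDerivAt_intervalIntegral_of_contDiff {F : H × ℝ → E} (hF : ContDiff ℝ 1 F) (x₀ : H) :
    HasFDerivAt (fun x => ∫ t in (0 : ℝ)..1, F (x, t))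
      (∫ t in (0 : ℝ)..1, (fderiv ℝ F (x₀, t)).comp (ContinuousLinearMap.inl ℝ H ℝ)) x₀ := by
  have hc : Continuous (fun z : H × ℝ =>
      (fderiv ℝ F z).comp (ContinuousLinearMap.inl ℝ H ℝ)) := by
    have := hF.continuous_fderiv (by norm_num)
    fun_prop
  obtain ⟨C, hC⟩ := ((isCompact_closedBall x₀ 1).prod (isCompact_Icc
    (a := (0 : ℝ)) (b := 1))).exists_bound_of_continuousOn
    hc.continuousOn
  refine intervalIntegral.hasFDerivAt_integral_of_dominated_of_fderiv_le (𝕜 := ℝ)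
    (F := fun x t => F (x, t)) (bound := fun _ => C)
    (F' := fun x t => (fderiv ℝ F (x, t)).comp (ContinuousLinearMap.inl ℝ H ℝ))
    (s := Metric.closedBall x₀ 1) (Metric.closedBall_mem_nhds _ one_pos) ?_ ?_ ?_ ?_ ?_ ?_
  · refine Eventually.of_forall fun x => ?_
    exact (hF.continuous.comp (by fun_prop : Continuous fun t : ℝ => (x, t))).aestronglyMeasurable
  · exact (hF.continuous.comp
      (by fun_prop : Continuous fun t : ℝ => (x₀, t))).intervalIntegrable _ _
  · exact (hc.comp (by fun_prop : Continuous fun t : ℝ => (x₀, t))).aestronglyMeasurable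
  · refine Eventually.of_forall fun t ht x hx => ?_
    rw [uIoc_of_le zero_le_one] at ht
    exact hC (x, t) ⟨hx, ht.1.le, ht.2⟩
  · simp
  · refine Eventually.of_forall fun t _ x _ => ?_
    have h1 : HasFDerivAt F (fderiv ℝ F (x, t)) (x, t) :=
      (hF.differentiable (by norm_num) _).hasFDerivAt
    have h2 : HasFDerivAt (fun x : H => (x, t)) (ContinuousLinearMap.inl ℝ H ℝ) x :=
      hasFDerivAt_prodMk_left x t
    exact h1.comp x h2

end Parametric

theorem contDiff_fderiv_comp_inl {H E : Type*} [NormedAddCommGroup H] [NormedSpace ℝ H]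
    [NormedAddCommGroup E] [NormedSpace ℝ E] {F : H × ℝ → E} (hF : ContDiff ℝ ∞ F) :
    ContDiff ℝ ∞ (fun z : H × ℝ => (fderiv ℝ F z).comp (ContinuousLinearMap.inl ℝ H ℝ)) :=
  (hF.fderiv_right (m := ∞) (by simp)).clm_comp contDiff_const

/-- The derivative of the integral is again such an integral, with values in a space of linear maps.
The target `E` is therefore quantified inside the induction, and `H` and `E` share a universe so
that the space of linear maps is an admissible target. -/
theorem contDiff_nat_intervalIntegral.{u} {H : Type u} [NormedAddCommGroup H] [NormedSpace ℝ H]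
    [FiniteDimensional ℝ H] (n : ℕ) : ∀ {E : Type u} [NormedAddCommGroup E] [NormedSpace ℝ E]
    {F : H × ℝ → E}, ContDiff ℝ ∞ F →
    ContDiff ℝ n (fun x => ∫ t in (0 : ℝ)..1, F (x, t)) := by
  induction n with
  | zero =>
    intro E _ _ F hF
    refine contDiff_zero.2 (continuous_iff_continuousAt.2 fun x => ?_)
    exact (hasFDerivAt_intervalIntegral_of_contDiff (hF.of_le (by simp)) x).continuousAt
  | succ n ih =>
    intro E _ _ F hF
    refine (contDiff_succ_iff_hasFDerivAt (n := n)).2 ⟨_, ih (contDiff_fderiv_comp_inl hF), fun x =>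
      hasFDerivAt_intervalIntegral_of_contDiff (hF.of_le (by simp)) x⟩

theorem contDiff_intervalIntegral.{u} {H E : Type u} [NormedAddCommGroup H] [NormedSpace ℝ H]
    [FiniteDimensional ℝ H] [NormedAddCommGroup E] [NormedSpace ℝ E]
    {F : H × ℝ → E} (hF : ContDiff ℝ ∞ F) :
    ContDiff ℝ ∞ (fun x => ∫ t in (0 : ℝ)..1, F (x, t)) :=
  contDiff_infty.2 fun n => contDiff_nat_intervalIntegral n hF

/-! ### Vanishing orders of smooth functions on the plane with parameters -/

abbrev E2 : Type := EuclideanSpace ℝ (Fin 2)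

/-- The standard basis vectors of the plane. -/
noncomputable abbrev planeBasis (i : Fin 2) : E2 := EuclideanSpace.single i 1

/-- The partial derivative in the `i`-th coordinate of the first variable. -/
noncomputable def dv (i : Fin 2) (g : E2 × E2 → ℝ) (z : E2 × E2) : ℝ :=
  fderiv ℝ g z (planeBasis i, 0)

theorem contDiff_dv {g : E2 × E2 → ℝ} (hg : ContDiff ℝ ∞ g) (i : Fin 2) :
    ContDiff ℝ ∞ (dv i g) :=
  (hg.fderiv_right (m := ∞) (by simp)).clm_apply contDiff_const

theorem hasFDerivAt_of_contDiff {E F : Type*} [NormedAddCommGroup E] [NormedSpace ℝ E]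
    [NormedAddCommGroup F] [NormedSpace ℝ F] {g : E → F} (hg : ContDiff ℝ ∞ g) (z : E) :
    HasFDerivAt g (fderiv ℝ g z) z :=
  (hg.differentiable (by simp) z).hasFDerivAt

theorem dv_add {g₁ g₂ : E2 × E2 → ℝ} (h₁ : ContDiff ℝ ∞ g₁) (h₂ : ContDiff ℝ ∞ g₂) (i : Fin 2)
    (z : E2 × E2) : dv i (fun z => g₁ z + g₂ z) z = dv i g₁ z + dv i g₂ z := by
  simp only [dv]
  rw [((hasFDerivAt_of_contDiff h₁ z).fun_add (hasFDerivAt_of_contDiff h₂ z)).fderiv]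
  simp

theorem dv_mul {g₁ g₂ : E2 × E2 → ℝ} (h₁ : ContDiff ℝ ∞ g₁) (h₂ : ContDiff ℝ ∞ g₂) (i : Fin 2)
    (z : E2 × E2) :
    dv i (fun z => g₁ z * g₂ z) z = g₁ z * dv i g₂ z + dv i g₁ z * g₂ z := by
  simp only [dv]
  rw [((hasFDerivAt_of_contDiff h₁ z).fun_mul (hasFDerivAt_of_contDiff h₂ z)).fderiv]
  simp; ring

theorem dv_sum {g : Fin 2 → E2 × E2 → ℝ} (h : ∀ j, ContDiff ℝ ∞ (g j)) (i : Fin 2)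
    (z : E2 × E2) : dv i (fun z => ∑ j, g j z) z = ∑ j, dv i (g j) z := by
  simp only [Fin.sum_univ_two]
  exact dv_add (h 0) (h 1) i z

theorem contDiff_coord (i : Fin 2) : ContDiff ℝ ∞ (fun z : E2 × E2 => z.1 i) := by
  have : ContDiff ℝ ∞ (fun z : E2 × E2 => z.1) := contDiff_fst
  exact contDiff_euclidean.1 this i

theorem dv_coord (i j : Fin 2) (z : E2 × E2) :
    dv j (fun z : E2 × E2 => z.1 i) z = if i = j then 1 else 0 := by
  have h : HasFDerivAt (fun z : E2 × E2 => z.1 i)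
      ((EuclideanSpace.proj i : E2 →L[ℝ] ℝ).comp (ContinuousLinearMap.fst ℝ E2 E2)) z :=
    ((EuclideanSpace.proj i : E2 →L[ℝ] ℝ).comp (ContinuousLinearMap.fst ℝ E2 E2)).hasFDerivAt
  simp only [dv]
  rw [h.fderiv]
  simp

/-- `g` is smooth and vanishes to order `k` where the first variable is zero. -/
def VanishOrder : ℕ → (E2 × E2 → ℝ) → Prop
  | 0, g => ContDiff ℝ ∞ g
  | k + 1, g => ∃ q : Fin 2 → E2 × E2 → ℝ, (∀ i, VanishOrder k (q i)) ∧
      ∀ z, g z = ∑ i, z.1 i * q i z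

theorem VanishOrder.contDiff {k : ℕ} : ∀ {g : E2 × E2 → ℝ}, VanishOrder k g → ContDiff ℝ ∞ g := by
  induction k with
  | zero => exact fun h => h
  | succ k ih =>
    rintro g ⟨q, hq, hg⟩
    rw [funext hg]
    exact ContDiff.sum fun i _ => (contDiff_coord i).mul (ih (hq i))

theorem VanishOrder.add {k : ℕ} : ∀ {g₁ g₂ : E2 × E2 → ℝ}, VanishOrder k g₁ → VanishOrder k g₂ →
    VanishOrder k (fun z => g₁ z + g₂ z) := by
  induction k with
  | zero => exact fun h₁ h₂ => ContDiff.add h₁ h₂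
  | succ k ih =>
    rintro g₁ g₂ ⟨q₁, hq₁, hg₁⟩ ⟨q₂, hq₂, hg₂⟩
    refine ⟨fun i z => q₁ i z + q₂ i z, fun i => ih (hq₁ i) (hq₂ i), fun z => ?_⟩
    simp only [hg₁, hg₂, Fin.sum_univ_two]
    ring

theorem VanishOrder.smul {k : ℕ} {a : E2 × E2 → ℝ} (ha : ContDiff ℝ ∞ a) :
    ∀ {g : E2 × E2 → ℝ}, VanishOrder k g → VanishOrder k (fun z => a z * g z) := by
  induction k with
  | zero => exact fun h => ContDiff.mul ha h
  | succ k ih =>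
    rintro g ⟨q, hq, hg⟩
    refine ⟨fun i z => a z * q i z, fun i => ih (hq i), fun z => ?_⟩
    simp only [hg, Fin.sum_univ_two]
    ring

theorem VanishOrder.sum {k : ℕ} {g : Fin 2 → E2 × E2 → ℝ} (h : ∀ i, VanishOrder k (g i)) :
    VanishOrder k (fun z => ∑ i, g i z) := by
  simp only [Fin.sum_univ_two]
  exact (h 0).add (h 1)

theorem VanishOrder.coord_mul {k : ℕ} {g : E2 × E2 → ℝ} (h : VanishOrder k g) (i : Fin 2) :
    VanishOrder (k + 1) (fun z => z.1 i * g z) := by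
  refine ⟨fun j z => (if i = j then 1 else 0) * g z, fun j => h.smul contDiff_const, fun z => ?_⟩
  simp

theorem VanishOrder.mul {k l : ℕ} {g₂ : E2 × E2 → ℝ} (h₂ : VanishOrder l g₂) :
    ∀ {g₁ : E2 × E2 → ℝ}, VanishOrder k g₁ → VanishOrder (k + l) (fun z => g₁ z * g₂ z) := by
  induction k with
  | zero =>
    intro g₁ h₁
    rw [zero_add]
    exact h₂.smul h₁
  | succ k ih =>
    rintro g₁ ⟨q, hq, hg⟩
    rw [Nat.add_right_comm]
    refine ⟨fun i z => q i z * g₂ z, fun i => ih (hq i), fun z => ?_⟩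
    simp only [hg, Fin.sum_univ_two]
    ring

/-- By the product rule on z_i q_i, the derivative either falls on the coordinate and leaves a
quotient of full order, or falls on q_i and loses one order that the coordinate restores. At order
zero the truncated subtraction asks for smoothness only. -/
theorem VanishOrder.dv {k : ℕ} (j : Fin 2) : ∀ {g : E2 × E2 → ℝ}, VanishOrder k g →
    VanishOrder (k - 1) (dv j g) := by
  induction k with
  | zero => exact fun h => contDiff_dv h j
  | succ k ih =>
    rintro g ⟨q, hq, hg⟩
    have e : StokesReg.dv j g = fun z =>
        ∑ i, (z.1 i * StokesReg.dv j (q i) z + (if i = j then 1 else 0) * q i z) := by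
      funext z
      rw [funext hg, dv_sum (fun i => (contDiff_coord i).mul (hq i).contDiff)]
      refine Finset.sum_congr rfl fun i _ => ?_
      rw [dv_mul (contDiff_coord i) (hq i).contDiff, dv_coord]
    rw [e, Nat.add_sub_cancel]
    refine VanishOrder.sum fun i => ((?_ : VanishOrder k _).add ((hq i).smul contDiff_const))
    -- For k = 0 the truncated order k - 1 is again 0, so no coordinate factor has to be counted.
    rcases k with _ | k
    · exact (ih (hq i)).smul (contDiff_coord i)
    · exact (ih (hq i)).coord_mul i

theorem sum_coord_planeBasis (v : E2) : ∑ i, v i • planeBasis i = v := by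
  ext j
  fin_cases j <;> simp [Fin.sum_univ_two]

/-- Hadamard's lemma: the quotients are integrals of partial derivatives along segments. -/
theorem hadamard_quotient {g : E2 × E2 → ℝ} (hg : ContDiff ℝ ∞ g) (h0 : ∀ b, g (0, b) = 0)
    (z : E2 × E2) : g z = ∑ i, z.1 i * ∫ t in (0 : ℝ)..1, dv i g (t • z.1, z.2) := by
  have hd : ∀ t : ℝ, HasDerivAt (fun t : ℝ => g (t • z.1, z.2))
      (∑ i, z.1 i * dv i g (t • z.1, z.2)) t := by
    intro t
    have h1 : HasDerivAt (fun t : ℝ => (t • z.1, z.2)) (z.1, (0 : E2)) t := by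
      have := ((hasDerivAt_id t).smul_const z.1).prodMk (hasDerivAt_const t z.2)
      simpa using this
    have h2 := (hasFDerivAt_of_contDiff hg (t • z.1, z.2)).comp_hasDerivAt t h1
    have h3 : fderiv ℝ g (t • z.1, z.2) (z.1, 0) = ∑ i, z.1 i * dv i g (t • z.1, z.2) := ?_
    · rwa [h3] at h2
    have : (z.1, (0 : E2)) = ∑ i, z.1 i • (planeBasis i, (0 : E2)) := by
      simp only [Prod.smul_mk, smul_zero]
      rw [Prod.ext_iff]
      constructor
      · rw [Prod.fst_sum]; exact (sum_coord_planeBasis z.1).symm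
      · rw [Prod.snd_sum]; simp
    rw [this, map_sum]
    simp only [map_smul, dv, smul_eq_mul]
  have hc : ∀ i, Continuous fun t : ℝ => dv i g (t • z.1, z.2) := fun i =>
    (contDiff_dv hg i).continuous.comp (by fun_prop)
  have hint := intervalIntegral.integral_eq_sub_of_hasDerivAt (a := 0) (b := 1)
    (fun t _ => hd t) (Continuous.intervalIntegrable (by fun_prop) _ _)
  simp only [one_smul, zero_smul, h0, sub_zero] at hint
  rw [intervalIntegral.integral_finsetSum] at hint
  · simp only [intervalIntegral.integral_const_mul] at hint
    exact hint.symm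
  · exact fun i _ => Continuous.intervalIntegrable (by fun_prop) _ _

theorem contDiff_hadamard_quotient {g : E2 × E2 → ℝ} (hg : ContDiff ℝ ∞ g) (i : Fin 2) :
    ContDiff ℝ ∞ (fun z : E2 × E2 => ∫ t in (0 : ℝ)..1, dv i g (t • z.1, z.2)) := by
  refine contDiff_intervalIntegral (F := fun w : (E2 × E2) × ℝ => dv i g (w.2 • w.1.1, w.1.2)) ?_
  refine (contDiff_dv hg i).comp ?_
  fun_prop

theorem VanishOrder.of_apply_zero {g : E2 × E2 → ℝ} (hg : ContDiff ℝ ∞ g)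
    (h0 : ∀ b, g (0, b) = 0) : VanishOrder 1 g :=
  ⟨_, contDiff_hadamard_quotient hg, hadamard_quotient hg h0⟩

/-- `g` vanishes to order `k`, and is supported in a bounded set of values of the first variable. -/
def VanishOrderBdd (k : ℕ) (g : E2 × E2 → ℝ) : Prop :=
  VanishOrder k g ∧ ∃ R : ℝ, ∀ z : E2 × E2, R < ‖z.1‖ → g z = 0

theorem dv_eq_zero_of_support {g : E2 × E2 → ℝ} {R : ℝ}
    (hR : ∀ z : E2 × E2, R < ‖z.1‖ → g z = 0) (i : Fin 2) (z : E2 × E2) (hz : R < ‖z.1‖) :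
    dv i g z = 0 := by
  have : g =ᶠ[𝓝 z] fun _ => 0 := by
    have ho : IsOpen {z : E2 × E2 | R < ‖z.1‖} := isOpen_lt continuous_const (by fun_prop)
    filter_upwards [ho.mem_nhds hz] with w hw using hR w hw
  simp [dv, this.fderiv_eq]

theorem exists_plane_cutoff (R : ℝ) : ∃ η : E2 → ℝ, ContDiff ℝ ∞ η ∧ (∀ v, ‖v‖ ≤ R → η v = 1) ∧
    ∃ R' : ℝ, ∀ v, R' < ‖v‖ → η v = 0 := by
  let f : ContDiffBump (0 : E2) := ⟨max R 1, max R 1 + 1, by positivity, by linarith⟩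
  refine ⟨f, f.contDiff, fun v hv => ?_, max R 1 + 1, fun v hv => ?_⟩
  · exact f.one_of_mem_closedBall (by
      rw [mem_closedBall_zero_iff]; exact hv.trans (le_max_left _ _))
  · exact f.zero_of_le_dist (by rw [dist_zero_right]; exact hv.le)

/-! ### Gaussian integration by parts on a graph -/

section GraphGaussian

/-- The increment `h (b + v) - h b` at `z = (v, b)`. -/
noncomputable def incr (h : E2 → ℝ) (z : E2 × E2) : ℝ := h (z.2 + z.1) - h z.2

/-- The squared distance of the points of the graph of `h` over `b + v` and `b`. -/
noncomputable def graphSq (h : E2 → ℝ) (z : E2 × E2) : ℝ := ‖z.1‖ ^ 2 + incr h z ^ 2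

/-- The partial derivatives of `h` at `b + v`. -/
noncomputable def dh (h : E2 → ℝ) (i : Fin 2) (z : E2 × E2) : ℝ :=
  fderiv ℝ h (z.2 + z.1) (planeBasis i)

/-- The Hadamard quotients of the increment. -/
noncomputable def incrQuot (h : E2 → ℝ) (i : Fin 2) (z : E2 × E2) : ℝ :=
  ∫ t in (0 : ℝ)..1, dv i (incr h) (t • z.1, z.2)

/-- Half the partial derivatives of `graphSq h`. -/
noncomputable def halfGrad (h : E2 → ℝ) (j : Fin 2) (z : E2 × E2) : ℝ :=
  z.1 j + incr h z * dh h j z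

/-- The determinant of the matrix expressing `halfGrad h` through the coordinates. -/
noncomputable def slopeDet (h : E2 → ℝ) (z : E2 × E2) : ℝ := 1 + ∑ i, incrQuot h i z * dh h i z

/-- The inverse of the matrix expressing `halfGrad h` through the coordinates. -/
noncomputable def invMat (h : E2 → ℝ) (i j : Fin 2) (z : E2 × E2) : ℝ :=
  (if i = j then 1 else 0) - incrQuot h j z * dh h i z / slopeDet h z

/-- The difference of the Euler field and the coordinates is a multiple of `incrQuot h`. -/
noncomputable def eulerCoeff (h : E2 → ℝ) (z : E2 × E2) : ℝ :=
  (∑ i, z.1 i * (incrQuot h i z - dh h i z)) / slopeDet h z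

/-- A vector field along which `graphSq h` has derivative `2 * graphSq h`. -/
noncomputable def eulerField (h : E2 → ℝ) (j : Fin 2) (z : E2 × E2) : ℝ :=
  z.1 j + eulerCoeff h z * incrQuot h j z

variable {h : E2 → ℝ} (hh : ContDiff ℝ ∞ h) (hs : ∀ a, ‖fderiv ℝ h a‖ ≤ 1 / 2)

include hh

theorem contDiff_incr : ContDiff ℝ ∞ (incr h) :=
  (hh.comp (contDiff_snd.add contDiff_fst)).sub (hh.comp contDiff_snd)

theorem contDiff_dh (i : Fin 2) : ContDiff ℝ ∞ (dh h i) := by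
  have : ContDiff ℝ ∞ (fun a => fderiv ℝ h a (planeBasis i)) :=
    (hh.fderiv_right (m := ∞) (by simp)).clm_apply contDiff_const
  exact this.comp (contDiff_snd.add contDiff_fst)

theorem dv_incr (i : Fin 2) (z : E2 × E2) : dv i (incr h) z = dh h i z := by
  have h1 : HasFDerivAt (fun z : E2 × E2 => z.2 + z.1)
      (ContinuousLinearMap.snd ℝ E2 E2 + ContinuousLinearMap.fst ℝ E2 E2) z :=
    hasFDerivAt_snd.add hasFDerivAt_fst
  have h2 := (hasFDerivAt_of_contDiff hh (z.2 + z.1)).comp z h1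
  have h3 := (hasFDerivAt_of_contDiff hh z.2).comp z (hasFDerivAt_snd (p := z))
  have h4 : HasFDerivAt (incr h) _ z := h2.sub h3
  simp [dv, h4.fderiv, dh]

theorem contDiff_incrQuot (i : Fin 2) : ContDiff ℝ ∞ (incrQuot h i) :=
  contDiff_hadamard_quotient (contDiff_incr hh) i

theorem incr_eq (z : E2 × E2) : incr h z = ∑ i, z.1 i * incrQuot h i z :=
  hadamard_quotient (contDiff_incr hh) (by simp [incr]) z

theorem contDiff_graphSq : ContDiff ℝ ∞ (graphSq h) :=
  (contDiff_fst.norm_sq ℝ).add ((contDiff_incr hh).pow 2)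

theorem incrQuot_zero (i : Fin 2) (b : E2) : incrQuot h i (0, b) = dh h i (0, b) := by
  simp [incrQuot, dv_incr hh]

theorem contDiff_slopeDet : ContDiff ℝ ∞ (slopeDet h) :=
  contDiff_const.add (ContDiff.sum fun i _ => (contDiff_incrQuot hh i).mul (contDiff_dh hh i))

include hs

omit hh in
theorem abs_dh_le (i : Fin 2) (z : E2 × E2) : |dh h i z| ≤ 1 / 2 := by
  have := (fderiv ℝ h (z.2 + z.1)).le_opNorm (planeBasis i)
  simp only [PiLp.norm_single, norm_one, mul_one] at this
  exact this.trans (hs _)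

theorem abs_incrQuot_le (i : Fin 2) (z : E2 × E2) : |incrQuot h i z| ≤ 1 / 2 := by
  have := intervalIntegral.norm_integral_le_of_norm_le_const (a := (0 : ℝ)) (b := 1) (C := 1 / 2)
    (f := fun t : ℝ => dv i (incr h) (t • z.1, z.2)) (fun t _ => by
      rw [dv_incr hh]; exact abs_dh_le hs i _)
  simpa [incrQuot] using this

/-- The slope bound 1/2 bounds each of the two products by 1/4 in absolute value, so the determinant
is at least 1/2. Division by it is then smooth everywhere. -/
theorem slopeDet_pos (z : E2 × E2) : 0 < slopeDet h z := by
  have h1 : ∀ i, -(1 / 4 : ℝ) ≤ incrQuot h i z * dh h i z := fun i => by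
    have h2 := abs_incrQuot_le hh hs i z
    have h3 := abs_dh_le hs i z
    have : |incrQuot h i z * dh h i z| ≤ 1 / 2 * (1 / 2) := by
      rw [abs_mul]; gcongr
    linarith [(abs_le.1 this).1]
  have := h1 0
  have := h1 1
  simp only [slopeDet, Fin.sum_univ_two]
  linarith

theorem contDiff_invMat (i j : Fin 2) : ContDiff ℝ ∞ (invMat h i j) :=
  contDiff_const.sub (((contDiff_incrQuot hh j).mul (contDiff_dh hh i)).div (contDiff_slopeDet hh)
    fun z => (slopeDet_pos hh hs z).ne')

omit hs in
theorem sum_halfGrad_mul_incrQuot (z : E2 × E2) :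
    ∑ j, halfGrad h j z * incrQuot h j z = incr h z * slopeDet h z := by
  have := incr_eq hh z
  simp only [halfGrad, slopeDet, Fin.sum_univ_two] at *
  linear_combination -this

/-- Since the increment is ∑ z_i `incrQuot` i, the vector `halfGrad` is the identity plus a rank-one
matrix, applied to z. `invMat` is its Sherman–Morrison inverse. -/
theorem coord_eq_sum (i : Fin 2) (z : E2 × E2) :
    z.1 i = ∑ j, halfGrad h j z * invMat h i j z := by
  have h1 := sum_halfGrad_mul_incrQuot hh z
  have h2 := (slopeDet_pos hh hs z).ne'
  have : ∑ j, halfGrad h j z * invMat h i j z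
      = halfGrad h i z - (∑ j, halfGrad h j z * incrQuot h j z) * dh h i z / slopeDet h z := by
    simp only [invMat, mul_sub, Finset.sum_sub_distrib, Finset.sum_mul, Finset.sum_div]
    simp [mul_assoc, mul_div_assoc]
  rw [this, h1]
  simp only [halfGrad]
  field_simp
  ring

/-- Pairing `halfGrad` with the plain Euler field z misses `graphSq` by `incr` times (`incr` - ∑ z_i
`dh` i). Pairing it with `incrQuot` gives `incr` times `slopeDet`, so `eulerCoeff` is exactly the
multiple that repairs the defect. -/
theorem sum_halfGrad_mul_eulerField (z : E2 × E2) :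
    ∑ j, halfGrad h j z * eulerField h j z = graphSq h z := by
  have h1 := sum_halfGrad_mul_incrQuot hh z
  have h2 := (slopeDet_pos hh hs z).ne'
  have h3 := incr_eq hh z
  have h4 : eulerCoeff h z * slopeDet h z = incr h z - ∑ i, z.1 i * dh h i z := by
    rw [eulerCoeff, div_mul_cancel₀ _ h2]
    simp only [mul_sub, Finset.sum_sub_distrib, h3]
  have h5 : ‖z.1‖ ^ 2 = ∑ i, z.1 i ^ 2 := EuclideanSpace.real_norm_sq_eq z.1
  simp only [eulerField, graphSq, h5, Fin.sum_univ_two, halfGrad] at *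
  linear_combination (eulerCoeff h z) * h1 + incr h z * h4

/-- At zero offset the Hadamard quotients are the partial derivatives of `h`, so their difference
has order one, and the coordinate in front supplies the second order. -/
theorem vanishOrder_eulerCoeff : VanishOrder 2 (eulerCoeff h) := by
  have h1 : ∀ i, VanishOrder 1 (fun z => incrQuot h i z - dh h i z) := fun i =>
    VanishOrder.of_apply_zero ((contDiff_incrQuot hh i).sub (contDiff_dh hh i))
      (by simp [incrQuot_zero hh])
  have h2 : VanishOrder 2 (fun z : E2 × E2 => ∑ i, z.1 i * (incrQuot h i z - dh h i z)) :=
    VanishOrder.sum fun i => (h1 i).coord_mul i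
  have h3 : ContDiff ℝ ∞ (fun z => (slopeDet h z)⁻¹) :=
    (contDiff_slopeDet hh).inv fun z => (slopeDet_pos hh hs z).ne'
  have := h2.smul h3
  convert this using 2 with z
  rw [eulerCoeff, div_eq_inv_mul]

theorem contDiff_eulerField (j : Fin 2) : ContDiff ℝ ∞ (eulerField h j) :=
  (contDiff_coord j).add ((vanishOrder_eulerCoeff hh hs).contDiff.mul (contDiff_incrQuot hh j))

/-- The Euler field of the plane has divergence 2, so half the divergence of G z is G plus a
first-order term. The correction by `eulerCoeff` has order two and keeps order one after a
derivative. Dimension two is what makes the leading term exactly `G`. -/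
theorem vanishOrder_half_div_sub {G : E2 × E2 → ℝ} (hG : ContDiff ℝ ∞ G) :
    VanishOrder 1 (fun z => 1 / 2 * ∑ j, dv j (fun z => G z * eulerField h j z) z - G z) := by
  have h1 : ∀ j, VanishOrder 1 (dv j (fun z => (G z * incrQuot h j z) * eulerCoeff h z)) :=
    fun j => ((vanishOrder_eulerCoeff hh hs).smul (hG.mul (contDiff_incrQuot hh j))).dv j
  have h2 : ∀ j, VanishOrder 1 (fun z : E2 × E2 => z.1 j * dv j G z) := fun j =>
    VanishOrder.coord_mul (k := 0) (contDiff_dv hG j) j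
  have h3 := ((VanishOrder.sum h1).add (VanishOrder.sum h2)).smul
    (contDiff_const (c := (1 / 2 : ℝ)))
  convert h3 using 2 with z
  have e : ∀ j, dv j (fun z => G z * eulerField h j z) z
      = z.1 j * dv j G z + G z + dv j (fun z => (G z * incrQuot h j z) * eulerCoeff h z) z := by
    intro j
    have : (fun z => G z * eulerField h j z)
        = fun z => z.1 j * G z + (G z * incrQuot h j z) * eulerCoeff h z := by
      funext z; simp only [eulerField]; ring
    rw [this, dv_add ((contDiff_coord j).mul hG)
      ((hG.mul (contDiff_incrQuot hh j)).mul (vanishOrder_eulerCoeff hh hs).contDiff),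
      dv_mul (contDiff_coord j) hG, dv_coord]
    simp
  simp only [e, Fin.sum_univ_two]
  ring

omit hs in
theorem hasFDerivAt_graphSq_slice (b v : E2) :
    HasFDerivAt (fun v => graphSq h (v, b))
      ((2 : ℝ) • innerSL ℝ v + (2 * incr h (v, b)) • fderiv ℝ h (b + v)) v := by
  have h1 : HasFDerivAt (fun v : E2 => ‖v‖ ^ 2) ((2 : ℝ) • innerSL ℝ v) v := by
    have := (hasStrictFDerivAt_norm_sq v).hasFDerivAt
    rwa [← Nat.cast_smul_eq_nsmul ℝ] at this
  have h2 : HasFDerivAt (fun v => incr h (v, b)) (fderiv ℝ h (b + v)) v := by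
    have := (hasFDerivAt_of_contDiff hh (b + v)).comp v ((hasFDerivAt_id v).const_add b)
    simpa [incr] using this.sub_const (h b)
  have h3 := h1.fun_add (h2.pow 2)
  have e : (fun v => graphSq h (v, b)) = fun v => ‖v‖ ^ 2 + incr h (v, b) ^ 2 := rfl
  rw [e]
  exact h3.congr_fderiv (by simp)

end GraphGaussian

theorem integrable_slice {g : E2 × E2 → ℝ} (hg : Continuous g) {R : ℝ}
    (hR : ∀ z : E2 × E2, R < ‖z.1‖ → g z = 0) (b : E2) {e : E2 → ℝ} (he : Continuous e) :
    Integrable (fun v => g (v, b) * e v) := by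
  refine Continuous.integrable_of_hasCompactSupport (by fun_prop) ?_
  refine HasCompactSupport.of_support_subset_isCompact (isCompact_closedBall (0 : E2) R) ?_
  intro v hv
  rw [mem_closedBall_zero_iff]
  by_contra hlt
  exact hv (by simp [hR (v, b) (not_le.1 hlt)])

/-- The Gaussian integral of `g` over the graph of `h`, centred over `b`. -/
noncomputable def gaussInt (h : E2 → ℝ) (g : E2 × E2 → ℝ) (b : E2) (τ : ℝ) : ℝ :=
  ∫ v, g (v, b) * Real.exp (-graphSq h (v, b) / τ)

section GraphGaussian

variable {h : E2 → ℝ} (hh : ContDiff ℝ ∞ h) (hs : ∀ a, ‖fderiv ℝ h a‖ ≤ 1 / 2)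

include hh

theorem continuous_gauss (b : E2) (τ : ℝ) :
    Continuous fun v => Real.exp (-graphSq h (v, b) / τ) := by
  have := (contDiff_graphSq hh).continuous
  fun_prop

/-- The j-th derivative of exp(-`graphSq`/τ) is -(2/τ) `halfGrad` j times itself; integrate by
parts, with no boundary term because `A` has bounded support in the offset. -/
theorem gaussInt_halfGrad_mul {A : E2 × E2 → ℝ} (hA : ContDiff ℝ ∞ A) {R : ℝ}
    (hR : ∀ z : E2 × E2, R < ‖z.1‖ → A z = 0) (j : Fin 2) (b : E2) {τ : ℝ} (hτ : 0 < τ) :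
    gaussInt h (fun z => halfGrad h j z * A z) b τ
      = τ * gaussInt h (fun z => 1 / 2 * dv j A z) b τ := by
  have hf : ∀ v, HasFDerivAt (fun v => Real.exp (-graphSq h (v, b) / τ)) _ v := fun v =>
    (((hasFDerivAt_graphSq_slice hh b v).neg).mul_const (τ⁻¹)).exp
  have hA' : ∀ v, HasFDerivAt (fun v => A (v, b))
      ((fderiv ℝ A (v, b)).comp (ContinuousLinearMap.inl ℝ E2 E2)) v := fun v =>
    (hasFDerivAt_of_contDiff hA (v, b)).comp v (hasFDerivAt_prodMk_left v b)
  have e1 : ∀ v, fderiv ℝ (fun v => Real.exp (-graphSq h (v, b) / τ)) v (planeBasis j)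
      = -(2 / τ) * (halfGrad h j (v, b) * Real.exp (-graphSq h (v, b) / τ)) := by
    intro v
    rw [(hf v).fderiv]
    simp [halfGrad, dh, EuclideanSpace.inner_single_right]
    ring_nf
  have e2 : ∀ v, fderiv ℝ (fun v => A (v, b)) v (planeBasis j) = dv j A (v, b) := by
    intro v
    rw [(hA' v).fderiv]
    simp [dv]
  have hcw : Continuous (halfGrad h j) :=
    (contDiff_coord j).continuous.add
      ((contDiff_incr hh).continuous.mul (contDiff_dh hh j).continuous)
  have ibp := integral_mul_fderiv_eq_neg_fderiv_mul_of_integrable (μ := (volume : Measure E2))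
    (f := fun v => A (v, b)) (g := fun v => Real.exp (-graphSq h (v, b) / τ))
    (v := planeBasis j) ?_ ?_ ?_ (fun v _ => (hA' v).differentiableAt)
    (fun v _ => (hf v).differentiableAt)
  · simp only [e1, e2] at ibp
    have e3 : (∫ v, A (v, b) * (-(2 / τ) *
        (halfGrad h j (v, b) * Real.exp (-graphSq h (v, b) / τ))))
        = -(2 / τ) * gaussInt h (fun z => halfGrad h j z * A z) b τ := by
      rw [gaussInt, ← integral_const_mul]
      congr 1; funext v; ring
    have e4 : gaussInt h (fun z => 1 / 2 * dv j A z) b τ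
        = 1 / 2 * ∫ v, dv j A (v, b) * Real.exp (-graphSq h (v, b) / τ) := by
      rw [gaussInt, ← integral_const_mul]
      congr 1; funext v; ring
    rw [e3] at ibp
    rw [e4]
    field_simp at ibp ⊢
    linarith
  · simp only [e2]
    exact integrable_slice (contDiff_dv hA j).continuous
      (fun z hz => dv_eq_zero_of_support hR j z hz) b (continuous_gauss hh b τ)
  · simp only [e1]
    refine integrable_slice hA.continuous hR b ?_
    have := continuous_gauss hh b τ
    fun_prop
  · exact integrable_slice hA.continuous hR b (continuous_gauss hh b τ)

theorem gaussInt_add {g₁ g₂ : E2 × E2 → ℝ} (h₁ : Continuous g₁) (h₂ : Continuous g₂) {R : ℝ}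
    (hR₁ : ∀ z : E2 × E2, R < ‖z.1‖ → g₁ z = 0) (hR₂ : ∀ z : E2 × E2, R < ‖z.1‖ → g₂ z = 0)
    (b : E2) (τ : ℝ) :
    gaussInt h (fun z => g₁ z + g₂ z) b τ = gaussInt h g₁ b τ + gaussInt h g₂ b τ := by
  simp only [gaussInt, add_mul]
  exact integral_add (integrable_slice h₁ hR₁ b (continuous_gauss hh b τ))
    (integrable_slice h₂ hR₂ b (continuous_gauss hh b τ))

theorem gaussInt_sum_halfGrad_mul {A : Fin 2 → E2 × E2 → ℝ} (hA : ∀ j, ContDiff ℝ ∞ (A j)) {R : ℝ}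
    (hR : ∀ j, ∀ z : E2 × E2, R < ‖z.1‖ → A j z = 0) (b : E2) {τ : ℝ} (hτ : 0 < τ) :
    gaussInt h (fun z => ∑ j, halfGrad h j z * A j z) b τ
      = τ * gaussInt h (fun z => ∑ j, 1 / 2 * dv j (A j) z) b τ := by
  have hcw : ∀ j, Continuous (halfGrad h j) := fun j =>
    (contDiff_coord j).continuous.add
      ((contDiff_incr hh).continuous.mul (contDiff_dh hh j).continuous)
  have hcA := fun j => (hA j).continuous
  have hcd := fun j => (contDiff_dv (hA j) j).continuous
  have hd := fun j => dv_eq_zero_of_support (hR j) j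
  simp only [Fin.sum_univ_two]
  rw [gaussInt_add hh (R := R) (by fun_prop) (by fun_prop) (fun z hz => by simp [hR 0 z hz])
      (fun z hz => by simp [hR 1 z hz]),
    gaussInt_add hh (R := R) (by fun_prop) (by fun_prop) (fun z hz => by simp [hd 0 z hz])
      (fun z hz => by simp [hd 1 z hz]),
    gaussInt_halfGrad_mul hh (hA 0) (hR 0) 0 b hτ, gaussInt_halfGrad_mul hh (hA 1) (hR 1) 1 b hτ]
  ring

include hs

/-- Gaussian integration by parts: two orders of vanishing yield one factor `τ`. -/
theorem exists_gaussInt_eq_mul {k : ℕ} {N : E2 × E2 → ℝ} (hN : VanishOrderBdd (k + 1) N) :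
    ∃ N', VanishOrderBdd (k - 1) N' ∧
      ∀ b τ, 0 < τ → gaussInt h N b τ = τ * gaussInt h N' b τ := by
  obtain ⟨⟨q, hq, hNq⟩, R, hR⟩ := hN
  obtain ⟨η, hη, hη1, R', hη0⟩ := exists_plane_cutoff R
  have hη' : ContDiff ℝ ∞ (fun z : E2 × E2 => η z.1) := hη.comp contDiff_fst
  -- The quotients `q` of `N` need not have bounded support. The cutoff `η`, equal to one on the
  -- support of `N`, leaves `N` unchanged and makes `A` admissible for integration by parts.
  set A : Fin 2 → E2 × E2 → ℝ := fun j z => ∑ i, (η z.1 * invMat h i j z) * q i z with hAdef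
  have hA : ∀ j, VanishOrder k (A j) := fun j => VanishOrder.sum fun i =>
    (hq i).smul (hη'.mul (contDiff_invMat hh hs i j))
  have hAR : ∀ j, ∀ z : E2 × E2, R' < ‖z.1‖ → A j z = 0 := fun j z hz => by
    simp [hAdef, hη0 z.1 hz]
  refine ⟨fun z => ∑ j, 1 / 2 * dv j (A j) z, ⟨?_, R', fun z hz => ?_⟩, fun b τ hτ => ?_⟩
  · exact VanishOrder.sum fun j => ((hA j).dv j).smul contDiff_const
  · simp [dv_eq_zero_of_support (hAR _) _ z hz]
  · rw [← gaussInt_sum_halfGrad_mul hh (fun j => (hA j).contDiff) hAR b hτ]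
    congr 1
    funext z
    have e0 : N z = η z.1 * N z := by
      by_cases hz : ‖z.1‖ ≤ R
      · rw [hη1 _ hz, one_mul]
      · rw [hR z (not_le.1 hz), mul_zero]
    have c0 := coord_eq_sum hh hs 0 z
    have c1 := coord_eq_sum hh hs 1 z
    rw [e0, hNq z]
    simp only [hAdef, Fin.sum_univ_two] at *
    linear_combination η z.1 * q 0 z * c0 + η z.1 * q 1 z * c1

/-- The decomposition of `graphSq` by `eulerField` gains a factor τ from the weight itself, so `G`
need not vanish anywhere. -/
theorem gaussInt_graphSq_mul {G : E2 × E2 → ℝ} (hG : ContDiff ℝ ∞ G) {R : ℝ}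
    (hR : ∀ z : E2 × E2, R < ‖z.1‖ → G z = 0) (b : E2) {τ : ℝ} (hτ : 0 < τ) :
    gaussInt h (fun z => graphSq h z * G z) b τ
      = τ * gaussInt h (fun z => ∑ j, 1 / 2 * dv j (fun z => G z * eulerField h j z) z) b τ := by
  rw [← gaussInt_sum_halfGrad_mul hh (A := fun j z => G z * eulerField h j z) (R := R)
    (fun j => hG.mul (contDiff_eulerField hh hs j)) (fun j z hz => by simp [hR z hz]) b hτ]
  congr 1
  funext z
  rw [← sum_halfGrad_mul_eulerField hh hs z, Finset.sum_mul]
  exact Finset.sum_congr rfl fun j _ => by ring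

omit hs in
theorem hasDerivAt_gaussInt {g : E2 × E2 → ℝ} (hg : Continuous g) {R : ℝ}
    (hR : ∀ z : E2 × E2, R < ‖z.1‖ → g z = 0) (b : E2) {τ : ℝ} (hτ : 0 < τ) :
    HasDerivAt (gaussInt h g b) (gaussInt h (fun z => graphSq h z * g z) b τ / τ ^ 2) τ := by
  have hσ := (contDiff_graphSq hh).continuous
  have hσ0 : ∀ z, 0 ≤ graphSq h z := fun z => by unfold graphSq; positivity
  have key := hasDerivAt_integral_of_dominated_loc_of_deriv_le (μ := (volume : Measure E2))
    (F := fun (τ : ℝ) v => g (v, b) * Real.exp (-graphSq h (v, b) / τ))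
    (F' := fun (τ : ℝ) v => g (v, b) *
      (Real.exp (-graphSq h (v, b) / τ) * (graphSq h (v, b) / τ ^ 2)))
    (bound := fun v => |g (v, b)| * (graphSq h (v, b) * (τ / 2)⁻¹ ^ 2))
    (x₀ := τ) (s := Ioi (τ / 2)) (Ioi_mem_nhds (by linarith))
    ?_ ?_ ?_ ?_ ?_ ?_
  · have := key.2
    refine this.congr_deriv ?_
    rw [gaussInt, ← integral_div]
    congr 1; funext v; ring
  · refine Eventually.of_forall fun t => ?_
    exact (integrable_slice hg hR b (continuous_gauss hh b t)).aestronglyMeasurable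
  · exact integrable_slice hg hR b (continuous_gauss hh b τ)
  · have := continuous_gauss hh b τ
    exact (integrable_slice hg hR b (by fun_prop)).aestronglyMeasurable
  · refine Eventually.of_forall fun v t ht => ?_
    have ht' : τ / 2 < t := ht
    have ht0 : 0 < t := by linarith
    rw [norm_mul, Real.norm_eq_abs]
    gcongr
    rw [norm_mul, Real.norm_of_nonneg (Real.exp_pos _).le,
      Real.norm_of_nonneg (div_nonneg (hσ0 _) (by positivity))]
    have h1 : Real.exp (-graphSq h (v, b) / t) ≤ 1 := by
      rw [Real.exp_le_one_iff]
      exact div_nonpos_of_nonpos_of_nonneg (by linarith [hσ0 (v, b)]) ht0.le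
    have h2 : graphSq h (v, b) / t ^ 2 ≤ graphSq h (v, b) * (τ / 2)⁻¹ ^ 2 := by
      rw [div_eq_mul_inv, ← inv_pow]
      have := hσ0 (v, b)
      gcongr
    calc _ ≤ 1 * (graphSq h (v, b) / t ^ 2) := by
          gcongr; exact div_nonneg (hσ0 _) (by positivity)
      _ ≤ _ := by rw [one_mul]; exact h2
  · exact integrable_slice (g := fun z => |g z|) (by fun_prop) (R := R)
      (fun z hz => by simp [hR z hz]) b (by fun_prop)
  · refine Eventually.of_forall fun v t ht => ?_
    have ht' : τ / 2 < t := ht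
    have ht0 : t ≠ 0 := by intro h0; rw [h0] at ht'; linarith
    have h1 : HasDerivAt (fun t : ℝ => -graphSq h (v, b) / t) (graphSq h (v, b) / t ^ 2) t := by
      have := (hasDerivAt_inv ht0).const_mul (-graphSq h (v, b))
      simp only [← div_eq_mul_inv] at this
      exact this.congr_deriv (by field_simp)
    exact (h1.exp).const_mul _

/-- With D half the divergence of G times the Euler field, the derivative of ∫ G e / τ is (∫ D e - ∫
G e)/τ². Since D - G vanishes to first order, one more integration by parts yields the factor τ that
brings this back to the form ∫ G' e / τ. -/
theorem exists_hasDerivAt_gaussInt_div {k : ℕ} {G : E2 × E2 → ℝ} (hG : VanishOrderBdd k G) :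
    ∃ G', VanishOrderBdd 0 G' ∧ ∀ b τ, 0 < τ →
      HasDerivAt (fun τ => gaussInt h G b τ / τ) (gaussInt h G' b τ / τ) τ := by
  obtain ⟨hGk, R, hR⟩ := hG
  have hGc := hGk.contDiff
  set D : E2 × E2 → ℝ := fun z =>
    ∑ j, 1 / 2 * dv j (fun z => G z * eulerField h j z) z with hD
  have hDc : Continuous D := continuous_finsetSum _ fun j _ => continuous_const.mul
    (contDiff_dv (hGc.mul (contDiff_eulerField hh hs j)) j).continuous
  have hDR : ∀ z : E2 × E2, R < ‖z.1‖ → D z = 0 := fun z hz => by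
    have := fun j => dv_eq_zero_of_support (g := fun z => G z * eulerField h j z) (R := R)
      (fun z hz => by simp [hR z hz]) j z hz
    simp [hD, this]
  have h1 : VanishOrderBdd 1 (fun z => D z + -1 * G z) := by
    refine ⟨?_, R, fun z hz => by simp [hDR z hz, hR z hz]⟩
    convert vanishOrder_half_div_sub hh hs hGc using 2 with z
    simp only [hD, ← Finset.mul_sum]
    ring
  -- This is the case k = 0: a single order of vanishing already gives a factor τ when nothing is
  -- asked of the new weight.
  obtain ⟨G', hG', hGe⟩ := exists_gaussInt_eq_mul hh hs h1
  refine ⟨G', hG', fun b τ hτ => ?_⟩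
  have h2 := (hasDerivAt_gaussInt hh hGc.continuous hR b hτ).fun_div (hasDerivAt_id τ) hτ.ne'
  refine h2.congr_deriv ?_
  rw [gaussInt_graphSq_mul hh hs hGc hR b hτ]
  have h3 := hGe b τ hτ
  rw [gaussInt_add hh (g₂ := fun z => -1 * G z) hDc (continuous_const.mul hGc.continuous) hDR
    (fun z hz => by simp [hR z hz])] at h3
  have h4 : gaussInt h (fun z => -1 * G z) b τ = - gaussInt h G b τ := by
    simp only [gaussInt, neg_mul, one_mul, integral_neg]
  rw [h4] at h3
  simp only [id]
  rw [mul_comm τ (gaussInt h G' b τ)] at h3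
  rw [← hD]
  field_simp
  linear_combination h3

theorem exists_gaussInt_eq_pow_mul (m : ℕ) : ∀ {N : E2 × E2 → ℝ}, VanishOrderBdd (2 * m) N →
    ∃ N', VanishOrderBdd 0 N' ∧ ∀ b τ, 0 < τ → gaussInt h N b τ = τ ^ m * gaussInt h N' b τ := by
  induction m with
  | zero => exact fun {N} hN => ⟨N, hN, by simp⟩
  | succ m ih =>
    intro N hN
    -- Here 2(m+1) is read as k + 1 with k = 2m + 1, so the new weight has order k - 1 = 2m.
    obtain ⟨N₁, h₁, e₁⟩ := exists_gaussInt_eq_mul hh hs (k := 2 * m + 1) hN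
    obtain ⟨N₂, h₂, e₂⟩ := ih h₁
    exact ⟨N₂, h₂, fun b τ hτ => by rw [e₁ b τ hτ, e₂ b τ hτ, pow_succ']; ring⟩

omit hs hh in
-- `graphSq` dominates the squared planar distance, and the planar Gaussian exp(-‖v‖²/τ) has
-- integral πτ, which cancels the division by τ.
theorem abs_gaussInt_div_le {G : E2 × E2 → ℝ} (hG : VanishOrderBdd 0 G) {K : Set E2}
    (hK : IsCompact K) : ∃ C, ∀ b ∈ K, ∀ τ, 0 < τ → |gaussInt h G b τ / τ| ≤ C := by
  obtain ⟨hGc, R, hR⟩ := hG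
  obtain ⟨C, hC⟩ := ((isCompact_closedBall (0 : E2) R).prod hK).exists_bound_of_continuousOn
    (ContDiff.continuous hGc).continuousOn
  refine ⟨|C| * Real.pi, fun b hb τ hτ => ?_⟩
  have hgi : ∫ v : E2, Real.exp (-τ⁻¹ * ‖v‖ ^ 2) = Real.pi * τ := by
    rw [GaussianFourier.integral_rexp_neg_mul_sq_norm (inv_pos.2 hτ)]
    simp
  -- Integrability is read off from the nonzero value: a non-integrable function would have integral
  -- zero.
  have hint : Integrable fun v : E2 => Real.exp (-τ⁻¹ * ‖v‖ ^ 2) := by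
    by_contra hni
    rw [integral_undef hni] at hgi
    have : 0 < Real.pi * τ := by positivity
    linarith
  have hle : |gaussInt h G b τ| ≤ ∫ v : E2, |C| * Real.exp (-τ⁻¹ * ‖v‖ ^ 2) := by
    rw [← Real.norm_eq_abs]
    refine norm_integral_le_of_norm_le (hint.const_mul _) (Eventually.of_forall fun v => ?_)
    rw [norm_mul, Real.norm_of_nonneg (Real.exp_pos _).le]
    gcongr
    · by_cases hv : ‖v‖ ≤ R
      · exact (hC (v, b) ⟨by simpa using hv, hb⟩).trans (le_abs_self C)
      · rw [hR (v, b) (not_le.1 hv)]; simp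
    · have : 0 ≤ incr h (v, b) ^ 2 := sq_nonneg _
      rw [graphSq, div_eq_inv_mul]
      have : 0 ≤ τ⁻¹ * incr h (v, b) ^ 2 := by positivity
      linarith
  rw [integral_const_mul, hgi] at hle
  rw [abs_div, abs_of_pos hτ, div_le_iff₀ hτ]
  linarith

end GraphGaussian

/-- The second derivative in `τ` of `exp (-s / τ) / τ ^ m`. -/
noncomputable def gaussKer (m : ℕ) (s τ : ℝ) : ℝ :=
  ((s / τ) ^ 2 - (2 * m + 2) * (s / τ) + m * (m + 1)) * Real.exp (-s / τ) / τ ^ (m + 2)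

theorem eq_of_hasDerivAt_of_eq_on_Ioi {f g : ℝ → ℝ} {f' g' τ : ℝ} (hτ : 0 < τ)
    (hfg : ∀ t, 0 < t → f t = g t) (hf : HasDerivAt f f' τ) (hg : HasDerivAt g g' τ) :
    f' = g' := by
  refine hf.unique (hg.congr_of_eventuallyEq ?_)
  filter_upwards [Ioi_mem_nhds hτ] with t ht using hfg t ht

/-! ### Second derivatives in τ of Gaussian integrals over a graph. -/

section GraphGaussian

variable {h : E2 → ℝ} (hh : ContDiff ℝ ∞ h) (hs : ∀ a, ‖fderiv ℝ h a‖ ≤ 1 / 2)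

include hh

theorem hasDerivAt_gaussInt_div_pow {g : E2 × E2 → ℝ} (hg : Continuous g) {R : ℝ}
    (hR : ∀ z : E2 × E2, R < ‖z.1‖ → g z = 0) (b : E2) (k : ℕ) {τ : ℝ} (hτ : 0 < τ) :
    HasDerivAt (fun τ => gaussInt h g b τ / τ ^ k)
      (gaussInt h (fun z => graphSq h z * g z) b τ / τ ^ (k + 2)
        - k * (gaussInt h g b τ / τ ^ (k + 1))) τ := by
  have h1 := (hasDerivAt_gaussInt hh hg hR b hτ).fun_div (hasDerivAt_pow k τ) (by positivity)
  refine h1.congr_deriv ?_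
  rcases k with _ | k
  · simp
  · simp only [Nat.add_sub_cancel]
    field_simp
    ring

/-- The right-hand side is grouped as it arises from applying `hasDerivAt_gaussInt_div_pow` twice to
the Gaussian integral divided by τ^m, so it can be matched directly with a derivative. -/
theorem integral_mul_gaussKer {N : E2 × E2 → ℝ} (hN : Continuous N) {R : ℝ}
    (hR : ∀ z : E2 × E2, R < ‖z.1‖ → N z = 0) (b : E2) (m : ℕ) {τ : ℝ} (hτ : 0 < τ) :
    ∫ v, N (v, b) * gaussKer m (graphSq h (v, b)) τ =
      (gaussInt h (fun z => graphSq h z * (graphSq h z * N z)) b τ / τ ^ (m + 2 + 2)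
        - (m + 2 : ℕ) * (gaussInt h (fun z => graphSq h z * N z) b τ / τ ^ (m + 2 + 1)))
      - m * (gaussInt h (fun z => graphSq h z * N z) b τ / τ ^ (m + 1 + 2)
        - (m + 1 : ℕ) * (gaussInt h N b τ / τ ^ (m + 1 + 1))) := by
  have hσ := (contDiff_graphSq hh).continuous
  have he := continuous_gauss hh b τ
  have i0 := integrable_slice hN hR b he
  have i1 := integrable_slice (g := fun z => graphSq h z * N z) (R := R) (by fun_prop)
    (fun z hz => by simp [hR z hz]) b he
  have i2 := integrable_slice (g := fun z => graphSq h z * (graphSq h z * N z)) (R := R)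
    (by fun_prop) (fun z hz => by simp [hR z hz]) b he
  have e : ∀ v, N (v, b) * gaussKer m (graphSq h (v, b)) τ =
      (1 / τ ^ (m + 4)) * ((graphSq h (v, b) * (graphSq h (v, b) * N (v, b)))
        * Real.exp (-graphSq h (v, b) / τ))
      - ((2 * m + 2) / τ ^ (m + 3)) * ((graphSq h (v, b) * N (v, b))
        * Real.exp (-graphSq h (v, b) / τ))
      + (m * (m + 1) / τ ^ (m + 2)) * (N (v, b) * Real.exp (-graphSq h (v, b) / τ)) := by
    intro v
    simp only [gaussKer]
    field_simp
    ring
  simp only [e]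
  rw [integral_add (Integrable.sub' (i2.const_mul _) (i1.const_mul _)) (i0.const_mul _),
    integral_sub (i2.const_mul _) (i1.const_mul _), integral_const_mul, integral_const_mul,
    integral_const_mul]
  simp only [gaussInt]
  push_cast
  ring

include hs

/-- The 2n orders of vanishing turn the Gaussian integral of `N` over τ^(n+1) into one of `N₁` over
τ, and that form survives two derivatives. Uniqueness of derivatives identifies the result with the
kernel integral. -/
theorem exists_integral_mul_gaussKer_eq (n : ℕ) {N : E2 × E2 → ℝ}
    (hN : VanishOrderBdd (2 * n) N) :
    ∃ G, VanishOrderBdd 0 G ∧ ∀ b τ, 0 < τ →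
      ∫ v, N (v, b) * gaussKer (n + 1) (graphSq h (v, b)) τ = gaussInt h G b τ / τ := by
  obtain ⟨N₁, hN₁, e₁⟩ := exists_gaussInt_eq_pow_mul hh hs n hN
  obtain ⟨N₂, hN₂, e₂⟩ := exists_hasDerivAt_gaussInt_div hh hs hN₁
  obtain ⟨N₃, hN₃, e₃⟩ := exists_hasDerivAt_gaussInt_div hh hs hN₂
  refine ⟨N₃, hN₃, fun b τ hτ => ?_⟩
  obtain ⟨hNk, R, hR⟩ := hN
  have hNc := hNk.contDiff.continuous
  have hσ := (contDiff_graphSq hh).continuous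
  have hc1 : Continuous (fun z => graphSq h z * N z) := by fun_prop
  have hR1 : ∀ z : E2 × E2, R < ‖z.1‖ → graphSq h z * N z = 0 := fun z hz => by simp [hR z hz]
  have d1 : ∀ t, 0 < t → gaussInt h (fun z => graphSq h z * N z) b t / t ^ (n + 1 + 2)
      - (n + 1 : ℕ) * (gaussInt h N b t / t ^ (n + 1 + 1)) = gaussInt h N₂ b t / t := by
    intro t ht
    refine eq_of_hasDerivAt_of_eq_on_Ioi ht (fun s hs => ?_)
      (hasDerivAt_gaussInt_div_pow hh hNc hR b (n + 1) ht) (e₂ b t ht)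
    rw [e₁ b s hs, pow_succ]
    field_simp
  have d2 := (hasDerivAt_gaussInt_div_pow hh hc1 hR1 b (n + 1 + 2) hτ).fun_sub
    ((hasDerivAt_gaussInt_div_pow hh hNc hR b (n + 1 + 1) hτ).const_mul ((n + 1 : ℕ) : ℝ))
  rw [integral_mul_gaussKer hh hNc hR b (n + 1) hτ]
  exact eq_of_hasDerivAt_of_eq_on_Ioi hτ d1 d2 (e₃ b τ hτ)

theorem abs_integral_mul_gaussKer_le (n : ℕ) {N : E2 × E2 → ℝ}
    (hN : VanishOrderBdd (2 * n) N) {K : Set E2} (hK : IsCompact K) :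
    ∃ C, ∀ b ∈ K, ∀ τ, 0 < τ →
      |∫ v, N (v, b) * gaussKer (n + 1) (graphSq h (v, b)) τ| ≤ C := by
  obtain ⟨G, hG, e⟩ := exists_integral_mul_gaussKer_eq hh hs n hN
  obtain ⟨C, hC⟩ := abs_gaussInt_div_le (h := h) hG hK
  exact ⟨C, fun b hb τ hτ => by rw [e b τ hτ]; exact hC b hb τ hτ⟩

end GraphGaussian

/-! ### The area formula for graphs -/

/-- The assignment g(a) ↦ f(a) is well defined and K-Lipschitz on the image of g, so neither map has
to be injective. -/
theorem hausdorffMeasure_image_le_of_dist_le {α X Y : Type*} [MetricSpace X]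
    [MeasurableSpace X] [BorelSpace X] [MetricSpace Y] [MeasurableSpace Y] [BorelSpace Y]
    {f : α → X} {g : α → Y} {s : Set α} {K : NNReal}
    (h : ∀ a ∈ s, ∀ b ∈ s, dist (f a) (f b) ≤ K * dist (g a) (g b)) (d : ℕ) :
    μH[d] (f '' s) ≤ (K : ENNReal) ^ d * μH[d] (g '' s) := by
  rcases s.eq_empty_or_nonempty with rfl | ⟨a₀, ha₀⟩
  · simp
  have : Nonempty α := ⟨a₀⟩
  set φ : Y → X := fun y => f (Function.invFunOn g s y) with hφ
  have hmem : ∀ y ∈ g '' s, Function.invFunOn g s y ∈ s ∧ g (Function.invFunOn g s y) = y :=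
    fun y hy => ⟨Function.invFunOn_mem hy, Function.invFunOn_eq hy⟩
  have hL : LipschitzOnWith K φ (g '' s) := by
    refine LipschitzOnWith.of_dist_le_mul fun y hy z hz => ?_
    have := h _ (hmem y hy).1 _ (hmem z hz).1
    rwa [(hmem y hy).2, (hmem z hz).2] at this
  have himg : f '' s ⊆ φ '' (g '' s) := by
    rintro _ ⟨a, ha, rfl⟩
    have hga : g a ∈ g '' s := ⟨a, ha, rfl⟩
    refine ⟨g a, hga, ?_⟩
    -- The chosen preimage of g a may differ from a, but both have the same image under g, so the
    -- distance bound forces equal values of f.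
    have := h _ (hmem _ hga).1 a ha
    rw [(hmem _ hga).2, dist_self, mul_zero] at this
    exact dist_le_zero.1 this
  have := hL.hausdorffMeasure_image_le (d := d) (by positivity)
  rw [ENNReal.rpow_natCast] at this
  exact (measure_mono himg).trans this

theorem euclideanHausdorffMeasure_image_le_of_dist_le {α X Y : Type*} [MetricSpace X]
    [MeasurableSpace X] [BorelSpace X] [MetricSpace Y] [MeasurableSpace Y] [BorelSpace Y]
    {f : α → X} {g : α → Y} {s : Set α} {K : NNReal}
    (h : ∀ a ∈ s, ∀ b ∈ s, dist (f a) (f b) ≤ K * dist (g a) (g b)) (d : ℕ) :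
    μHE[d] (f '' s) ≤ (K : ENNReal) ^ d * μHE[d] (g '' s) := by
  simp only [Measure.euclideanHausdorffMeasure_def, Measure.smul_apply, ENNReal.smul_def,
    smul_eq_mul]
  rw [mul_left_comm]
  gcongr
  exact hausdorffMeasure_image_le_of_dist_le h d

/-- Second countability gives a countable subcover; making it disjoint reduces the comparison to a
termwise inequality of sums. -/
theorem measure_le_of_locally_le {X : Type*} [TopologicalSpace X] [SecondCountableTopology X]
    [MeasurableSpace X] [OpensMeasurableSpace X] {μ ν : Measure X}
    (h : ∀ x, ∃ U ∈ 𝓝 x, ∀ A ⊆ U, MeasurableSet A → μ A ≤ ν A) : μ ≤ ν := by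
  rcases isEmpty_or_nonempty X with hX | hX
  · exact Measure.le_iff.2 fun A _ => by simp [Set.eq_empty_of_isEmpty A]
  choose U hU hle using h
  obtain ⟨s, hs, hcov⟩ := TopologicalSpace.countable_cover_nhds
    (fun x => interior_mem_nhds.2 (hU x))
  have hne : s.Nonempty := by
    by_contra hemp
    rw [not_nonempty_iff_eq_empty] at hemp
    simp only [hemp, biUnion_empty] at hcov
    exact empty_ne_univ hcov
  obtain ⟨e, he⟩ := hs.exists_eq_range hne
  set D : ℕ → Set X := disjointed fun n => interior (U (e n)) with hD
  have hDm : ∀ n, MeasurableSet (D n) :=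
    fun n => MeasurableSet.disjointed (fun i => isOpen_interior.measurableSet) n
  have hDu : ⋃ n, D n = univ := by
    rw [hD, iUnion_disjointed, ← hcov, he, biUnion_range]
  refine Measure.le_iff.2 fun A hA => ?_
  have hdec : A = ⋃ n, A ∩ D n := by rw [← inter_iUnion, hDu, inter_univ]
  have hdisj : Pairwise (Function.onFun Disjoint fun n => A ∩ D n) := fun i j hij =>
    ((disjoint_disjointed _) hij).mono inter_subset_right inter_subset_right
  rw [hdec, measure_iUnion hdisj fun n => hA.inter (hDm n),
    measure_iUnion hdisj fun n => hA.inter (hDm n)]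
  refine ENNReal.tsum_le_tsum fun n => hle (e n) _ ?_ (hA.inter (hDm n))
  exact inter_subset_right.trans ((disjointed_subset _ _).trans interior_subset)

/-- The symmetric map of the plane that stretches the direction `p` by `√(1 + ‖p‖ ^ 2)`. -/
noncomputable def stretch (p : E2) : E2 →ₗ[ℝ] E2 :=
  LinearMap.id + (1 + √(1 + ‖p‖ ^ 2))⁻¹ • ((innerSL ℝ p : E2 →L[ℝ] ℝ) : E2 →ₗ[ℝ] ℝ).smulRight p

theorem stretch_apply (p v : E2) :
    stretch p v = v + ((1 + √(1 + ‖p‖ ^ 2))⁻¹ * ⟪p, v⟫_ℝ) • p := by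
  simp [stretch, smul_smul]

/-- The coefficient c = 1/(1 + √(1 + ‖p‖²)) solves 2c + c²‖p‖² = 1. The stretched plane is thus
isometric to the tangent plane of slope p, with the plane itself as model space. -/
theorem norm_sq_stretch (p v : E2) : ‖stretch p v‖ ^ 2 = ‖v‖ ^ 2 + ⟪p, v⟫_ℝ ^ 2 := by
  rw [stretch_apply, norm_add_sq_real, norm_smul, mul_pow, inner_smul_right, real_inner_comm p v]
  have hs : √(1 + ‖p‖ ^ 2) ^ 2 = 1 + ‖p‖ ^ 2 := Real.sq_sqrt (by positivity)
  have hs0 : 0 ≤ √(1 + ‖p‖ ^ 2) := Real.sqrt_nonneg _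
  set s := √(1 + ‖p‖ ^ 2)
  rw [Real.norm_eq_abs, sq_abs]
  have hp : ‖p‖ ^ 2 = s ^ 2 - 1 := by linarith
  rw [hp]
  field_simp
  ring

theorem det_stretch (p : E2) : LinearMap.det (stretch p) = √(1 + ‖p‖ ^ 2) := by
  rw [← LinearMap.det_toMatrix (EuclideanSpace.basisFun (Fin 2) ℝ).toBasis, Matrix.det_fin_two]
  simp only [LinearMap.toMatrix_apply, OrthonormalBasis.coe_toBasis, EuclideanSpace.basisFun_apply,
    OrthonormalBasis.coe_toBasis_repr_apply, EuclideanSpace.basisFun_repr, stretch_apply,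
    EuclideanSpace.inner_single_right]
  have hs : √(1 + ‖p‖ ^ 2) ^ 2 = 1 + ‖p‖ ^ 2 := Real.sq_sqrt (by positivity)
  have hs0 : 0 ≤ √(1 + ‖p‖ ^ 2) := Real.sqrt_nonneg _
  have hp : ‖p‖ ^ 2 = p 0 ^ 2 + p 1 ^ 2 := by
    rw [EuclideanSpace.real_norm_sq_eq, Fin.sum_univ_two]
  set s := √(1 + ‖p‖ ^ 2)
  simp
  field_simp
  nlinarith

/-- The area density of the graph of `h`. -/
noncomputable def areaDensity (h : E2 → ℝ) (a : E2) : ℝ := √(1 + ‖gradient h a‖ ^ 2)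

theorem gradient_inner {h : E2 → ℝ} (a v : E2) : ⟪gradient h a, v⟫_ℝ = fderiv ℝ h a v := by
  rw [gradient, InnerProductSpace.toDual_symm_apply]

theorem contDiff_gradient {h : E2 → ℝ} (hh : ContDiff ℝ ∞ h) : ContDiff ℝ ∞ (gradient h) :=
  (InnerProductSpace.toDual ℝ E2).symm.contDiff.comp (hh.fderiv_right (m := ∞) (by simp))

theorem contDiff_areaDensity {h : E2 → ℝ} (hh : ContDiff ℝ ∞ h) :
    ContDiff ℝ ∞ (areaDensity h) :=
  (contDiff_const.add ((contDiff_gradient hh).norm_sq ℝ)).sqrt fun a => by positivity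

theorem areaDensity_pos (h : E2 → ℝ) (a : E2) : 0 < areaDensity h a :=
  Real.sqrt_pos.2 (by positivity)

/-- X and Y play the role of the lengths of two chords over the same planar segment of length n,
with height differences d and e. -/
theorem le_mul_of_sq_eq {n d e η X Y : ℝ} (hη : 0 ≤ η) (hY : 0 ≤ Y)
    (hX2 : X ^ 2 = n ^ 2 + d ^ 2) (hY2 : Y ^ 2 = n ^ 2 + e ^ 2) (hde : |d - e| ≤ η * n) :
    X ≤ (1 + η) * Y := by
  refine abs_le_of_sq_le_sq' ?_ (by positivity) |>.2
  have h1 : |d| ≤ |e| + η * n := by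
    have := abs_sub_abs_le_abs_sub d e
    linarith
  have h2 : d ^ 2 ≤ (|e| + η * n) ^ 2 := by
    rw [← sq_abs d]
    gcongr
  have h3 : |e| ^ 2 = e ^ 2 := sq_abs e
  have h4 : |e| * n ≤ n ^ 2 + e ^ 2 := by nlinarith [sq_nonneg (|e| - n), abs_nonneg e]
  rw [mul_pow, hX2, hY2]
  nlinarith [mul_le_mul_of_nonneg_left h4 hη, mul_nonneg (sq_nonneg η) (sq_nonneg e)]

theorem ENNReal_le_of_forall_pow_mul_le {a b : ENNReal} (n : ℕ)
    (h : ∀ η : ℝ, 0 < η → a ≤ ENNReal.ofReal ((1 + η) ^ n) * b) : a ≤ b := by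
  by_cases hb : b = ⊤
  · simp [hb]
  have h1 : Tendsto (fun η : ℝ => ENNReal.ofReal ((1 + η) ^ n) * b) (𝓝[>] 0) (𝓝 (1 * b)) := by
    refine ENNReal.Tendsto.mul_const ?_ (Or.inr hb)
    have : Tendsto (fun η : ℝ => ENNReal.ofReal ((1 + η) ^ n)) (𝓝 0)
        (𝓝 (ENNReal.ofReal ((1 + 0) ^ n))) :=
      (ENNReal.continuous_ofReal.comp (by fun_prop)).tendsto 0
    simp only [add_zero, one_pow, ENNReal.ofReal_one] at this
    exact this.mono_left nhdsWithin_le_nhds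
  rw [one_mul] at h1
  exact ge_of_tendsto h1 (eventually_mem_nhdsWithin.mono fun η hη => h η hη)

section Area

variable {h : E2 → ℝ} (hh : ContDiff ℝ ∞ h) {ψ : E2 → E3}
  (hψ : ∀ a b, dist (ψ a) (ψ b) ^ 2 = dist a b ^ 2 + (h a - h b) ^ 2)

include hψ

theorem dist_le_dist_graph (a b : E2) : dist a b ≤ dist (ψ a) (ψ b) := by
  refine abs_le_of_sq_le_sq' ?_ dist_nonneg |>.2
  rw [hψ]
  linarith [sq_nonneg (h a - h b)]

theorem injective_graph : Function.Injective ψ := fun a b hab => by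
  have := dist_le_dist_graph hψ a b
  rw [hab, dist_self] at this
  exact dist_le_zero.1 this

include hh

/-- By strict differentiability, chords of the graph near c and their counterparts on the tangent
plane at c agree in length up to a factor 1 + η. This costs (1 + η)² in two-dimensional measure; the
third factor comes from freezing the area density at c. -/
theorem exists_graph_comparison (c : E2) {η : ℝ} (hη : 0 < η) : ∃ U ∈ 𝓝 c, ∀ A ⊆ U,
    MeasurableSet A →
    μHE[2] (ψ '' A) ≤ ENNReal.ofReal ((1 + η) ^ 3) *
      ∫⁻ a in A, ENNReal.ofReal (areaDensity h a) ∧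
    ∫⁻ a in A, ENNReal.ofReal (areaDensity h a) ≤ ENNReal.ofReal ((1 + η) ^ 3) *
      μHE[2] (ψ '' A) := by
  obtain ⟨U₁, hU₁, happ⟩ := ((hh.contDiffAt (x := c)).hasStrictFDerivAt
    (by simp)).approximates_deriv_on_nhds
    (c := ⟨η, hη.le⟩) (Or.inr hη)
  have hJ := (contDiff_areaDensity hh).continuous
  have hJc := areaDensity_pos h c
  have hU₂ : {a | areaDensity h c < (1 + η) * areaDensity h a} ∈ 𝓝 c :=
    (isOpen_lt continuous_const (by fun_prop)).mem_nhds (by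
      change areaDensity h c < (1 + η) * areaDensity h c
      nlinarith)
  have hU₃ : {a | areaDensity h a < (1 + η) * areaDensity h c} ∈ 𝓝 c :=
    (isOpen_lt (by fun_prop) continuous_const).mem_nhds (by
      change areaDensity h c < (1 + η) * areaDensity h c
      nlinarith)
  refine ⟨U₁ ∩ ({a | areaDensity h c < (1 + η) * areaDensity h a} ∩
    {a | areaDensity h a < (1 + η) * areaDensity h c}),
    inter_mem hU₁ (inter_mem hU₂ hU₃), fun A hA hAm => ?_⟩
  set T := stretch (gradient h c) with hT
  have hvol : μHE[2] (T '' A) = ENNReal.ofReal (areaDensity h c) * volume A := by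
    rw [EuclideanSpace.euclideanHausdorffMeasure_eq_volume, Measure.addHaar_image_linearMap,
      hT, det_stretch, abs_of_nonneg (Real.sqrt_nonneg _), areaDensity]
  have hTd : ∀ a b, dist (T a) (T b) ^ 2
      = dist a b ^ 2 + (fderiv ℝ h c (a - b)) ^ 2 := fun a b => by
    rw [dist_eq_norm, dist_eq_norm, ← map_sub, hT, norm_sq_stretch, gradient_inner]
  have hcmp : ∀ a ∈ A, ∀ b ∈ A, |h a - h b - fderiv ℝ h c (a - b)| ≤ η * dist a b :=
    fun a ha b hb => by
      have := happ a (hA ha).1 b (hA hb).1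
      rw [dist_eq_norm]
      exact this
  have hk : (0 : ℝ) ≤ 1 + η := by linarith
  have hK : ((1 + η).toNNReal : ℝ) = 1 + η := Real.coe_toNNReal _ hk
  have m1 := euclideanHausdorffMeasure_image_le_of_dist_le (f := ψ) (g := T) (s := A)
    (K := (1 + η).toNNReal) (fun a ha b hb => hK.symm ▸ le_mul_of_sq_eq hη.le dist_nonneg
      (hψ a b) (hTd a b) (hcmp a ha b hb)) 2
  have m2 := euclideanHausdorffMeasure_image_le_of_dist_le (f := T) (g := ψ) (s := A)
    (K := (1 + η).toNNReal) (fun a ha b hb => hK.symm ▸ le_mul_of_sq_eq hη.le dist_nonneg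
      (hTd a b) (hψ a b) (by rw [abs_sub_comm]; exact hcmp a ha b hb)) 2
  change _ ≤ ENNReal.ofReal (1 + η) ^ 2 * _ at m1 m2
  rw [hvol] at m1 m2
  have hpow : ENNReal.ofReal ((1 + η) ^ 3)
      = ENNReal.ofReal (1 + η) ^ 2 * ENNReal.ofReal (1 + η) := by
    rw [ENNReal.ofReal_pow hk, pow_succ]
  constructor
  · refine m1.trans ?_
    rw [hpow, mul_assoc]
    refine mul_le_mul' le_rfl ?_
    rw [← lintegral_const_mul _ hJ.measurable.ennreal_ofReal,
      ← setLIntegral_const]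
    refine setLIntegral_mono' hAm fun a ha => ?_
    rw [← ENNReal.ofReal_mul hk]
    exact ENNReal.ofReal_le_ofReal (hA ha).2.1.le
  · have : ∫⁻ a in A, ENNReal.ofReal (areaDensity h a)
        ≤ ENNReal.ofReal (1 + η) * (ENNReal.ofReal (areaDensity h c) * volume A) := by
      rw [← mul_assoc, ← ENNReal.ofReal_mul hk, ← setLIntegral_const]
      refine setLIntegral_mono' hAm fun a ha => ?_
      exact ENNReal.ofReal_le_ofReal (hA ha).2.2.le
    refine this.trans ?_
    rw [hpow, mul_comm (ENNReal.ofReal (1 + η) ^ 2), mul_assoc]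
    gcongr

theorem continuous_graph : Continuous ψ := by
  refine continuous_iff_continuousAt.2 fun a => ?_
  rw [ContinuousAt, tendsto_iff_dist_tendsto_zero]
  have h1 : ∀ b, dist (ψ b) (ψ a) = √(dist b a ^ 2 + (h b - h a) ^ 2) := fun b => by
    rw [← hψ, Real.sqrt_sq dist_nonneg]
  simp only [h1]
  have h2 := hh.continuous
  have h3 : Continuous fun b => √(dist b a ^ 2 + (h b - h a) ^ 2) := by fun_prop
  simpa using h3.tendsto a

theorem measurableEmbedding_graph : MeasurableEmbedding ψ :=
  (continuous_graph hh hψ).measurableEmbedding (injective_graph hψ)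

/-- The area formula for a graph. -/
theorem restrict_range_graph : (μHE[2] : Measure E3).restrict (range ψ) =
    Measure.map ψ (volume.withDensity fun a => ENNReal.ofReal (areaDensity h a)) := by
  have hemb := measurableEmbedding_graph hh hψ
  rw [← hemb.map_comap]
  congr 1
  have hle : ∀ η : ℝ, 0 < η → (Measure.comap ψ μHE[2] ≤ ENNReal.ofReal ((1 + η) ^ 3) •
      (volume.withDensity fun a => ENNReal.ofReal (areaDensity h a))) ∧
      ((volume.withDensity fun a => ENNReal.ofReal (areaDensity h a)) ≤
      ENNReal.ofReal ((1 + η) ^ 3) • Measure.comap ψ μHE[2]) := by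
    intro η hη
    refine ⟨measure_le_of_locally_le fun c => ?_, measure_le_of_locally_le fun c => ?_⟩
    all_goals
      obtain ⟨U, hU, hUA⟩ := exists_graph_comparison hh hψ c hη
      refine ⟨U, hU, fun A hA hAm => ?_⟩
      rw [Measure.smul_apply, smul_eq_mul, hemb.comap_apply, withDensity_apply _ hAm]
    · exact (hUA A hA hAm).1
    · exact (hUA A hA hAm).2
  refine le_antisymm (Measure.le_iff.2 fun A hA => ?_) (Measure.le_iff.2 fun A hA => ?_)
  · exact ENNReal_le_of_forall_pow_mul_le 3 fun η hη => (hle η hη).1 A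
  · exact ENNReal_le_of_forall_pow_mul_le 3 fun η hη => (hle η hη).2 A

end Area

/-! ### Graph charts of smooth surfaces -/

theorem isInvertible_of_apply_one_ne_zero {L : ℝ →L[ℝ] ℝ} (hL : L 1 ≠ 0) : L.IsInvertible := by
  refine ⟨ContinuousLinearEquiv.unitsEquivAut ℝ (Units.mk0 (L 1) hL), ?_⟩
  ext
  simp

/-- The implicit function theorem provides the zero set, and strict monotonicity in the second
variable turns it into the description of the sublevel set. -/
theorem exists_implicit_graph {G : E2 × ℝ → ℝ} {W : Set (E2 × ℝ)} (hW : IsOpen W)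
    (h0W : (0, 0) ∈ W) (hG : ContDiffOn ℝ ∞ G W) (hG0 : G (0, 0) = 0)
    (hG1 : ∀ a, fderiv ℝ G (0, 0) (a, 0) = 0) (hG2 : 0 < fderiv ℝ G (0, 0) (0, 1)) :
    ∃ (h : E2 → ℝ) (ε : ℝ), 0 < ε ∧ (∀ a ∈ Metric.ball (0 : E2) ε, ContDiffAt ℝ ∞ h a) ∧
      fderiv ℝ h 0 = 0 ∧
      ∀ a ∈ Metric.ball (0 : E2) ε, ∀ t, |t| < ε → (G (a, t) < 0 ↔ t < h a) := by
  have hGat : ∀ v ∈ W, ContDiffAt ℝ ∞ G v := fun v hv => hG.contDiffAt (hW.mem_nhds hv)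
  have hinv : ∀ v, 0 < fderiv ℝ G v (0, 1) →
      (fderiv ℝ G v ∘L ContinuousLinearMap.inr ℝ E2 ℝ).IsInvertible := fun v hv =>
    isInvertible_of_apply_one_ne_zero (by simpa using hv.ne')
  have n0 : (∞ : WithTop ℕ∞) ≠ 0 := by simp
  set cdf := hGat _ h0W
  set h := cdf.implicitFunction n0 (hinv _ hG2) with hh
  have hcd : ContDiffAt ℝ ∞ h 0 := cdf.contDiffAt_implicitFunction n0 (hinv _ hG2)
  have hh0 : h 0 = 0 := cdf.implicitFunction_apply_self n0 (hinv _ hG2)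
  have hdh : fderiv ℝ h 0 = 0 := by
    have h1 := (cdf.hasStrictFDerivAt_implicitFunction n0 (hinv _ hG2)).hasFDerivAt.fderiv
    change fderiv ℝ h 0 = _ at h1
    rw [h1]
    have h2 : fderiv ℝ G (0, 0) ∘L ContinuousLinearMap.inl ℝ E2 ℝ = 0 := by
      ext a; simp [hG1 a]
    rw [h2]; simp
  have hdc : ContinuousAt (fun v => fderiv ℝ G v (0, 1)) (0, 0) :=
    ((cdf.fderiv_right (m := ∞) (by simp)).clm_apply contDiffAt_const).continuousAt
  have ev1 : ∀ᶠ v in 𝓝 ((0 : E2), (0 : ℝ)), v ∈ W ∧ 0 < fderiv ℝ G v (0, 1) :=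
    (hW.eventually_mem h0W).and (hdc.eventually_const_lt hG2)
  obtain ⟨ε₀, hε₀, hball⟩ := Metric.eventually_nhds_iff_ball.1 ev1
  have ev2 : ∀ᶠ a in 𝓝 (0 : E2), |h a| < ε₀ := by
    have := hcd.continuousAt.abs
    refine this.eventually_lt_const ?_
    simpa [hh0] using hε₀
  have ev3 : ∀ᶠ a in 𝓝 (0 : E2), G (a, h a) = 0 := by
    have := cdf.eventually_apply_implicitFunction n0 (hinv _ hG2)
    simpa only [hG0] using this
  -- Being C^∞ at a point does not spread to a neighbourhood, but being C¹ does. It yields the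
  -- continuity by which the implicit function at a nearby point is identified with `h`; smoothness
  -- there then comes from the theorem at that point.
  have ev4 : ∀ᶠ a in 𝓝 (0 : E2), ContDiffAt ℝ 1 h a :=
    (hcd.of_le (by simp)).eventually (by simp)
  obtain ⟨ε₁, hε₁, hball₁⟩ := Metric.eventually_nhds_iff_ball.1 (ev2.and (ev3.and ev4))
  have hmem : ∀ a ∈ Metric.ball (0 : E2) (min ε₀ ε₁), ∀ t, |t| < ε₀ →
      (a, t) ∈ Metric.ball ((0 : E2), (0 : ℝ)) ε₀ := fun a ha t ht => by
    rw [Metric.mem_ball, Prod.dist_eq]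
    refine max_lt ((Metric.mem_ball.1 ha).trans_le (min_le_left _ _)) ?_
    simpa using ht
  refine ⟨h, min ε₀ ε₁, lt_min hε₀ hε₁, fun a ha => ?_, hdh, fun a ha t ht => ?_⟩
  · have ha₁ := hball₁ a (Metric.ball_subset_ball (min_le_right _ _) ha)
    obtain ⟨hvW, hv2⟩ := hball _ (hmem a ha (h a) ha₁.1)
    have hloc := (hGat _ hvW).eventually_apply_eq_iff_implicitFunction n0 (hinv _ hv2)
    have hcont : ContinuousAt (fun b => (b, h b)) a := continuousAt_id.prodMk ha₁.2.2.continuousAt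
    have ev5 : ∀ᶠ b in 𝓝 a, G (b, h b) = 0 := by
      filter_upwards [Metric.isOpen_ball.mem_nhds
        (Metric.ball_subset_ball (min_le_right ε₀ ε₁) ha)] with b hb using (hball₁ b hb).2.1
    refine ((hGat _ hvW).contDiffAt_implicitFunction n0 (hinv _ hv2)).congr_of_eventuallyEq ?_
    filter_upwards [hcont.eventually hloc, ev5] with b hb hb0
    exact (hb.1 (hb0.trans ha₁.2.1.symm)).symm
  · have ha₁ := hball₁ a (Metric.ball_subset_ball (min_le_right _ _) ha)
    have ht₀ : |t| < ε₀ := ht.trans_le (min_le_left _ _)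
    have hd : ∀ s, |s| < ε₀ → HasDerivAt (fun s => G (a, s)) (fderiv ℝ G (a, s) (0, 1)) s := by
      intro s hs
      have h1 := ((hGat _ (hball _ (hmem a ha s hs)).1).differentiableAt n0).hasFDerivAt
      exact h1.comp_hasDerivAt s ((hasDerivAt_const s a).prodMk (hasDerivAt_id s))
    have hmono : StrictMonoOn (fun s => G (a, s)) (Ioo (-ε₀) ε₀) := by
      refine strictMonoOn_of_deriv_pos (convex_Ioo _ _) ?_ ?_
      · exact fun s hs => (hd s (abs_lt.2 hs)).continuousAt.continuousWithinAt
      · intro s hs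
        rw [interior_Ioo] at hs
        rw [(hd s (abs_lt.2 hs)).deriv]
        exact (hball _ (hmem a ha s (abs_lt.2 hs))).2
    have := hmono.lt_iff_lt (abs_lt.1 ht₀) (abs_lt.1 ha₁.1)
    simp only [ha₁.2.1] at this
    exact this

/-- Precompose with a ↦ r κ(a/r), which is the identity near 0 and maps the whole plane into a small
ball. Its derivative is bounded independently of r, while the derivative of `h` is as small as
desired on small balls. -/
theorem exists_small_slope_extension {h : E2 → ℝ} {ε : ℝ} (hε : 0 < ε)
    (hcd : ∀ a ∈ Metric.ball (0 : E2) ε, ContDiffAt ℝ ∞ h a) (hd : fderiv ℝ h 0 = 0) :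
    ∃ (k : E2 → ℝ) (r : ℝ), 0 < r ∧ ContDiff ℝ ∞ k ∧ (∀ a, ‖fderiv ℝ k a‖ ≤ 1 / 2) ∧
      ∀ a ∈ Metric.ball (0 : E2) r, k a = h a := by
  let χ : ContDiffBump (0 : E2) := ⟨1, 2, one_pos, one_lt_two⟩
  set κ : E2 → E2 := fun a => χ a • a with hκ
  have hκs : ContDiff ℝ ∞ κ := χ.contDiff.smul contDiff_id
  have hκn : ∀ a, ‖κ a‖ ≤ 2 := fun a => by
    rw [hκ, norm_smul, Real.norm_of_nonneg χ.nonneg]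
    by_cases ha : ‖a‖ ≤ 2
    · calc _ ≤ 1 * ‖a‖ := by gcongr; exact χ.le_one
        _ ≤ 2 := by linarith
    · rw [χ.zero_of_le_dist (by rw [dist_zero_right]; exact (not_le.1 ha).le)]; simp
  have hκc : HasCompactSupport κ := χ.hasCompactSupport.smul_right
  obtain ⟨C, hC⟩ := (hκc.fderiv (𝕜 := ℝ)).exists_bound_of_continuous
    (hκs.continuous_fderiv (by simp))
  have hC0 : 0 ≤ C := (norm_nonneg _).trans (hC 0)
  have hdc : ContinuousAt (fun a => ‖fderiv ℝ h a‖) 0 :=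
    ((hcd 0 (Metric.mem_ball_self hε)).fderiv_right (m := ∞) (by simp)).continuousAt.norm
  have ev : ∀ᶠ a in 𝓝 (0 : E2), ‖fderiv ℝ h a‖ < 1 / (2 * (C + 1)) := by
    refine hdc.eventually_lt_const ?_
    simp only [hd, norm_zero]
    positivity
  obtain ⟨ε', hε', hball⟩ := Metric.eventually_nhds_iff_ball.1 ev
  -- Since ‖κ‖ ≤ 2, the rescaled map takes values of norm at most 2r, inside both balls.
  set r := min ε ε' / 3 with hr
  have hmin : 0 < min ε ε' := lt_min hε hε'
  have hr0 : 0 < r := by positivity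
  set g : E2 → E2 := fun a => r • κ (r⁻¹ • a) with hg
  have hgs : ContDiff ℝ ∞ g := by
    have : ContDiff ℝ ∞ (fun a : E2 => r⁻¹ • a) := by fun_prop
    exact (hκs.comp this).const_smul r
  have hgmem : ∀ a, g a ∈ Metric.ball (0 : E2) (min ε ε') := fun a => by
    rw [mem_ball_zero_iff, hg, norm_smul, Real.norm_of_nonneg hr0.le]
    have := hκn (r⁻¹ • a)
    calc _ ≤ r * 2 := by gcongr
      _ < min ε ε' := by rw [hr]; linarith
  have hgd : ∀ a, HasFDerivAt g (fderiv ℝ κ (r⁻¹ • a)) a := fun a => by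
    have h1 : HasFDerivAt (fun a : E2 => r⁻¹ • a) (r⁻¹ • ContinuousLinearMap.id ℝ E2) a :=
      (hasFDerivAt_id a).const_smul r⁻¹
    have h2 := ((hasFDerivAt_of_contDiff hκs (r⁻¹ • a)).comp a h1).const_smul r
    refine h2.congr_fderiv ?_
    ext v
    simp [smul_smul, hr0.ne']
  refine ⟨fun a => h (g a), r, hr0, ?_, fun a => ?_, fun a ha => ?_⟩
  · refine contDiff_iff_contDiffAt.2 fun a => ?_
    exact (hcd _ (Metric.ball_subset_ball (min_le_left _ _) (hgmem a))).comp a hgs.contDiffAt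
  · have h1 := ((hcd _ (Metric.ball_subset_ball (min_le_left _ _) (hgmem a))).differentiableAt
      (by simp)).hasFDerivAt.comp a (hgd a)
    have h2 : fderiv ℝ (fun a => h (g a)) a = (fderiv ℝ h (g a)).comp (fderiv ℝ κ (r⁻¹ • a)) :=
      h1.fderiv
    rw [h2]
    refine (ContinuousLinearMap.opNorm_comp_le _ _).trans ?_
    have h3 := (hball _ (Metric.ball_subset_ball (min_le_right _ _) (hgmem a))).le
    calc _ ≤ 1 / (2 * (C + 1)) * C := by gcongr; exact hC _
      _ ≤ 1 / 2 := by
        rw [div_mul_eq_mul_div, one_mul, div_le_div_iff₀ (by positivity) (by positivity)]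
        linarith
  · have h1 : χ (r⁻¹ • a) = 1 := by
      refine χ.one_of_mem_closedBall ?_
      rw [mem_closedBall_zero_iff, norm_smul, norm_inv, Real.norm_of_nonneg hr0.le]
      rw [mem_ball_zero_iff] at ha
      rw [inv_mul_le_iff₀ hr0]
      change ‖a‖ ≤ r * 1
      linarith
    simp [hg, hκ, h1, smul_smul, hr0.ne']

/-- An orthonormal frame, in which the last vector is singled out. -/
abbrev Frame : Type := WithLp 2 (E2 × ℝ) ≃ₗᵢ[ℝ] E3

theorem exists_frame {n : E3} (hn : ‖n‖ = 1) :
    ∃ Φ : Frame, Φ (WithLp.toLp 2 (0, 1)) = n := by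
  have hn0 : n ≠ 0 := by rintro rfl; simp at hn
  have : Fact (Module.finrank ℝ E3 = 2 + 1) := ⟨by simp⟩
  let b := OrthonormalBasis.fromOrthogonalSpanSingleton (𝕜 := ℝ) 2 hn0
  let ι : E2 →ₗᵢ[ℝ] E3 := (ℝ ∙ n)ᗮ.subtypeₗᵢ.comp b.repr.symm.toLinearIsometry
  have hι : ∀ a, ⟪ι a, n⟫_ℝ = 0 := fun a => by
    have : (ι a) ∈ (ℝ ∙ n)ᗮ := (b.repr.symm a).2
    rw [Submodule.mem_orthogonal_singleton_iff_inner_right] at this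
    rw [real_inner_comm]; exact this
  let L : WithLp 2 (E2 × ℝ) →ₗ[ℝ] E3 :=
    { toFun := fun x => ι x.fst + x.snd • n
      map_add' := fun x y => by simp [add_smul]; abel
      map_smul' := fun c x => by simp [mul_smul] }
  have hL : ∀ x, ‖L x‖ = ‖x‖ := fun x => by
    have h1 : ‖L x‖ ^ 2 = ‖x‖ ^ 2 := by
      change ‖ι x.fst + x.snd • n‖ ^ 2 = _
      rw [norm_add_sq_real, inner_smul_right, hι, norm_smul, hn, WithLp.prod_norm_sq_eq_of_L2,
        ι.norm_map]
      ring
    exact (pow_left_inj₀ (norm_nonneg _) (norm_nonneg _) two_ne_zero).1 h1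
  refine ⟨LinearIsometry.toLinearIsometryEquiv ⟨L, hL⟩ ?_, ?_⟩
  · have : Module.finrank ℝ (WithLp 2 (E2 × ℝ)) = Module.finrank ℝ (E2 × ℝ) :=
      (WithLp.linearEquiv 2 ℝ (E2 × ℝ)).finrank_eq
    rw [this]
    simp
  · rw [LinearIsometry.coe_toLinearIsometryEquiv]
    change ι 0 + (1 : ℝ) • n = n
    simp

/-- The planar coordinate of a point with respect to a frame at `p`. -/
noncomputable def planeCoord (Φ : Frame) (p x : E3) : E2 := (Φ.symm (x - p)).fst

/-- The normal coordinate of a point with respect to a frame at `p`. -/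
noncomputable def heightCoord (Φ : Frame) (p x : E3) : ℝ := (Φ.symm (x - p)).snd

/-- The point with given coordinates with respect to a frame at `p`. -/
noncomputable def framePoint (Φ : Frame) (p : E3) (z : E2 × ℝ) : E3 := p + Φ (WithLp.toLp 2 z)

/-- The parametrization of the graph of `h` with respect to a frame at `p`. -/
noncomputable def graphMap (Φ : Frame) (p : E3) (h : E2 → ℝ) (a : E2) : E3 :=
  framePoint Φ p (a, h a)

section Frame

variable (Φ : Frame) (p : E3)

theorem planeCoord_framePoint (z : E2 × ℝ) : planeCoord Φ p (framePoint Φ p z) = z.1 := by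
  simp [planeCoord, framePoint]

theorem heightCoord_framePoint (z : E2 × ℝ) : heightCoord Φ p (framePoint Φ p z) = z.2 := by
  simp [heightCoord, framePoint]

theorem framePoint_coords (x : E3) :
    framePoint Φ p (planeCoord Φ p x, heightCoord Φ p x) = x := by
  have : WithLp.toLp 2 (planeCoord Φ p x, heightCoord Φ p x) = Φ.symm (x - p) := rfl
  rw [framePoint, this]
  simp

theorem contDiff_framePoint : ContDiff ℝ ∞ (framePoint Φ p) :=
  contDiff_const.add ((Φ.contDiff).comp (WithLp.prodContinuousLinearEquiv 2 ℝ E2 ℝ).symm.contDiff)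

theorem contDiff_coords : ContDiff ℝ ∞ (fun x => (planeCoord Φ p x, heightCoord Φ p x)) :=
  (WithLp.prodContinuousLinearEquiv 2 ℝ E2 ℝ).contDiff.comp
    (Φ.symm.contDiff.comp (contDiff_id.sub contDiff_const))

theorem contDiff_planeCoord : ContDiff ℝ ∞ (planeCoord Φ p) := (contDiff_coords Φ p).fst

theorem contDiff_heightCoord : ContDiff ℝ ∞ (heightCoord Φ p) := (contDiff_coords Φ p).snd

theorem norm_framePoint_sub (z w : E2 × ℝ) :
    ‖framePoint Φ p z - framePoint Φ p w‖ ^ 2 = ‖z.1 - w.1‖ ^ 2 + (z.2 - w.2) ^ 2 := by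
  rw [framePoint, framePoint, add_sub_add_left_eq_sub, ← map_sub, Φ.norm_map,
    WithLp.prod_norm_sq_eq_of_L2]
  simp [sq_abs]

theorem dist_graphMap (h : E2 → ℝ) (a b : E2) :
    dist (graphMap Φ p h a) (graphMap Φ p h b) ^ 2 = dist a b ^ 2 + (h a - h b) ^ 2 := by
  rw [dist_eq_norm, dist_eq_norm, graphMap, graphMap, norm_framePoint_sub]

theorem contDiff_graphMap {h : E2 → ℝ} (hh : ContDiff ℝ ∞ h) : ContDiff ℝ ∞ (graphMap Φ p h) :=
  (contDiff_framePoint Φ p).comp (contDiff_id.prodMk hh)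

theorem hasFDerivAt_framePoint (z : E2 × ℝ) : HasFDerivAt (framePoint Φ p)
    ((Φ.toContinuousLinearEquiv : WithLp 2 (E2 × ℝ) →L[ℝ] E3).comp
      ((WithLp.prodContinuousLinearEquiv 2 ℝ E2 ℝ).symm : E2 × ℝ →L[ℝ] WithLp 2 (E2 × ℝ))) z :=
  (((Φ.toContinuousLinearEquiv : WithLp 2 (E2 × ℝ) →L[ℝ] E3).comp
      ((WithLp.prodContinuousLinearEquiv 2 ℝ E2 ℝ).symm :
        E2 × ℝ →L[ℝ] WithLp 2 (E2 × ℝ))).hasFDerivAt).const_add p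

end Frame

/-- In the open set `V`, the region `Ω` lies below the graph of `h` in the frame `Φ` at `p`. -/
structure IsGraphChart (Ω : Set E3) (p : E3) (Φ : Frame) (h : E2 → ℝ) (V : Set E3) : Prop where
  contDiff : ContDiff ℝ ∞ h
  slope : ∀ a, ‖fderiv ℝ h a‖ ≤ 1 / 2
  isOpen : IsOpen V
  mem : p ∈ V
  mem_iff : ∀ x ∈ V, x ∈ Ω ↔ heightCoord Φ p x < h (planeCoord Φ p x)

theorem eq_zero_of_mem_frontier {Ω V : Set E3} (hΩ : IsOpen Ω) {x : E3} (hx : x ∈ frontier Ω)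
    (hV : IsOpen V) (hxV : x ∈ V) {g : E3 → ℝ} (hgc : ContinuousAt g x)
    (hiff : ∀ x ∈ V, x ∈ Ω ↔ g x < 0) : g x = 0 := by
  apply le_antisymm
  · by_contra! hpos
    have h1 : ∀ᶠ z in 𝓝 x, 0 < g z := hgc.eventually_const_lt hpos
    have h2 : ∃ᶠ z in 𝓝 x, z ∈ Ω := mem_closure_iff_frequently.1 (frontier_subset_closure hx)
    obtain ⟨z, hz, hz1, hz2⟩ := (h2.and_eventually (h1.and (hV.mem_nhds hxV))).exists
    exact lt_asymm ((hiff z hz2).1 hz) hz1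
  · by_contra! hneg
    rw [hΩ.frontier_eq] at hx
    exact hx.2 ((hiff x hxV).2 hneg)

/-- Along a ray, g(x + tv)/t tends to ⟪G, v⟫, which fixes the sign of g for small t > 0. Continuity
extends the positive case to a neighbourhood and excludes the closure of Ω. -/
theorem isOutwardUnitNormal_of_hasGradientAt {Ω V : Set E3} {x G : E3} (hV : IsOpen V)
    (hxV : x ∈ V) {g : E3 → ℝ} (hgc : ContinuousOn g V) (hG : HasGradientAt g G x) (hG0 : G ≠ 0)
    (hgx : g x = 0) (hiff : ∀ x ∈ V, x ∈ Ω ↔ g x < 0) :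
    IsOutwardUnitNormal Ω x (‖G‖⁻¹ • G) := by
  have hn : 0 < ‖G‖ := norm_pos_iff.2 hG0
  have hslope : ∀ v : E3, Tendsto (fun t : ℝ => t⁻¹ * g (x + t • v)) (𝓝[>] 0)
      (𝓝 ⟪G, v⟫_ℝ) := by
    intro v
    have h1 : HasDerivAt (fun t : ℝ => x + t • v) v 0 := by
      simpa using ((hasDerivAt_id (0 : ℝ)).smul_const v).const_add x
    have h2 : HasFDerivAt g (InnerProductSpace.toDual ℝ E3 G) (x + (0 : ℝ) • v) := by
      simpa using hG.hasFDerivAt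
    have h3 := h2.comp_hasDerivAt (0 : ℝ) h1
    rw [InnerProductSpace.toDual_apply_apply] at h3
    simpa [hgx] using h3.tendsto_slope_zero_right
  have hmem : ∀ v : E3, ∀ᶠ t : ℝ in 𝓝[>] 0, x + t • v ∈ V := by
    intro v
    have hc : Continuous (fun t : ℝ => x + t • v) := by fun_prop
    have h := hc.tendsto 0
    simp only [zero_smul, add_zero] at h
    exact (h.mono_left nhdsWithin_le_nhds).eventually (hV.mem_nhds hxV)
  have hsign : ∀ v, ⟪v, ‖G‖⁻¹ • G⟫_ℝ = ‖G‖⁻¹ * ⟪G, v⟫_ℝ := fun v => by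
    rw [inner_smul_right, real_inner_comm]
  refine ⟨?_, ?_, ?_⟩
  · rw [norm_smul, norm_inv, norm_norm, inv_mul_cancel₀ hn.ne']
  · intro v hv
    rw [hsign] at hv
    have hv' : ⟪G, v⟫_ℝ < 0 := by
      by_contra! h
      have : 0 ≤ ‖G‖⁻¹ * ⟪G, v⟫_ℝ := by positivity
      linarith
    filter_upwards [(hslope v).eventually_lt_const hv', hmem v, self_mem_nhdsWithin]
      with t ht htV ht0
    have ht0' : 0 < t := ht0
    refine (hiff _ htV).2 ?_
    by_contra! h
    have : 0 ≤ t⁻¹ * g (x + t • v) := by positivity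
    linarith
  · intro v hv
    rw [hsign] at hv
    have hv' : 0 < ⟪G, v⟫_ℝ := pos_of_mul_pos_right hv (by positivity)
    filter_upwards [(hslope v).eventually_const_lt hv', hmem v, self_mem_nhdsWithin]
      with t ht htV ht0 hcl
    have ht0' : 0 < t := ht0
    have hpos : 0 < g (x + t • v) := pos_of_mul_pos_right ht (by positivity)
    have hc : ContinuousAt g (x + t • v) := hgc.continuousAt (hV.mem_nhds htV)
    obtain ⟨z, hz, hz1, hz2⟩ := ((mem_closure_iff_frequently.1 hcl).and_eventually
      ((hc.eventually_const_lt hpos).and (hV.mem_nhds htV))).exists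
    exact lt_asymm ((hiff z hz2).1 hz) hz1

theorem IsOutwardUnitNormal.outwardNormal_eq {Ω : Set E3} {x ν : E3}
    (h : IsOutwardUnitNormal Ω x ν) : outwardNormal Ω x = ν := by
  have hex : ∃ ν, IsOutwardUnitNormal Ω x ν := ⟨ν, h⟩
  rw [outwardNormal, dif_pos hex]
  exact hex.choose_spec.unique h

/-- In a frame whose last vector is the normalized gradient, the defining function has derivative
‖∇g‖ times the height. The implicit graph is then flat at the centre, so it can be extended to the
plane with slope at most 1/2. -/
theorem IsSmoothBoundedRegion.exists_isGraphChart {Ω : Set E3} (hΩ : IsSmoothBoundedRegion Ω)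
    {p : E3} (hp : p ∈ frontier Ω) : ∃ Φ h V, IsGraphChart Ω p Φ h V := by
  obtain ⟨V, g, hV, hpV, hg, hgrad, hiff⟩ := hΩ.smooth_boundary p hp
  have hgp : g p = 0 := eq_zero_of_mem_frontier hΩ.isOpen hp hV hpV
    (hg.continuousOn.continuousAt (hV.mem_nhds hpV)) hiff
  have hgd : HasGradientAt g (gradient g p) p :=
    ((hg.contDiffAt (hV.mem_nhds hpV)).differentiableAt (by simp)).hasGradientAt
  have hn : 0 < ‖gradient g p‖ := norm_pos_iff.2 (hgrad p hpV)
  obtain ⟨Φ, hΦ⟩ := exists_frame (n := ‖gradient g p‖⁻¹ • gradient g p)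
    (by rw [norm_smul, norm_inv, norm_norm, inv_mul_cancel₀ hn.ne'])
  have hfp : framePoint Φ p (0, 0) = p := by
    have : WithLp.toLp 2 ((0 : E2), (0 : ℝ)) = 0 := rfl
    simp [framePoint, this]
  have hGd : HasFDerivAt (fun z => g (framePoint Φ p z)) _ (0, 0) :=
    HasFDerivAt.comp (0, 0) (g := g) (by rw [hfp]; exact hgd.hasFDerivAt)
      (hasFDerivAt_framePoint Φ p (0, 0))
  have hGa : ∀ z, fderiv ℝ (fun z => g (framePoint Φ p z)) (0, 0) z
      = ⟪gradient g p, Φ (WithLp.toLp 2 z)⟫_ℝ := fun z => by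
    rw [hGd.fderiv]
    rfl
  have hgn : gradient g p = ‖gradient g p‖ • Φ (WithLp.toLp 2 (0, 1)) := by
    rw [hΦ, smul_smul, mul_inv_cancel₀ hn.ne', one_smul]
  have hGz : ∀ z : E2 × ℝ, fderiv ℝ (fun z => g (framePoint Φ p z)) (0, 0) z
      = ‖gradient g p‖ * z.2 := fun z => by
    rw [hGa, hgn, inner_smul_left, Φ.inner_map_map, WithLp.prod_inner_apply]
    simp [norm_smul]
  have hcont := (contDiff_framePoint Φ p).continuous
  obtain ⟨h₀, ε, hε, hcd, hd, hlt⟩ := exists_implicit_graph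
    (G := fun z => g (framePoint Φ p z)) (W := framePoint Φ p ⁻¹' V) (hV.preimage hcont)
    (by change framePoint Φ p (0, 0) ∈ V; rwa [hfp])
    (hg.comp (contDiff_framePoint Φ p).contDiffOn (mapsTo_preimage _ _))
    (by rw [hfp, hgp]) (fun a => by rw [hGz]; simp) (by rw [hGz]; simpa using hn)
  obtain ⟨h, r, hr, hh, hs, heq⟩ := exists_small_slope_extension hε hcd hd
  have hc1 := (contDiff_planeCoord Φ p).continuous
  have hc2 := (contDiff_heightCoord Φ p).continuous
  refine ⟨Φ, h, V ∩ ((planeCoord Φ p ⁻¹' Metric.ball 0 (min ε r)) ∩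
    {x | |heightCoord Φ p x| < ε}), hh, hs, ?_, ?_, ?_⟩
  · exact hV.inter ((Metric.isOpen_ball.preimage hc1).inter (isOpen_lt (by fun_prop)
      continuous_const))
  · have h1 : planeCoord Φ p p = 0 := by
      conv_lhs => rw [← hfp]
      rw [hfp]; simp [planeCoord]
    have h2 : heightCoord Φ p p = 0 := by simp [heightCoord]
    refine ⟨hpV, ?_, ?_⟩
    · simp [h1, hε, hr]
    · simp [h2, hε]
  · rintro x ⟨hxV, hx1, hx2⟩
    have hx1' : planeCoord Φ p x ∈ Metric.ball (0 : E2) (min ε r) := hx1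
    rw [hiff x hxV, heq _ (Metric.ball_subset_ball (min_le_right _ _) hx1'),
      ← hlt _ (Metric.ball_subset_ball (min_le_left _ _) hx1') _ hx2, framePoint_coords]

namespace IsGraphChart

variable {Ω : Set E3} {p : E3} {Φ : Frame} {h : E2 → ℝ} {V : Set E3}

theorem mem_frontier_iff (hc : IsGraphChart Ω p Φ h V) (hΩ : IsOpen Ω) {x : E3} (hx : x ∈ V) :
    x ∈ frontier Ω ↔ heightCoord Φ p x = h (planeCoord Φ p x) := by
  have hc1 := (contDiff_planeCoord Φ p).continuous
  have hc2 := (contDiff_heightCoord Φ p).continuous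
  have hc3 := hc.contDiff.continuous
  constructor
  · intro hxf
    have := eq_zero_of_mem_frontier (g := fun x => heightCoord Φ p x - h (planeCoord Φ p x)) hΩ hxf
      hc.isOpen hx (by fun_prop) (fun y hy => by rw [hc.mem_iff y hy, sub_neg])
    linarith
  · intro hxe
    rw [hΩ.frontier_eq]
    refine ⟨?_, fun hxΩ => ((hc.mem_iff x hx).1 hxΩ).ne hxe⟩
    -- Points just below the graph lie in Ω and converge to x.
    have hcont : Continuous fun t : ℝ =>
        framePoint Φ p (planeCoord Φ p x, heightCoord Φ p x - t) :=
      (contDiff_framePoint Φ p).continuous.comp (by fun_prop)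
    have htend : Tendsto (fun t : ℝ =>
        framePoint Φ p (planeCoord Φ p x, heightCoord Φ p x - t)) (𝓝[>] 0) (𝓝 x) := by
      have := hcont.tendsto 0
      simp only [sub_zero, framePoint_coords] at this
      exact this.mono_left nhdsWithin_le_nhds
    refine mem_closure_of_tendsto htend ?_
    filter_upwards [htend.eventually (hc.isOpen.mem_nhds hx), self_mem_nhdsWithin] with t ht ht0
    rw [hc.mem_iff _ ht, planeCoord_framePoint, heightCoord_framePoint, ← hxe]
    simpa using ht0

theorem graphMap_mem_frontier (hc : IsGraphChart Ω p Φ h V) (hΩ : IsOpen Ω) {a : E2}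
    (ha : graphMap Φ p h a ∈ V) : graphMap Φ p h a ∈ frontier Ω := by
  rw [hc.mem_frontier_iff hΩ ha, graphMap, planeCoord_framePoint, heightCoord_framePoint]

theorem graphMap_planeCoord (hc : IsGraphChart Ω p Φ h V) (hΩ : IsOpen Ω) {x : E3} (hx : x ∈ V)
    (hxf : x ∈ frontier Ω) : graphMap Φ p h (planeCoord Φ p x) = x := by
  rw [graphMap, ← (hc.mem_frontier_iff hΩ hx).1 hxf, framePoint_coords]

/-- The upward normal of the graph, of length `areaDensity h a`. -/
noncomputable def _root_.StokesReg.graphNormal (Φ : Frame) (h : E2 → ℝ) (a : E2) : E3 :=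
  Φ (WithLp.toLp 2 (-gradient h a, 1))

theorem _root_.StokesReg.norm_graphNormal (Φ : Frame) (h : E2 → ℝ) (a : E2) :
    ‖graphNormal Φ h a‖ = areaDensity h a := by
  rw [graphNormal, Φ.norm_map, WithLp.prod_norm_eq_of_L2, areaDensity]
  simp [add_comm]

theorem _root_.StokesReg.contDiff_graphNormal (Φ : Frame) {h : E2 → ℝ} (hh : ContDiff ℝ ∞ h) :
    ContDiff ℝ ∞ (graphNormal Φ h) :=
  Φ.contDiff.comp ((WithLp.prodContinuousLinearEquiv 2 ℝ E2 ℝ).symm.contDiff.comp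
    ((contDiff_gradient hh).neg.prodMk contDiff_const))

/-- `graphNormal` is the gradient of the height above the graph, which is a defining function of Ω
in the chart. -/
theorem outwardNormal_eq (hc : IsGraphChart Ω p Φ h V) (hΩ : IsOpen Ω) {x : E3} (hx : x ∈ V)
    (hxf : x ∈ frontier Ω) : outwardNormal Ω x =
      (areaDensity h (planeCoord Φ p x))⁻¹ • graphNormal Φ h (planeCoord Φ p x) := by
  have hc1 := (contDiff_planeCoord Φ p).continuous
  have hc2 := (contDiff_heightCoord Φ p).continuous
  have hc3 := hc.contDiff.continuous
  have hJ := areaDensity_pos h (planeCoord Φ p x)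
  rw [← norm_graphNormal Φ]
  refine (isOutwardUnitNormal_of_hasGradientAt hc.isOpen hx
    (g := fun x => heightCoord Φ p x - h (planeCoord Φ p x)) (by fun_prop) ?_ ?_ ?_
    (fun y hy => by rw [hc.mem_iff y hy, sub_neg])).outwardNormal_eq
  · rw [hasGradientAt_iff_hasFDerivAt]
    have d0 : HasFDerivAt (fun x : E3 => Φ.symm (x - p))
        (Φ.symm.toContinuousLinearEquiv : E3 →L[ℝ] WithLp 2 (E2 × ℝ)) x :=
      ((Φ.symm.toContinuousLinearEquiv : E3 →L[ℝ] WithLp 2 (E2 × ℝ)).hasFDerivAt).comp x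
        ((hasFDerivAt_id x).sub_const p)
    have d1 := ((WithLp.prodContinuousLinearEquiv 2 ℝ E2 ℝ :
      WithLp 2 (E2 × ℝ) →L[ℝ] E2 × ℝ).hasFDerivAt).comp x d0
    have d2 : HasFDerivAt (planeCoord Φ p) _ x := d1.fst
    have d3 : HasFDerivAt (heightCoord Φ p) _ x := d1.snd
    have d4 := d3.fun_sub ((hasFDerivAt_of_contDiff hc.contDiff (planeCoord Φ p x)).comp x d2)
    refine d4.congr_fderiv ?_
    ext v
    rw [InnerProductSpace.toDual_apply_apply]
    have : v = Φ (Φ.symm v) := (Φ.apply_symm_apply v).symm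
    conv_rhs => rw [this, graphNormal, Φ.inner_map_map, WithLp.prod_inner_apply]
    simp only [inner_neg_left, gradient_inner]
    simp
    ring
  · rw [← norm_pos_iff, norm_graphNormal]
    exact hJ
  · rw [(hc.mem_frontier_iff hΩ hx).1 hxf, sub_self]

theorem restrict_surfaceMeasure (hc : IsGraphChart Ω p Φ h V) (hΩ : IsOpen Ω) :
    (surfaceMeasure Ω).restrict V = (Measure.map (graphMap Φ p h)
      (volume.withDensity fun a => ENNReal.ofReal (areaDensity h a))).restrict V := by
  rw [← restrict_range_graph hc.contDiff (dist_graphMap Φ p h), surfaceMeasure,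
    Measure.restrict_restrict hc.isOpen.measurableSet,
    Measure.restrict_restrict hc.isOpen.measurableSet]
  congr 1
  ext x
  constructor
  · rintro ⟨hx, hxf⟩
    exact ⟨hx, _, hc.graphMap_planeCoord hΩ hx hxf⟩
  · rintro ⟨hx, a, rfl⟩
    exact ⟨hx, hc.graphMap_mem_frontier hΩ hx⟩

end IsGraphChart

/-- The normal is defined by choice at each point, but on the surface near p it coincides with a
field smooth on all of space, namely the normalized graph normal at the planar coordinate. -/
theorem IsSmoothBoundedRegion.contDiffOn_outwardNormal {Ω : Set E3}
    (hΩ : IsSmoothBoundedRegion Ω) : ContDiffOn ℝ ∞ (outwardNormal Ω) (frontier Ω) := by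
  intro p hp
  obtain ⟨Φ, h, V, hc⟩ := hΩ.exists_isGraphChart hp
  have hs : ContDiff ℝ ∞ (fun x =>
      (areaDensity h (planeCoord Φ p x))⁻¹ • graphNormal Φ h (planeCoord Φ p x)) :=
    (((contDiff_areaDensity hc.contDiff).comp (contDiff_planeCoord Φ p)).inv
      fun x => (areaDensity_pos h _).ne').smul
      ((contDiff_graphNormal Φ hc.contDiff).comp (contDiff_planeCoord Φ p))
  refine hs.contDiffAt.contDiffWithinAt.congr_of_eventuallyEq ?_
    (hc.outwardNormal_eq hΩ.isOpen hc.mem hp)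
  filter_upwards [self_mem_nhdsWithin, nhdsWithin_le_nhds (hc.isOpen.mem_nhds hc.mem)] with x hx hxV
  exact hc.outwardNormal_eq hΩ.isOpen hxV hx

/-! ### Integration over smooth surfaces -/

theorem graphMap_apply_zero_of_height {Φ : Frame} {p : E3} {h : E2 → ℝ} (h0 : h 0 = 0) :
    graphMap Φ p h 0 = p := by
  have : WithLp.toLp 2 ((0 : E2), (0 : ℝ)) = 0 := rfl
  simp [graphMap, framePoint, h0, this]

theorem measurableEmbedding_graphMap (Φ : Frame) (p : E3) {h : E2 → ℝ} (hh : ContDiff ℝ ∞ h) :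
    MeasurableEmbedding (graphMap Φ p h) :=
  measurableEmbedding_graph hh (dist_graphMap Φ p h)

theorem norm_planeCoord_le (Φ : Frame) (p x : E3) : ‖planeCoord Φ p x‖ ≤ ‖x - p‖ := by
  rw [← Φ.symm.norm_map (x - p)]
  refine abs_le_of_sq_le_sq' ?_ (norm_nonneg _) |>.2
  rw [WithLp.prod_norm_sq_eq_of_L2, planeCoord]
  linarith [sq_nonneg ‖(Φ.symm (x - p)).snd‖]

theorem norm_le_norm_graphMap_sub (Φ : Frame) (p : E3) (h : E2 → ℝ) (a : E2) :
    ‖a‖ ≤ ‖graphMap Φ p h a - p‖ := by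
  have := norm_planeCoord_le Φ p (graphMap Φ p h a)
  rwa [graphMap, planeCoord_framePoint] at this

namespace IsGraphChart

variable {Ω : Set E3} {p : E3} {Φ : Frame} {h : E2 → ℝ} {V : Set E3}
  {F : Type*} [NormedAddCommGroup F] [NormedSpace ℝ F]

theorem setIntegral_surfaceMeasure (hc : IsGraphChart Ω p Φ h V) (hΩ : IsOpen Ω) {f : E3 → F}
    (hf : ∀ x ∉ V, f x = 0) :
    ∫ x, f x ∂(surfaceMeasure Ω) = ∫ a, areaDensity h a • f (graphMap Φ p h a) := by
  have hemb := measurableEmbedding_graphMap Φ p hc.contDiff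
  have hJ := (contDiff_areaDensity hc.contDiff).continuous
  rw [← setIntegral_eq_integral_of_forall_compl_eq_zero hf, hc.restrict_surfaceMeasure hΩ,
    setIntegral_eq_integral_of_forall_compl_eq_zero hf, hemb.integral_map,
    integral_withDensity_eq_integral_toReal_smul hJ.measurable.ennreal_ofReal (by simp)]
  simp_rw [ENNReal.toReal_ofReal (areaDensity_pos h _).le]

theorem integrableOn_surfaceMeasure (hc : IsGraphChart Ω p Φ h V) (hΩ : IsOpen Ω) {f : E3 → F}
    {W : Set E3} (hW : IsOpen W) (hWV : W ⊆ V)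
    (hf : IntegrableOn (fun a => areaDensity h a • f (graphMap Φ p h a)) (graphMap Φ p h ⁻¹' W)) :
    IntegrableOn f W (surfaceMeasure Ω) := by
  have hemb := measurableEmbedding_graphMap Φ p hc.contDiff
  have hJ := (contDiff_areaDensity hc.contDiff).continuous
  have e : (surfaceMeasure Ω).restrict W = (Measure.map (graphMap Φ p h)
      (volume.withDensity fun a => ENNReal.ofReal (areaDensity h a))).restrict W := by
    have := congrArg (fun μ => μ.restrict W) (hc.restrict_surfaceMeasure hΩ)
    simpa only [Measure.restrict_restrict hW.measurableSet, inter_eq_left.2 hWV] using this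
  have hW' : MeasurableSet (graphMap Φ p h ⁻¹' W) := hemb.measurable hW.measurableSet
  rw [IntegrableOn, e, ← IntegrableOn, hemb.integrableOn_map_iff, IntegrableOn,
    restrict_withDensity hW', integrable_withDensity_iff_integrable_smul'
      hJ.measurable.ennreal_ofReal (by simp)]
  simp_rw [Function.comp_apply, ENNReal.toReal_ofReal (areaDensity_pos h _).le]
  exact hf

theorem height_zero (hc : IsGraphChart Ω p Φ h V) (hΩ : IsOpen Ω) (hp : p ∈ frontier Ω) :
    h 0 = 0 := by
  have := (hc.mem_frontier_iff hΩ hc.mem).1 hp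
  have h1 : planeCoord Φ p p = 0 := by simp [planeCoord]
  have h2 : heightCoord Φ p p = 0 := by simp [heightCoord]
  rw [h1, h2] at this
  exact this.symm

end IsGraphChart

theorem preimage_graphMap_ball_subset (Φ : Frame) (p : E3) (h : E2 → ℝ) (r : ℝ) :
    graphMap Φ p h ⁻¹' Metric.ball p r ⊆ Metric.ball 0 r := fun a ha => by
  rw [mem_ball_zero_iff]
  rw [mem_preimage, mem_ball_iff_norm] at ha
  exact (norm_le_norm_graphMap_sub Φ p h a).trans_lt ha

theorem aestronglyMeasurable_surfaceMeasure {Ω : Set E3} {F : Type*} [TopologicalSpace F]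
    [TopologicalSpace.PseudoMetrizableSpace F]
    [SecondCountableTopologyEither E3 F] {f : E3 → F} (hf : ContinuousOn f (frontier Ω)) :
    AEStronglyMeasurable f (surfaceMeasure Ω) :=
  hf.aestronglyMeasurable isClosed_frontier.measurableSet

theorem ae_mem_frontier (Ω : Set E3) : ∀ᵐ x ∂(surfaceMeasure Ω), x ∈ frontier Ω :=
  ae_restrict_mem isClosed_frontier.measurableSet

theorem ae_ne_surfaceMeasure (Ω : Set E3) (y : E3) : ∀ᵐ x ∂(surfaceMeasure Ω), x ≠ y := by
  refine ae_restrict_of_ae ?_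
  rw [Measure.euclideanHausdorffMeasure_def]
  refine Measure.ae_smul_measure ?_ _
  have := Measure.nullSingletonClass_hausdorff E3 (d := ((2 : ℕ) : ℝ)) (by norm_num)
  exact Measure.ae_ne _ y

namespace IsSmoothBoundedRegion

variable {Ω : Set E3} (hΩ : IsSmoothBoundedRegion Ω)
include hΩ

theorem isCompact_frontier : IsCompact (frontier Ω) :=
  Metric.isCompact_of_isClosed_isBounded isClosed_frontier
    (hΩ.isBounded.closure.subset frontier_subset_closure)

theorem isFiniteMeasure : IsFiniteMeasure (surfaceMeasure Ω) := by
  refine ⟨?_⟩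
  rw [surfaceMeasure, Measure.restrict_apply_univ]
  refine hΩ.isCompact_frontier.measure_lt_top_of_nhdsWithin fun p hp => ?_
  obtain ⟨Φ, h, V, hc⟩ := hΩ.exists_isGraphChart hp
  have hW : IsOpen (V ∩ Metric.ball p 1) := hc.isOpen.inter Metric.isOpen_ball
  have hint : IntegrableOn (fun _ => (1 : ℝ)) (V ∩ Metric.ball p 1) (surfaceMeasure Ω) := by
    refine hc.integrableOn_surfaceMeasure hΩ.isOpen hW inter_subset_left ?_
    have hJ := (contDiff_areaDensity hc.contDiff).continuous
    refine IntegrableOn.mono_set (t := Metric.closedBall 0 1) ?_ ?_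
    · exact (by fun_prop : Continuous fun a => areaDensity h a • (1 : ℝ)).continuousOn
        |>.integrableOn_compact (isCompact_closedBall _ _)
    · exact (preimage_mono inter_subset_right).trans
        ((preimage_graphMap_ball_subset Φ p h 1).trans Metric.ball_subset_closedBall)
  have hfin := ((integrableOn_const_iff (by simp)).1 hint).resolve_left (by simp)
  refine ⟨frontier Ω ∩ (V ∩ Metric.ball p 1), inter_mem_nhdsWithin _
    (hW.mem_nhds ⟨hc.mem, Metric.mem_ball_self one_pos⟩), ?_⟩
  rwa [surfaceMeasure, Measure.restrict_apply hW.measurableSet, inter_comm] at hfin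

/-- In the chart centred at y the distance to y is at least the planar norm, so the singularity is
at most that of 1/‖a‖, which is integrable in dimension two. Outside a ball the integrand is bounded
and the surface has finite area. -/
theorem integrable_inv_dist {y : E3} (hy : y ∈ frontier Ω) :
    Integrable (fun x => ‖y - x‖⁻¹) (surfaceMeasure Ω) := by
  have := hΩ.isFiniteMeasure
  obtain ⟨Φ, h, V, hc⟩ := hΩ.exists_isGraphChart hy
  obtain ⟨ρ, hρ, hball⟩ := Metric.isOpen_iff.1 hc.isOpen y hc.mem
  have hmeas : Measurable fun x : E3 => ‖y - x‖⁻¹ := by fun_prop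
  rw [← integrableOn_univ, ← union_compl_self (Metric.ball y ρ)]
  refine IntegrableOn.union ?_ ?_
  · refine hc.integrableOn_surfaceMeasure hΩ.isOpen Metric.isOpen_ball hball ?_
    have hJ := (contDiff_areaDensity hc.contDiff).continuous
    obtain ⟨C, hC⟩ := (isCompact_closedBall (0 : E2) ρ).exists_bound_of_continuousOn hJ.continuousOn
    refine IntegrableOn.mono_set (t := Metric.ball 0 ρ) ?_ (preimage_graphMap_ball_subset Φ y h ρ)
    have hg := (contDiff_graphMap Φ y hc.contDiff).continuous
    refine integrableOn_ball_of_norm_le_rpow (C := C) (α := 1) (by simp) (by simp) ?_ ?_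
    · refine (ae_restrict_iff' Metric.isOpen_ball.measurableSet).2 (Eventually.of_forall ?_)
      intro a ha
      have hCa := hC a (Metric.ball_subset_closedBall ha)
      rw [norm_smul, norm_inv, norm_norm, Real.rpow_neg_one, norm_sub_rev]
      rcases eq_or_ne a 0 with rfl | ha0
      · rw [graphMap_apply_zero_of_height (hc.height_zero hΩ.isOpen hy)]
        simp
      · have h1 := norm_le_norm_graphMap_sub Φ y h a
        have h2 : 0 < ‖a‖ := norm_pos_iff.2 ha0
        have : 0 ≤ C := (norm_nonneg _).trans hCa
        gcongr
    · exact (hJ.measurable.smul (hmeas.comp hg.measurable)).aestronglyMeasurable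
  · refine Measure.integrableOn_of_bounded (M := ρ⁻¹) (measure_ne_top _ _)
      hmeas.aestronglyMeasurable ?_
    refine (ae_restrict_iff' Metric.isOpen_ball.measurableSet.compl).2 (Eventually.of_forall ?_)
    intro x hx
    rw [norm_inv, norm_norm]
    have : ρ ≤ ‖y - x‖ := by
      rw [mem_compl_iff, Metric.mem_ball, not_lt, dist_comm, dist_eq_norm] at hx
      exact hx
    gcongr

theorem integrable_of_norm_le {F : Type*} [NormedAddCommGroup F] {f : E3 → F}
    (hf : AEStronglyMeasurable f (surfaceMeasure Ω)) {y : E3} (hy : y ∈ frontier Ω) {C : ℝ}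
    (hle : ∀ x ∈ frontier Ω, x ≠ y → ‖f x‖ ≤ C * ‖y - x‖⁻¹) : Integrable f (surfaceMeasure Ω) := by
  refine ((hΩ.integrable_inv_dist hy).const_mul C).mono' hf ?_
  filter_upwards [ae_mem_frontier Ω, ae_ne_surfaceMeasure Ω y] with x hx hxy using hle x hx hxy

end IsSmoothBoundedRegion

/-! ### Uniform bounds for kernels that are second derivatives of Gaussians -/

theorem pow_mul_exp_neg_le (k : ℕ) {X : ℝ} (hX : 0 ≤ X) :
    X ^ k * Real.exp (-X) ≤ k.factorial := by
  have := Real.pow_div_factorial_le_exp X hX k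
  rw [Real.exp_neg, ← div_eq_mul_inv, div_le_iff₀ (Real.exp_pos _)]
  rwa [div_le_iff₀' (by positivity)] at this

theorem exists_gaussKer_profile_le (m k : ℕ) : ∃ C, 0 ≤ C ∧ ∀ X : ℝ, 0 ≤ X →
    |X ^ 2 - (2 * m + 2) * X + m * (m + 1)| * (X ^ k * Real.exp (-X)) ≤ C := by
  refine ⟨(k + 2).factorial + (2 * m + 2) * (k + 1).factorial + m * (m + 1) * k.factorial,
    by positivity, fun X hX => ?_⟩
  have h1 : |X ^ 2 - (2 * m + 2) * X + m * (m + 1)| ≤ X ^ 2 + (2 * m + 2) * X + m * (m + 1) := by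
    have : (0 : ℝ) ≤ (2 * m + 2) * X := by positivity
    have : (0 : ℝ) ≤ m * (m + 1) := by positivity
    rw [abs_le]; constructor <;> nlinarith
  calc _ ≤ (X ^ 2 + (2 * m + 2) * X + m * (m + 1)) * (X ^ k * Real.exp (-X)) := by gcongr
    _ = X ^ (k + 2) * Real.exp (-X) + (2 * m + 2) * (X ^ (k + 1) * Real.exp (-X))
        + m * (m + 1) * (X ^ k * Real.exp (-X)) := by ring
    _ ≤ _ := by
      gcongr
      · exact pow_mul_exp_neg_le (k + 2) hX
      · exact pow_mul_exp_neg_le (k + 1) hX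
      · exact pow_mul_exp_neg_le k hX

theorem abs_gaussKer {m : ℕ} {s τ : ℝ} (hτ : 0 < τ) : |gaussKer m s τ| =
    |(s / τ) ^ 2 - (2 * m + 2) * (s / τ) + m * (m + 1)| * Real.exp (-(s / τ)) / τ ^ (m + 2) := by
  rw [gaussKer, abs_div, abs_mul, Real.abs_exp, abs_of_pos (pow_pos hτ _), neg_div]

theorem exists_abs_gaussKer_le (m : ℕ) : ∃ C, 0 ≤ C ∧ ∀ s τ : ℝ, 0 ≤ s → 0 < τ →
    |gaussKer m s τ| ≤ C / τ ^ (m + 2) := by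
  obtain ⟨C, hC0, hC⟩ := exists_gaussKer_profile_le m 0
  refine ⟨C, hC0, fun s τ hs hτ => ?_⟩
  rw [abs_gaussKer hτ]
  gcongr
  simpa using hC (s / τ) (by positivity)

/-- The weight s^(m+2) absorbs the negative powers of τ, which gives a bound uniform in τ for points
at a fixed distance from y. -/
theorem exists_abs_gaussKer_mul_pow_le (m : ℕ) : ∃ C, 0 ≤ C ∧ ∀ s τ : ℝ, 0 ≤ s → 0 < τ →
    |gaussKer m s τ| * s ^ (m + 2) ≤ C := by
  obtain ⟨C, hC0, hC⟩ := exists_gaussKer_profile_le m (m + 2)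
  refine ⟨C, hC0, fun s τ hs hτ => le_trans (le_of_eq ?_) (hC (s / τ) (by positivity))⟩
  rw [abs_gaussKer hτ, div_pow s τ (m + 2)]
  ring

theorem continuous_gaussKer (m : ℕ) (τ : ℝ) : Continuous fun s => gaussKer m s τ := by
  unfold gaussKer
  fun_prop

/-- A function of `x` that vanishes at `x = y` as a product of `n` differences. -/
def diffProd {n : ℕ} (G : E3 → ℝ) (g : Fin n → E3 → ℝ) (y x : E3) : ℝ :=
  G x * ∏ i, (g i x - g i y)

theorem VanishOrder.prod {n : ℕ} : ∀ {q : Fin n → E2 × E2 → ℝ}, (∀ i, VanishOrder 1 (q i)) →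
    VanishOrder n (fun z => ∏ i, q i z) := by
  induction n with
  | zero =>
    intro q _
    have : VanishOrder 0 (fun _ : E2 × E2 => (1 : ℝ)) := contDiff_const
    simpa using this
  | succ n ih =>
    intro q hq
    simp only [Fin.prod_univ_succ]
    have := (ih fun i => hq i.succ).mul (hq 0)
    rwa [add_comm 1 n] at this

/-- `g` is smooth on the surface only, and the graph leaves the surface outside `V`. The bump
removes that part and leaves a function smooth on the whole plane. -/
theorem IsGraphChart.contDiff_bump_mul {Ω : Set E3} (hΩ : IsOpen Ω) {p : E3} {Φ : Frame}
    {h : E2 → ℝ} {V : Set E3} (hc : IsGraphChart Ω p Φ h V) (χ : ContDiffBump p)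
    (hχ : Metric.closedBall p χ.rOut ⊆ V) {g : E3 → ℝ} (hg : ContDiffOn ℝ ∞ g (frontier Ω)) :
    ContDiff ℝ ∞ (fun a => χ (graphMap Φ p h a) * g (graphMap Φ p h a)) := by
  have hψ := contDiff_graphMap Φ p hc.contDiff
  refine contDiff_iff_contDiffAt.2 fun a => ?_
  by_cases ha : graphMap Φ p h a ∈ V
  · have hV : graphMap Φ p h ⁻¹' V ∈ 𝓝 a := hψ.continuous.continuousAt.preimage_mem_nhds
      (hc.isOpen.mem_nhds ha)
    have h1 : ContDiffOn ℝ ∞ (fun a => g (graphMap Φ p h a)) (graphMap Φ p h ⁻¹' V) :=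
      hg.comp hψ.contDiffOn fun b hb => hc.graphMap_mem_frontier hΩ hb
    exact (χ.contDiff.comp hψ).contDiffAt.mul (h1.contDiffAt hV)
  · have hout : {b | χ.rOut < dist (graphMap Φ p h b) p} ∈ 𝓝 a := by
      have hcont := hψ.continuous
      refine (isOpen_lt continuous_const (by fun_prop)).mem_nhds ?_
      by_contra hle
      exact ha (hχ (Metric.mem_closedBall.2 (not_lt.1 hle)))
    refine (contDiffAt_const (c := (0 : ℝ))).congr_of_eventuallyEq ?_
    filter_upwards [hout] with b hb
    rw [χ.zero_of_le_dist (le_of_lt hb), zero_mul]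

theorem continuousOn_diffProd {n : ℕ} {S : Set E3} {G : E3 → ℝ} {g : Fin n → E3 → ℝ}
    (hG : ContinuousOn G S) (hg : ∀ i, ContinuousOn (g i) S) :
    ContinuousOn (fun z : E3 × E3 => diffProd G g z.1 z.2) (S ×ˢ S) := by
  refine (hG.comp continuousOn_snd fun z hz => hz.2).mul (continuousOn_finsetProd _ fun i _ => ?_)
  exact ((hg i).comp continuousOn_snd fun z hz => hz.2).sub
    ((hg i).comp continuousOn_fst fun z hz => hz.1)

/-! ### Uniform bounds for Gaussian kernel integrals over a surface. -/

namespace IsSmoothBoundedRegion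

variable {Ω : Set E3} (hΩ : IsSmoothBoundedRegion Ω)
include hΩ

theorem exists_abs_diffProd_le {n : ℕ} {G : E3 → ℝ} {g : Fin n → E3 → ℝ}
    (hG : ContinuousOn G (frontier Ω)) (hg : ∀ i, ContinuousOn (g i) (frontier Ω)) :
    ∃ M, 0 ≤ M ∧ ∀ y ∈ frontier Ω, ∀ x ∈ frontier Ω, |diffProd G g y x| ≤ M := by
  obtain ⟨M, hM⟩ := (hΩ.isCompact_frontier.prod hΩ.isCompact_frontier).exists_bound_of_continuousOn
    (continuousOn_diffProd hG hg)
  exact ⟨|M|, abs_nonneg M, fun y hy x hx => (hM (y, x) ⟨hy, hx⟩).trans (le_abs_self M)⟩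

theorem integrable_of_abs_le {f : E3 → ℝ} (hf : AEStronglyMeasurable f (surfaceMeasure Ω)) {C : ℝ}
    (hle : ∀ x ∈ frontier Ω, |f x| ≤ C) : Integrable f (surfaceMeasure Ω) := by
  have := hΩ.isFiniteMeasure
  exact Integrable.of_bound hf C ((ae_mem_frontier Ω).mono fun x hx => hle x hx)

theorem abs_integral_le {f : E3 → ℝ} {C : ℝ} (hle : ∀ x ∈ frontier Ω, |f x| ≤ C) :
    |∫ x, f x ∂(surfaceMeasure Ω)| ≤ C * (surfaceMeasure Ω).real univ := by
  have := hΩ.isFiniteMeasure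
  exact norm_integral_le_of_norm_le_const (f := f) (C := C)
    ((ae_mem_frontier Ω).mono fun x hx => hle x hx)

/-- Near p the integral is a planar one, bounded by `abs_integral_mul_gaussKer_le` because each
difference vanishes to first order. Away from p the kernel itself is bounded uniformly in τ. -/
theorem eventually_abs_integral_diffProd_mul_gaussKer_le {n : ℕ} {G : E3 → ℝ}
    {g : Fin (2 * n) → E3 → ℝ} (hG : ContDiffOn ℝ ∞ G (frontier Ω))
    (hg : ∀ i, ContDiffOn ℝ ∞ (g i) (frontier Ω)) {p : E3} (hp : p ∈ frontier Ω) :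
    ∃ C, ∀ᶠ y in 𝓝[frontier Ω] p, ∀ τ, 0 < τ →
      |∫ x, diffProd G g y x * gaussKer (n + 1) (‖y - x‖ ^ 2) τ ∂(surfaceMeasure Ω)| ≤ C := by
  obtain ⟨Φ, h, V, hc⟩ := hΩ.exists_isGraphChart hp
  obtain ⟨ε, hε, hball⟩ := Metric.isOpen_iff.1 hc.isOpen p hc.mem
  -- Base points stay within ρ of p. The first bump is 1 up to 2ρ, so the far part keeps distance ρ
  -- from y; the second is 1 on the support of the first, up to 3ρ, and both live inside the chart.
  set ρ := ε / 5 with hρ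
  have hρ0 : 0 < ρ := by positivity
  let χ₁ : ContDiffBump p := ⟨2 * ρ, 3 * ρ, by positivity, by linarith⟩
  let χ₂ : ContDiffBump p := ⟨3 * ρ, 4 * ρ, by positivity, by linarith⟩
  have hV₁ : Metric.closedBall p χ₁.rOut ⊆ V :=
    (Metric.closedBall_subset_ball (by change 3 * ρ < ε; linarith)).trans hball
  have hV₂ : Metric.closedBall p χ₂.rOut ⊆ V :=
    (Metric.closedBall_subset_ball (by change 4 * ρ < ε; linarith)).trans hball
  obtain ⟨η, hη, hη1, R, hηR⟩ := exists_plane_cutoff ρ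
  set ψ := graphMap Φ p h with hψ
  have hψs : ContDiff ℝ ∞ ψ := contDiff_graphMap Φ p hc.contDiff
  have hJ := contDiff_areaDensity hc.contDiff
  -- the numerator in the chart
  set A : E2 → ℝ := fun a => areaDensity h a * (χ₁ (ψ a) * G (ψ a)) with hA
  have hAs : ContDiff ℝ ∞ A := hJ.mul (hc.contDiff_bump_mul hΩ.isOpen χ₁ hV₁ hG)
  set B : Fin (2 * n) → E2 → ℝ := fun i a => χ₂ (ψ a) * g i (ψ a) with hB
  have hBs : ∀ i, ContDiff ℝ ∞ (B i) := fun i => hc.contDiff_bump_mul hΩ.isOpen χ₂ hV₂ (hg i)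
  have hadd : ContDiff ℝ ∞ (fun z : E2 × E2 => z.2 + z.1) := contDiff_snd.add contDiff_fst
  -- The cutoff `η` acts on the base point and equals one for the base points that occur. It makes
  -- the support in the offset bounded uniformly over all base points.
  set N : E2 × E2 → ℝ := fun z =>
    (η z.2 * A (z.2 + z.1)) * ∏ i, (B i (z.2 + z.1) - B i z.2) with hN
  have hNv : VanishOrderBdd (2 * n) N := by
    refine ⟨(VanishOrder.prod fun i => VanishOrder.of_apply_zero
      (((hBs i).comp hadd).sub ((hBs i).comp contDiff_snd)) (by simp)).smul
      ((hη.comp contDiff_snd).mul (hAs.comp hadd)), 3 * ρ + R, fun z hz => ?_⟩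
    by_cases h2 : R < ‖z.2‖
    · simp [hN, hηR _ h2]
    · have h3 : 3 * ρ ≤ dist (ψ (z.2 + z.1)) p := by
        have h4 := norm_le_norm_graphMap_sub Φ p h (z.2 + z.1)
        have h5 : ‖z.1‖ ≤ ‖z.2 + z.1‖ + ‖z.2‖ := by
          have := norm_sub_le (z.2 + z.1) z.2
          simpa using this
        rw [dist_eq_norm]
        linarith
      simp [hN, hA, χ₁.zero_of_le_dist h3]
  obtain ⟨C₁, hC₁⟩ := abs_integral_mul_gaussKer_le hc.contDiff hc.slope n hNv
    (isCompact_closedBall (0 : E2) ρ)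
  obtain ⟨C₂, hC₂0, hC₂⟩ := exists_abs_gaussKer_mul_pow_le (n + 1)
  obtain ⟨C₃, hC₃0, hC₃⟩ := exists_abs_gaussKer_le (n + 1)
  obtain ⟨M, hM0, hM⟩ := hΩ.exists_abs_diffProd_le hG.continuousOn fun i => (hg i).continuousOn
  refine ⟨C₁ + M * (C₂ / (ρ ^ 2) ^ (n + 1 + 2)) * (surfaceMeasure Ω).real univ, ?_⟩
  filter_upwards [self_mem_nhdsWithin,
    nhdsWithin_le_nhds (Metric.ball_mem_nhds p hρ0)] with y hy hyp τ hτ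
  have hyV : y ∈ V := hball (Metric.ball_subset_ball (by rw [hρ]; linarith) hyp)
  have hyp' : dist y p < ρ := hyp
  set f : E3 → ℝ := fun x => diffProd G g y x * gaussKer (n + 1) (‖y - x‖ ^ 2) τ with hf
  have hfc : ContinuousOn f (frontier Ω) := by
    have h1 : ContinuousOn (fun x => diffProd G g y x) (frontier Ω) :=
      (continuousOn_diffProd hG.continuousOn fun i => (hg i).continuousOn).comp
        (by fun_prop : Continuous fun x : E3 => (y, x)).continuousOn fun x hx => ⟨hy, hx⟩
    refine h1.mul ?_
    exact ((continuous_gaussKer (n + 1) τ).comp (by fun_prop)).continuousOn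
  have hχc : Continuous χ₁ := χ₁.continuous
  have hfb : ∀ x ∈ frontier Ω, |f x| ≤ M * (C₃ / τ ^ (n + 1 + 2)) := fun x hx => by
    rw [hf, abs_mul]
    exact mul_le_mul (hM y hy x hx) (hC₃ _ _ (by positivity) hτ) (abs_nonneg _) hM0
  have hχ1 : ∀ x, |χ₁ x| ≤ 1 := fun x => by rw [abs_of_nonneg χ₁.nonneg]; exact χ₁.le_one
  have hχ2 : ∀ x, |1 - χ₁ x| ≤ 1 := fun x => by
    rw [abs_of_nonneg (by linarith [χ₁.le_one (x := x)])]
    linarith [χ₁.nonneg (x := x)]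
  have i1 : Integrable (fun x => χ₁ x * f x) (surfaceMeasure Ω) := by
    refine hΩ.integrable_of_abs_le (aestronglyMeasurable_surfaceMeasure (by fun_prop))
      (C := 1 * (M * (C₃ / τ ^ (n + 1 + 2)))) fun x hx => ?_
    rw [abs_mul]
    exact mul_le_mul (hχ1 x) (hfb x hx) (abs_nonneg _) zero_le_one
  have i2 : Integrable (fun x => (1 - χ₁ x) * f x) (surfaceMeasure Ω) := by
    refine hΩ.integrable_of_abs_le (aestronglyMeasurable_surfaceMeasure (by fun_prop))
      (C := 1 * (M * (C₃ / τ ^ (n + 1 + 2)))) fun x hx => ?_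
    rw [abs_mul]
    exact mul_le_mul (hχ2 x) (hfb x hx) (abs_nonneg _) zero_le_one
  have hsplit : ∫ x, f x ∂(surfaceMeasure Ω) = ∫ x, χ₁ x * f x ∂(surfaceMeasure Ω)
      + ∫ x, (1 - χ₁ x) * f x ∂(surfaceMeasure Ω) := by
    rw [← integral_add i1 i2]
    congr 1; funext x; ring
  rw [hsplit]
  refine (abs_add_le _ _).trans (add_le_add ?_ ?_)
  · -- the near part
    set b := planeCoord Φ p y with hb
    have hyb : ψ b = y := hc.graphMap_planeCoord hΩ.isOpen hyV hy
    have hbn : ‖b‖ ≤ ρ := (norm_planeCoord_le Φ p y).trans (by rw [← dist_eq_norm]; exact hyp'.le)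
    have hχy : χ₂ (ψ b) = 1 := by
      rw [hyb]
      refine χ₂.one_of_mem_closedBall ?_
      change dist y p ≤ 3 * ρ
      linarith
    -- Pass to the chart and translate the plane, so that the integration variable becomes the
    -- offset from the base point.
    rw [hc.setIntegral_surfaceMeasure hΩ.isOpen (fun x hx => by
      rw [χ₁.zero_of_le_dist (le_of_lt (not_le.1 fun hle => hx (hV₁ hle))), zero_mul]),
      ← integral_add_left_eq_self _ b]
    refine le_trans (le_of_eq ?_) (hC₁ b (by simpa using hbn) τ hτ)
    congr 2
    funext v
    have hsq : ‖y - ψ (b + v)‖ ^ 2 = graphSq h (v, b) := by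
      rw [← hyb, ← dist_eq_norm, hψ, dist_graphMap, graphSq, incr, dist_eq_norm]
      simp only [sub_add_cancel_left, norm_neg]
      ring
    simp only [hf, hN, hA, smul_eq_mul]
    rw [← hψ, hsq, hη1 b hbn, diffProd]
    by_cases hout : 3 * ρ ≤ dist (ψ (b + v)) p
    · rw [χ₁.zero_of_le_dist hout]
      ring
    · have hχv : χ₂ (ψ (b + v)) = 1 :=
        χ₂.one_of_mem_closedBall (not_le.1 hout).le
      have : ∀ i, B i (b + v) - B i b = g i (ψ (b + v)) - g i y := fun i => by
        simp only [hB]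
        rw [hχv, hχy, hyb]
        ring
      simp only [this]
      ring
  · -- the far part
    refine hΩ.abs_integral_le fun x hx => ?_
    rw [abs_mul]
    by_cases hnear : dist x p ≤ 2 * ρ
    · rw [χ₁.one_of_mem_closedBall hnear]
      simp only [sub_self, abs_zero, zero_mul]
      positivity
    · have hxy : ρ ≤ ‖y - x‖ := by
        rw [← dist_eq_norm, dist_comm]
        have := dist_triangle x y p
        linarith
      have hk : |gaussKer (n + 1) (‖y - x‖ ^ 2) τ| ≤ C₂ / (ρ ^ 2) ^ (n + 1 + 2) := by
        rw [le_div_iff₀ (by positivity)]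
        refine le_trans ?_ (hC₂ (‖y - x‖ ^ 2) τ (by positivity) hτ)
        gcongr
      calc _ ≤ 1 * |f x| := by gcongr; exact hχ2 x
        _ = |diffProd G g y x| * |gaussKer (n + 1) (‖y - x‖ ^ 2) τ| := by rw [one_mul, hf, abs_mul]
        _ ≤ _ := mul_le_mul (hM y hy x hx) hk (abs_nonneg _) hM0

theorem exists_abs_integral_diffProd_mul_gaussKer_le {n : ℕ} {G : E3 → ℝ}
    {g : Fin (2 * n) → E3 → ℝ} (hG : ContDiffOn ℝ ∞ G (frontier Ω))
    (hg : ∀ i, ContDiffOn ℝ ∞ (g i) (frontier Ω)) :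
    ∃ C, ∀ y ∈ frontier Ω, ∀ τ, 0 < τ →
      |∫ x, diffProd G g y x * gaussKer (n + 1) (‖y - x‖ ^ 2) τ ∂(surfaceMeasure Ω)| ≤ C := by
  refine hΩ.isCompact_frontier.induction_on (p := fun S => ∃ C, ∀ y ∈ S, ∀ τ, 0 < τ →
      |∫ x, diffProd G g y x * gaussKer (n + 1) (‖y - x‖ ^ 2) τ ∂(surfaceMeasure Ω)| ≤ C)
    ⟨0, by simp⟩ ?_ ?_ ?_
  · rintro S T hST ⟨C, hC⟩
    exact ⟨C, fun y hy => hC y (hST hy)⟩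
  · rintro S T ⟨C, hC⟩ ⟨D, hD⟩
    refine ⟨max C D, fun y hy τ hτ => ?_⟩
    rcases hy with hy | hy
    · exact (hC y hy τ hτ).trans (le_max_left _ _)
    · exact (hD y hy τ hτ).trans (le_max_right _ _)
  · intro p hp
    obtain ⟨C, hC⟩ := hΩ.eventually_abs_integral_diffProd_mul_gaussKer_le hG hg hp
    exact ⟨_, hC, C, fun y hy => hy⟩

end IsSmoothBoundedRegion

/-! ### Smoothing functions -/

theorem hasDerivAt_exp_neg_sq (r : ℝ) :
    HasDerivAt (fun r => Real.exp (-r ^ 2)) (-2 * r * Real.exp (-r ^ 2)) r := by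
  refine ((hasDerivAt_pow 2 r).fun_neg.exp).congr_deriv ?_
  push_cast
  ring

theorem hasDerivAt_erf (r : ℝ) : HasDerivAt erf (2 / √Real.pi * Real.exp (-r ^ 2)) r := by
  have hc : Continuous fun t : ℝ => Real.exp (-t ^ 2) := by fun_prop
  exact (intervalIntegral.integral_hasDerivAt_right (hc.intervalIntegrable _ _)
    (hc.stronglyMeasurableAtFilter _ _) hc.continuousAt).const_mul _

theorem erf_zero : erf 0 = 0 := by simp [erf]

theorem pow_mul_exp_neg_sq_le (n : ℕ) {r : ℝ} (hr : 0 ≤ r) :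
    r ^ n * Real.exp (-r ^ 2) ≤ Real.exp 1 * n.factorial * Real.exp (-r) := by
  have h1 : Real.exp (-r ^ 2) ≤ Real.exp 1 * Real.exp (-r) * Real.exp (-r) := by
    rw [← Real.exp_add, ← Real.exp_add, Real.exp_le_exp]
    nlinarith [sq_nonneg (r - 1)]
  calc r ^ n * Real.exp (-r ^ 2) ≤ r ^ n * (Real.exp 1 * Real.exp (-r) * Real.exp (-r)) := by
        gcongr
    _ = Real.exp 1 * (r ^ n * Real.exp (-r)) * Real.exp (-r) := by ring
    _ ≤ _ := by gcongr; exact pow_mul_exp_neg_le n hr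

theorem tendsto_pow_mul_exp_neg_sq (n : ℕ) :
    Tendsto (fun r : ℝ => r ^ n * Real.exp (-r ^ 2)) atTop (𝓝 0) := by
  have h1 : Tendsto (fun r : ℝ => Real.exp 1 * n.factorial * Real.exp (-r)) atTop (𝓝 0) := by
    simpa using Real.tendsto_exp_neg_atTop_nhds_zero.const_mul (Real.exp 1 * n.factorial)
  refine squeeze_zero' ?_ ?_ h1
  · filter_upwards [eventually_ge_atTop 0] with r hr
    positivity
  · filter_upwards [eventually_ge_atTop 0] with r hr using pow_mul_exp_neg_sq_le n hr

theorem tendsto_erf : Tendsto erf atTop (𝓝 1) := by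
  have h1 : IntegrableOn (fun t : ℝ => Real.exp (-t ^ 2)) (Ioi 0) := by
    simpa using (integrable_exp_neg_mul_sq (b := 1) one_pos).integrableOn
  have h2 := intervalIntegral_tendsto_integral_Ioi (0 : ℝ) h1 tendsto_id
  have h3 : ∫ t in Ioi (0 : ℝ), Real.exp (-t ^ 2) = √Real.pi / 2 := by
    simpa using integral_gaussian_Ioi 1
  rw [h3] at h2
  have h4 := h2.const_mul (2 / √Real.pi)
  have hpi : √Real.pi ≠ 0 := (Real.sqrt_pos.2 Real.pi_pos).ne'
  have h5 : 2 / √Real.pi * (√Real.pi / 2) = 1 := by field_simp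
  rwa [h5] at h4

/-- Adding C exp(-r) makes s decreasing and subtracting it makes s increasing, and both combinations
tend to 1. -/
theorem abs_sub_one_le_of_deriv {s s' : ℝ → ℝ} {C : ℝ} (hd : ∀ r, HasDerivAt s (s' r) r)
    (hs' : ∀ r, 0 ≤ r → |s' r| ≤ C * Real.exp (-r)) (hs : Tendsto s atTop (𝓝 1)) {r : ℝ}
    (hr : 0 ≤ r) : |s r - 1| ≤ C * Real.exp (-r) := by
  have he : ∀ x : ℝ, HasDerivAt (fun x => C * Real.exp (-x)) (-(C * Real.exp (-x))) x := fun x =>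
    ((hasDerivAt_neg x).exp.const_mul C).congr_deriv (by ring)
  have ht : Tendsto (fun x => C * Real.exp (-x)) atTop (𝓝 0) := by
    simpa using Real.tendsto_exp_neg_atTop_nhds_zero.const_mul C
  have h1 : AntitoneOn (fun x => s x + C * Real.exp (-x)) (Ici 0) := by
    refine antitoneOn_of_deriv_nonpos (convex_Ici 0) ?_ ?_ ?_
    · exact fun x _ => ((hd x).fun_add (he x)).continuousAt.continuousWithinAt
    · exact fun x _ => ((hd x).fun_add (he x)).differentiableAt.differentiableWithinAt
    · intro x hx
      rw [interior_Ici] at hx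
      rw [((hd x).fun_add (he x)).deriv]
      linarith [(abs_le.1 (hs' x (le_of_lt hx))).2]
  have h2 : MonotoneOn (fun x => s x - C * Real.exp (-x)) (Ici 0) := by
    refine monotoneOn_of_deriv_nonneg (convex_Ici 0) ?_ ?_ ?_
    · exact fun x _ => ((hd x).fun_sub (he x)).continuousAt.continuousWithinAt
    · exact fun x _ => ((hd x).fun_sub (he x)).differentiableAt.differentiableWithinAt
    · intro x hx
      rw [interior_Ici] at hx
      rw [((hd x).fun_sub (he x)).deriv]
      linarith [(abs_le.1 (hs' x (le_of_lt hx))).1]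
  have l1 : 1 ≤ s r + C * Real.exp (-r) := by
    have : Tendsto (fun x => s x + C * Real.exp (-x)) atTop (𝓝 1) := by simpa using hs.add ht
    refine le_of_tendsto this ?_
    filter_upwards [eventually_ge_atTop r] with x hx using h1 hr (hr.trans hx) hx
  have l2 : s r - C * Real.exp (-r) ≤ 1 := by
    have : Tendsto (fun x => s x - C * Real.exp (-x)) atTop (𝓝 1) := by simpa using hs.sub ht
    refine ge_of_tendsto this ?_
    filter_upwards [eventually_ge_atTop r] with x hx using h2 hr (hr.trans hx) hx
  rw [abs_le]
  constructor <;> linarith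

/-- `s` vanishes at zero, tends to one at infinity, and has derivative
`r ^ (2 * k) * Q (r ^ 2) * exp (-r ^ 2)`. -/
structure IsGaussProfile (s : ℝ → ℝ) (k : ℕ) (Q : ℝ → ℝ) : Prop where
  zero : s 0 = 0
  tendsto : Tendsto s atTop (𝓝 1)
  hasDerivAt : ∀ r, HasDerivAt s (r ^ (2 * k) * Q (r ^ 2) * Real.exp (-r ^ 2)) r

/-- The smooth function `Λ` with `s r = r ^ (2 * k + 1) * Λ (r ^ 2)`. -/
noncomputable def profileQuot (k : ℕ) (Q : ℝ → ℝ) (S : ℝ) : ℝ :=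
  ∫ u in (0 : ℝ)..1, u ^ (2 * k) * Q (S * u ^ 2) * Real.exp (-(S * u ^ 2))

theorem contDiff_profileQuot (k : ℕ) {Q : ℝ → ℝ} (hQ : ContDiff ℝ ∞ Q) :
    ContDiff ℝ ∞ (profileQuot k Q) := by
  refine contDiff_intervalIntegral
    (F := fun z : ℝ × ℝ => z.2 ^ (2 * k) * Q (z.1 * z.2 ^ 2) * Real.exp (-(z.1 * z.2 ^ 2))) ?_
  fun_prop

namespace IsGaussProfile

variable {s : ℝ → ℝ} {k : ℕ} {Q : ℝ → ℝ}

/-- Integrate the derivative of u ↦ s(ru) over [0, 1] and pull out r^(2k+1). -/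
theorem eq_pow_mul (hs : IsGaussProfile s k Q) (hQ : ContDiff ℝ ∞ Q) (r : ℝ) :
    s r = r ^ (2 * k + 1) * profileQuot k Q (r ^ 2) := by
  have hQc := hQ.continuous
  have hd : ∀ u : ℝ, HasDerivAt (fun u => s (r * u))
      (r ^ (2 * k + 1) * (u ^ (2 * k) * Q (r ^ 2 * u ^ 2) * Real.exp (-(r ^ 2 * u ^ 2)))) u :=
    fun u => ((hs.hasDerivAt (r * u)).comp u ((hasDerivAt_id u).const_mul r)).congr_deriv (by
      simp only [mul_pow]; ring)
  have := intervalIntegral.integral_eq_sub_of_hasDerivAt (a := 0) (b := 1) (fun u _ => hd u)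
    (Continuous.intervalIntegrable (by fun_prop) _ _)
  rw [intervalIntegral.integral_const_mul] at this
  simp only [mul_one, mul_zero, hs.zero, sub_zero] at this
  exact this.symm

/-- The quotient is δ^(-p) Λ(‖z‖²/δ²), smooth because it depends on z only through ‖z‖². -/
theorem isSmoothingFactor (hs : IsGaussProfile s k Q) (hQ : ContDiff ℝ ∞ Q) :
    IsSmoothingFactor s (2 * k + 1) := by
  have hΛ := contDiff_profileQuot k hQ
  refine ⟨hs.tendsto, ?_, fun δ hδ => ?_⟩
  · have h1 : (fun r => profileQuot k Q (r ^ 2)) =O[𝓝[>] 0] (fun _ => (1 : ℝ)) := by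
      have hc : Continuous fun r : ℝ => profileQuot k Q (r ^ 2) :=
        hΛ.continuous.comp (by fun_prop)
      exact (hc.tendsto 0).isBigO_one ℝ |>.mono nhdsWithin_le_nhds
    have h2 := (isBigO_refl (fun r : ℝ => r ^ (2 * k + 1)) (𝓝[>] 0)).mul h1
    simp only [mul_one] at h2
    exact h2.congr_left fun r => (hs.eq_pow_mul hQ r).symm
  · refine ⟨fun z => (δ ^ (2 * k + 1))⁻¹ * profileQuot k Q (‖z‖ ^ 2 / δ ^ 2), ?_, fun z hz => ?_⟩
    · have : ContDiff ℝ ∞ (fun z : E3 => ‖z‖ ^ 2 / δ ^ 2) := (contDiff_norm_sq ℝ).div_const _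
      exact contDiff_const.mul (hΛ.comp this)
    · have hz0 : ‖z‖ ≠ 0 := norm_ne_zero_iff.2 hz
      rw [hs.eq_pow_mul hQ, div_pow, div_pow]
      field_simp

theorem continuous (hs : IsGaussProfile s k Q) : Continuous s :=
  continuous_iff_continuousAt.2 fun r => (hs.hasDerivAt r).continuousAt

end IsGaussProfile

theorem integrableOn_of_abs_le_pow_mul_exp {f : ℝ → ℝ} (hf : Continuous f) {C : ℝ} {n : ℕ}
    (h : ∀ r, 0 ≤ r → |f r| ≤ C * (r ^ n * Real.exp (-r))) : IntegrableOn f (Ioi 0) := by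
  refine integrable_of_isBigO_exp_neg (b := 1 / 2) (by norm_num) hf.continuousOn ?_
  have h1 : f =O[atTop] fun r : ℝ => r ^ n * Real.exp (-r) := by
    refine IsBigO.of_bound C ?_
    filter_upwards [eventually_ge_atTop 0] with r hr
    rw [Real.norm_eq_abs, Real.norm_of_nonneg (by positivity)]
    exact h r hr
  refine h1.trans ?_
  have h2 := ((isLittleO_pow_exp_pos_mul_atTop n (b := 1 / 2) (by norm_num)).isBigO).mul
    (isBigO_refl (fun r : ℝ => Real.exp (-r)) atTop)
  refine h2.congr_right fun r => ?_
  rw [← Real.exp_add]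
  congr 1; ring

/-- The profiles with derivative `c * r ^ (2 * k) * exp (-r ^ 2)`. -/
theorem IsGaussProfile.isHighOrderModification {s t : ℝ → ℝ} {k : ℕ} {c : ℝ} (hc : 0 < c)
    (hs : IsGaussProfile s k fun _ => c)
    (ht : ∀ r, s r + (5 / 3 + 1 / 3 * (2 * k - 2 * r ^ 2)) * (c * r ^ (2 * k + 1) *
      Real.exp (-r ^ 2)) = t r) : IsHighOrderModification s t (2 * k + 1) := by
  set g : ℝ → ℝ := fun r => c * r ^ (2 * k + 1) * Real.exp (-r ^ 2) with hg
  have hgc : Continuous g := by fun_prop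
  -- With s' = c r^(2k) exp(-r²), r s' is `g` and r² s'' is (2k - 2r²) `g`.
  have hmod : ∀ a b r, modify s a b r = s r + (a + b * (2 * k - 2 * r ^ 2)) * g r := by
    intro a b r
    have e1 : deriv s = fun r => c * r ^ (2 * k) * Real.exp (-r ^ 2) := by
      funext r; rw [(hs.hasDerivAt r).deriv]; ring
    have e2 : deriv (fun r : ℝ => c * r ^ (2 * k) * Real.exp (-r ^ 2)) r
        = c * ((2 * k : ℕ) * r ^ (2 * k - 1)) * Real.exp (-r ^ 2)
          + c * r ^ (2 * k) * (-2 * r * Real.exp (-r ^ 2)) :=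
      (((hasDerivAt_pow (2 * k) r).const_mul c).fun_mul (hasDerivAt_exp_neg_sq r)).deriv
    have e3 : r ^ 2 * ((2 * k : ℕ) * r ^ (2 * k - 1)) = (2 * k : ℕ) * r ^ (2 * k + 1) := by
      rcases k with _ | k
      · simp
      · have : 2 * (k + 1) - 1 = 2 * k + 1 := by omega
        rw [this]; ring
    rw [modify, e1, e2, hg]
    push_cast at e3 ⊢
    linear_combination b * c * Real.exp (-r ^ 2) * e3
  have hsc := hs.continuous
  have hmodc : ∀ a b, Continuous (modify s a b) := fun a b => by
    rw [funext (hmod a b)]; fun_prop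
  have hs1 : ∀ r, 0 ≤ r → |s r - 1| ≤ c * (Real.exp 1 * (2 * k).factorial) * Real.exp (-r) :=
    fun r hr => abs_sub_one_le_of_deriv hs.hasDerivAt (fun r hr => by
      rw [abs_of_nonneg (by have := pow_nonneg hr (2 * k); positivity)]
      have := mul_le_mul_of_nonneg_left (pow_mul_exp_neg_sq_le (2 * k) hr) hc.le
      linarith) hs.tendsto hr
  have hgle : ∀ n r, 0 ≤ r → |r ^ n * g r| ≤
      c * (Real.exp 1 * (n + (2 * k + 1)).factorial) * Real.exp (-r) := fun n r hr => by
    rw [abs_of_nonneg (by have := pow_nonneg hr (2 * k + 1); positivity)]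
    have := mul_le_mul_of_nonneg_left (pow_mul_exp_neg_sq_le (n + (2 * k + 1)) hr) hc.le
    rw [pow_add] at this
    simp only [hg]
    linarith
  have is : ∀ n, IntegrableOn (fun r => r ^ n * (s r - 1)) (Ioi 0) := fun n => by
    refine integrableOn_of_abs_le_pow_mul_exp (by fun_prop)
      (C := c * (Real.exp 1 * (2 * k).factorial)) (n := n) fun r hr => ?_
    rw [abs_mul, abs_of_nonneg (pow_nonneg hr n)]
    have := mul_le_mul_of_nonneg_left (hs1 r hr) (pow_nonneg hr n)
    linarith
  have ig : ∀ n, IntegrableOn (fun r => r ^ n * g r) (Ioi 0) := fun n =>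
    integrableOn_of_abs_le_pow_mul_exp (by fun_prop) (n := 0) fun r hr => by
      simpa using hgle n r hr
  have im : ∀ a b n, IntegrableOn (fun r => r ^ n * (modify s a b r - 1)) (Ioi 0) := by
    intro a b n
    have := ((is n).add ((ig n).const_mul (a + 2 * b * k))).add ((ig (n + 2)).const_mul (-2 * b))
    refine this.congr_fun (fun r _ => ?_) measurableSet_Ioi
    simp only [Pi.add_apply, hmod]
    ring
  have gpos : ∀ n, 0 < ∫ r in Ioi (0 : ℝ), r ^ n * g r := fun n => by
    rw [setIntegral_pos_iff_support_of_nonneg_ae ?_ (ig n)]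
    · have : (Function.support fun r => r ^ n * g r) ∩ Ioi 0 = Ioi 0 := by
        refine inter_eq_right.2 fun r hr => ?_
        have hr' : (0 : ℝ) < r := hr
        have : 0 < r ^ n * g r := by positivity
        exact this.ne'
      rw [this]
      simp
    · refine (ae_restrict_iff' measurableSet_Ioi).2 (Eventually.of_forall fun r hr => ?_)
      have hr' : (0 : ℝ) < r := hr
      have : 0 < r ^ n * g r := by positivity
      exact this.le
  -- the two moments of the modified function
  have moment : ∀ a b (n : ℕ), ∫ r in Ioi (0 : ℝ), r ^ n * (modify s a b r - 1)
      = (a - (1 / (n + 1) + (n + 2) * b)) * ∫ r in Ioi (0 : ℝ), r ^ n * g r := by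
    intro a b n
    have hn : (n : ℝ) + 1 ≠ 0 := by positivity
    -- This primitive vanishes at zero and at infinity; its derivative is the moment integrand minus
    -- a multiple of r^n `g`, which gives the formula for the moment.
    have hF : ∀ r, HasDerivAt (fun r => r ^ (n + 1) * (s r - 1) / (n + 1)
        + b * (r ^ (n + 1) * g r))
        (r ^ n * (modify s a b r - 1)
          - (a - (1 / (n + 1) + (n + 2) * b)) * (r ^ n * g r)) r := by
      intro r
      have d1 := (((hasDerivAt_pow (n + 1) r).fun_mul
        ((hs.hasDerivAt r).sub_const 1)).div_const ((n : ℝ) + 1))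
      have d2 := (((hasDerivAt_pow (n + 1 + (2 * k + 1)) r).fun_mul
        (hasDerivAt_exp_neg_sq r)).const_mul (b * c))
      have e : (fun r => b * (r ^ (n + 1) * g r))
          = fun r => b * c * (r ^ (n + 1 + (2 * k + 1)) * Real.exp (-r ^ 2)) := by
        funext r; simp only [hg]; ring
      rw [← e] at d2
      refine (d1.fun_add d2).congr_deriv ?_
      have e2 : n + 1 + (2 * k + 1) - 1 = n + (2 * k + 1) := by omega
      rw [hmod, e2, Nat.add_sub_cancel]
      simp only [hg]
      push_cast
      field_simp
      ring
    have hint : IntegrableOn (fun r => r ^ n * (modify s a b r - 1)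
        - (a - (1 / (n + 1) + (n + 2) * b)) * (r ^ n * g r)) (Ioi 0) :=
      (im a b n).sub ((ig n).const_mul _)
    have t1 : Tendsto (fun r => r ^ (n + 1) * (s r - 1)) atTop (𝓝 0) := by
      have h1 := (Real.tendsto_pow_mul_exp_neg_atTop_nhds_zero (n + 1)).const_mul
        (c * (Real.exp 1 * (2 * k).factorial))
      rw [mul_zero] at h1
      refine squeeze_zero_norm' ?_ h1
      filter_upwards [eventually_ge_atTop 0] with r hr
      rw [Real.norm_eq_abs, abs_mul, abs_of_nonneg (pow_nonneg hr _)]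
      have := mul_le_mul_of_nonneg_left (hs1 r hr) (pow_nonneg hr (n + 1))
      linarith
    have t2 : Tendsto (fun r => r ^ (n + 1) * g r) atTop (𝓝 0) := by
      have h1 := (tendsto_pow_mul_exp_neg_sq (n + 1 + (2 * k + 1))).const_mul c
      rw [mul_zero] at h1
      refine h1.congr fun r => ?_
      simp only [hg]; ring
    have t3 : Tendsto (fun r => r ^ (n + 1) * (s r - 1) / (n + 1)
        + b * (r ^ (n + 1) * g r)) atTop (𝓝 0) := by
      simpa using (t1.div_const ((n : ℝ) + 1)).add (t2.const_mul b)
    have := integral_Ioi_of_hasDerivAt_of_tendsto' (a := 0) (fun r _ => hF r) hint t3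
    rw [integral_sub (im a b n) ((ig n).const_mul _), integral_const_mul] at this
    simp only [ne_eq, Nat.add_eq_zero_iff, one_ne_zero, and_false, not_false_eq_true, zero_pow,
      zero_mul, zero_div, mul_zero, add_zero, sub_zero] at this
    linarith
  have hmi : ∀ a b n, EqOn (momentIntegrand (modify s a b) (2 * k + 1) (2 * k + 1 + n))
      (fun r => r ^ n * (modify s a b r - 1)) (Ioi 0) := fun a b n r hr => by
    have hr' : (r : ℝ) ≠ 0 := ne_of_gt hr
    rw [momentIntegrand, pow_add r (2 * k + 1) n]
    field_simp
  have hiff : ∀ a b (n : ℕ), MomentVanishes (modify s a b) (2 * k + 1) (2 * k + 1 + n) ↔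
      a = 1 / (n + 1) + (n + 2) * b := by
    intro a b n
    rw [MomentVanishes, setIntegral_congr_fun measurableSet_Ioi (hmi a b n), moment,
      and_iff_right ((im a b n).congr_fun (hmi a b n).symm measurableSet_Ioi),
      mul_eq_zero, or_iff_left (gpos n).ne', sub_eq_zero]
  -- 5/3 and 1/3 solve a = 1 + 2b and a = 1/3 + 4b, the conditions for n = 0 and n = 2.
  have htm : modify s (5 / 3) (1 / 3) = t := funext fun r => by rw [hmod, ← ht]
  refine ⟨5 / 3, 1 / 3, fun r => by rw [htm], ?_, ?_, fun a' b' h0 h2 => ?_⟩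
  · rw [← htm]; exact (hiff _ _ 0).2 (by norm_num)
  · rw [← htm]; exact (hiff _ _ 2).2 (by norm_num)
  · have h0' := (hiff a' b' 0).1 h0
    have h2' := (hiff a' b' 2).1 h2
    norm_num at h0' h2'
    constructor <;> linarith

/-- A function `erf r - r * P (r ^ 2) * exp (-r ^ 2)` with `P` given through its derivative. -/
theorem hasDerivAt_erf_sub {p p' : ℝ → ℝ} {r : ℝ} (hp : HasDerivAt p (p' r) r) :
    HasDerivAt (fun r => erf r - p r * Real.exp (-r ^ 2) / √Real.pi)
      ((2 - p' r + 2 * r * p r) * Real.exp (-r ^ 2) / √Real.pi) r := by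
  refine ((hasDerivAt_erf r).fun_sub
    ((hp.fun_mul (hasDerivAt_exp_neg_sq r)).div_const _)).congr_deriv ?_
  ring

theorem tendsto_erf_sub {p : ℝ → ℝ}
    (hp : Tendsto (fun r => p r * Real.exp (-r ^ 2)) atTop (𝓝 0)) :
    Tendsto (fun r => erf r - p r * Real.exp (-r ^ 2) / √Real.pi) atTop (𝓝 1) := by
  simpa using tendsto_erf.sub (hp.div_const √Real.pi)

/-! ### The six concrete smoothing functions. -/

theorem isGaussProfile_s₁ : IsGaussProfile s₁ 0 fun _ => 2 / √Real.pi where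
  zero := erf_zero
  tendsto := tendsto_erf
  hasDerivAt r := (hasDerivAt_erf r).congr_deriv (by simp)

theorem isGaussProfile_s₂ : IsGaussProfile s₂ 1 fun _ => 4 / √Real.pi where
  zero := by simp [s₂, erf_zero]
  tendsto := tendsto_erf_sub <| by
    simpa [mul_assoc] using (tendsto_pow_mul_exp_neg_sq 1).const_mul 2
  hasDerivAt r := (hasDerivAt_erf_sub (p := fun r => 2 * r) (p' := fun _ => 2)
    (by simpa using (hasDerivAt_id r).const_mul 2)).congr_deriv (by ring)

theorem isGaussProfile_s₃ : IsGaussProfile s₃ 2 fun _ => 8 / (3 * √Real.pi) where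
  zero := by simp [s₃, erf_zero]
  tendsto := tendsto_erf_sub <| by
    have := ((tendsto_pow_mul_exp_neg_sq 3).const_mul (4 / 3)).add
      ((tendsto_pow_mul_exp_neg_sq 1).const_mul 2)
    simp only [mul_zero, add_zero] at this
    exact this.congr fun r => by ring
  hasDerivAt r := (hasDerivAt_erf_sub (p := fun r => 2 * r * (2 / 3 * r ^ 2 + 1))
    (p' := fun r => 4 * r ^ 2 + 2) ((((hasDerivAt_id r).const_mul 2).fun_mul
      (((hasDerivAt_pow 2 r).const_mul (2 / 3)).add_const 1)).congr_deriv (by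
        simp only [id]; push_cast; ring))).congr_deriv (by field_simp; ring)

/-- The derivative factor of the high-order smoothing functions. -/
noncomputable def highFactor (k : ℕ) (c S : ℝ) : ℝ :=
  c * (S ^ 2 - (2 * k + 4) * S + (k + 1) * (k + 2))

theorem contDiff_highFactor (k : ℕ) (c : ℝ) : ContDiff ℝ ∞ (highFactor k c) := by
  unfold highFactor
  fun_prop

/-- The quadratic in `highFactor k` is the one occurring in `gaussKer (k + 1)`. In all three cases
the constant is 4/3 times that of the basic factor. -/
theorem isGaussProfile_s₁High : IsGaussProfile s₁High 0 (highFactor 0 (8 / (3 * √Real.pi))) where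
  zero := by simp [s₁High, erf_zero]
  tendsto := tendsto_erf_sub <| by
    have := ((tendsto_pow_mul_exp_neg_sq 3).const_mul (4 / 3)).sub
      ((tendsto_pow_mul_exp_neg_sq 1).const_mul (10 / 3))
    simp only [mul_zero, sub_zero] at this
    exact this.congr fun r => by ring
  hasDerivAt r := (hasDerivAt_erf_sub (p := fun r => 2 / 3 * r * (2 * r ^ 2 - 5))
    (p' := fun r => 4 * r ^ 2 - 10 / 3) ((((hasDerivAt_id r).const_mul (2 / 3)).fun_mul
      (((hasDerivAt_pow 2 r).const_mul 2).sub_const 5)).congr_deriv (by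
        simp only [id]; push_cast; ring))).congr_deriv (by
          simp only [highFactor]; push_cast; field_simp; ring)

theorem isGaussProfile_s₂High : IsGaussProfile s₂High 1 (highFactor 1 (16 / (3 * √Real.pi))) where
  zero := by simp [s₂High, erf_zero]
  tendsto := tendsto_erf_sub <| by
    have := (((tendsto_pow_mul_exp_neg_sq 5).const_mul (8 / 3)).sub
      ((tendsto_pow_mul_exp_neg_sq 3).const_mul (28 / 3))).add
      ((tendsto_pow_mul_exp_neg_sq 1).const_mul 2)
    simp only [mul_zero, sub_zero, add_zero] at this
    exact this.congr fun r => by ring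
  hasDerivAt r := (hasDerivAt_erf_sub
    (p := fun r => 2 / 3 * r * (4 * r ^ 4 - 14 * r ^ 2 + 3))
    (p' := fun r => 40 / 3 * r ^ 4 - 28 * r ^ 2 + 2) ((((hasDerivAt_id r).const_mul (2 / 3)).fun_mul
      ((((hasDerivAt_pow 4 r).const_mul 4).fun_sub ((hasDerivAt_pow 2 r).const_mul 14)).add_const
        3)).congr_deriv (by
        simp only [id]; push_cast; ring))).congr_deriv (by
          simp only [highFactor]; push_cast; field_simp; ring)

theorem isGaussProfile_s₃High : IsGaussProfile s₃High 2 (highFactor 2 (32 / (9 * √Real.pi))) where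
  zero := by simp [s₃High, erf_zero]
  tendsto := tendsto_erf_sub <| by
    have := ((((tendsto_pow_mul_exp_neg_sq 7).const_mul (16 / 9)).sub
      ((tendsto_pow_mul_exp_neg_sq 5).const_mul 8)).add
      ((tendsto_pow_mul_exp_neg_sq 3).const_mul (4 / 3))).add
      ((tendsto_pow_mul_exp_neg_sq 1).const_mul 2)
    simp only [mul_zero, sub_zero, add_zero] at this
    exact this.congr fun r => by ring
  hasDerivAt r := (hasDerivAt_erf_sub
    (p := fun r => 2 / 9 * r * (8 * r ^ 6 - 36 * r ^ 4 + 6 * r ^ 2 + 9))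
    (p' := fun r => 112 / 9 * r ^ 6 - 40 * r ^ 4 + 4 * r ^ 2 + 2)
      ((((hasDerivAt_id r).const_mul (2 / 9)).fun_mul
      (((((hasDerivAt_pow 6 r).const_mul 8).fun_sub ((hasDerivAt_pow 4 r).const_mul 36)).fun_add
        ((hasDerivAt_pow 2 r).const_mul 6)).add_const 9)).congr_deriv (by
        simp only [id]; push_cast; ring))).congr_deriv (by
          simp only [highFactor]; push_cast; field_simp; ring)

theorem isHighOrderModification_s₁ : IsHighOrderModification s₁ s₁High 1 :=
  isGaussProfile_s₁.isHighOrderModification (by positivity) fun r => by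
    simp only [s₁, s₁High]; push_cast; field_simp; ring

theorem isHighOrderModification_s₂ : IsHighOrderModification s₂ s₂High 3 :=
  isGaussProfile_s₂.isHighOrderModification (by positivity) fun r => by
    simp only [s₂, s₂High]; push_cast; field_simp; ring

theorem isHighOrderModification_s₃ : IsHighOrderModification s₃ s₃High 5 :=
  isGaussProfile_s₃.isHighOrderModification (by positivity) fun r => by
    simp only [s₃, s₃High]; push_cast; field_simp; ring

/-! ### The error of one scalar regularized integral. -/

theorem IsGaussProfile.exists_abs_le {s : ℝ → ℝ} {k : ℕ} {Q : ℝ → ℝ} (hs : IsGaussProfile s k Q) :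
    ∃ A, 0 ≤ A ∧ ∀ r, 0 ≤ r → |s r| ≤ A := by
  obtain ⟨R, hR⟩ := eventually_atTop.1 (hs.tendsto.abs.eventually_le_const
    (show |(1 : ℝ)| < 2 by norm_num))
  obtain ⟨B, hB⟩ := (isCompact_Icc (a := (0 : ℝ)) (b := R)).exists_bound_of_continuousOn
    hs.continuous.continuousOn
  refine ⟨max 2 B, le_max_of_le_left (by norm_num), fun r hr => ?_⟩
  rcases le_total R r with h | h
  · exact (hR r h).trans (le_max_left _ _)
  · exact (hB r ⟨hr, h⟩).trans (le_max_right _ _)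

/-- The derivative of `s (r / δ) / r ^ (2 k + 1)` in `δ` is a heat-type kernel. -/
theorem IsGaussProfile.hasDerivAt_div {s : ℝ → ℝ} {k : ℕ} {c : ℝ}
    (hs : IsGaussProfile s k (highFactor k c)) {r δ : ℝ} (hr : 0 < r) (hδ : 0 < δ) :
    HasDerivAt (fun δ => (s (r / δ) - 1) / r ^ (2 * k + 1))
      (-c * δ ^ 4 * gaussKer (k + 1) (r ^ 2) (δ ^ 2)) δ := by
  have h1 : HasDerivAt (fun δ : ℝ => r / δ) (-r / δ ^ 2) δ := by
    refine ((hasDerivAt_const δ r).fun_div (hasDerivAt_id δ) hδ.ne').congr_deriv ?_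
    simp
  refine ((((hs.hasDerivAt (r / δ)).comp δ h1).sub_const 1).div_const _).congr_deriv ?_
  rw [gaussKer, highFactor, ← div_pow, show -((r / δ) ^ 2) = -r ^ 2 / δ ^ 2 by ring,
    show -r ^ 2 / δ ^ 2 = -(r / δ) ^ 2 by ring]
  push_cast
  have e : r ^ (2 * k + 1) = r ^ (2 * k) * r := pow_succ _ _
  have e2 : (δ ^ 2) ^ (k + 1 + 2) = δ ^ (2 * k) * δ ^ 6 := by ring
  rw [e, e2, div_pow r δ (2 * k)]
  field_simp
  ring

theorem aestronglyMeasurable_diffProd {Ω : Set E3} {n : ℕ} {G : E3 → ℝ} {g : Fin n → E3 → ℝ}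
    (hG : ContinuousOn G (frontier Ω)) (hg : ∀ i, ContinuousOn (g i) (frontier Ω)) {y : E3}
    (hy : y ∈ frontier Ω) : AEStronglyMeasurable (diffProd G g y) (surfaceMeasure Ω) :=
  aestronglyMeasurable_surfaceMeasure ((continuousOn_diffProd hG hg).comp (g := fun z : E3 × E3 =>
    diffProd G g z.1 z.2) (f := fun x => (y, x)) (by fun_prop) fun x hx => ⟨hy, hx⟩)

theorem aestronglyMeasurable_diffProd_mul {Ω : Set E3} {k : ℕ} {G : E3 → ℝ}
    {g : Fin (2 * k) → E3 → ℝ}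
    (hG : ContinuousOn G (frontier Ω)) (hg : ∀ i, ContinuousOn (g i) (frontier Ω)) {y : E3}
    (hy : y ∈ frontier Ω) {s : ℝ → ℝ} {Q : ℝ → ℝ} (hs : IsGaussProfile s k Q) (δ : ℝ) :
    AEStronglyMeasurable (fun x => diffProd G g y x *
      ((s (‖y - x‖ / δ) - 1) / ‖y - x‖ ^ (2 * k + 1))) (surfaceMeasure Ω) := by
  have hsm := hs.continuous.measurable
  have : Measurable fun x : E3 => (s (‖y - x‖ / δ) - 1) / ‖y - x‖ ^ (2 * k + 1) := by fun_prop
  exact (aestronglyMeasurable_diffProd hG hg hy).mul this.aestronglyMeasurable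

namespace IsSmoothBoundedRegion

variable {Ω : Set E3} (hΩ : IsSmoothBoundedRegion Ω)

include hΩ

/-- Differentiability at y handles nearby points and boundedness the others. The constant may depend
on y, which suffices for integrability and dominated convergence at a fixed y. -/
theorem exists_norm_sub_le {F : Type*} [NormedAddCommGroup F] [NormedSpace ℝ F] {g : E3 → F}
    (hg : ContDiffOn ℝ ∞ g (frontier Ω)) {y : E3} (hy : y ∈ frontier Ω) :
    ∃ C, 0 ≤ C ∧ ∀ x ∈ frontier Ω, ‖g x - g y‖ ≤ C * ‖y - x‖ := by
  obtain ⟨C, hC0, hC⟩ := (((hg y hy).differentiableWithinAt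
    (by simp)).hasFDerivWithinAt.isBigO_sub).exists_nonneg
  rw [isBigOWith_iff, eventually_nhdsWithin_iff, Metric.eventually_nhds_iff] at hC
  obtain ⟨ρ, hρ, hC⟩ := hC
  obtain ⟨M, hM⟩ := hΩ.isCompact_frontier.exists_bound_of_continuousOn
    (hg.continuousOn.sub (continuousOn_const (c := g y)))
  have hM0 : 0 ≤ M := (norm_nonneg _).trans (hM y hy)
  refine ⟨max C (M / ρ), le_max_of_le_left hC0, fun x hx => ?_⟩
  rcases lt_or_ge (dist x y) ρ with h | h
  · refine (hC h hx).trans ?_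
    rw [norm_sub_rev x y]
    gcongr
    exact le_max_left _ _
  · rw [dist_comm, dist_eq_norm] at h
    calc ‖g x - g y‖ ≤ M := hM x hx
      _ = M / ρ * ρ := by field_simp
      _ ≤ _ := by gcongr; exact le_max_right _ _

theorem exists_abs_diffProd_le_pow {n : ℕ} {G : E3 → ℝ} {g : Fin n → E3 → ℝ}
    (hG : ContinuousOn G (frontier Ω)) (hg : ∀ i, ContDiffOn ℝ ∞ (g i) (frontier Ω)) {y : E3}
    (hy : y ∈ frontier Ω) :
    ∃ C, 0 ≤ C ∧ ∀ x ∈ frontier Ω, |diffProd G g y x| ≤ C * ‖y - x‖ ^ n := by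
  choose C hC0 hC using fun i => hΩ.exists_norm_sub_le (hg i) hy
  obtain ⟨M, hM⟩ := hΩ.isCompact_frontier.exists_bound_of_continuousOn hG
  have hM0 : 0 ≤ M := (norm_nonneg _).trans (hM y hy)
  refine ⟨M * ∏ i, C i, mul_nonneg hM0 (Finset.prod_nonneg fun i _ => hC0 i), fun x hx => ?_⟩
  rw [diffProd, abs_mul, Finset.abs_prod, mul_assoc]
  have h1 : ∏ i, |g i x - g i y| ≤ ∏ i, C i * ‖y - x‖ :=
    Finset.prod_le_prod (fun i _ => abs_nonneg _) fun i _ => hC i x hx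
  rw [Finset.prod_mul_distrib, Finset.prod_const, Finset.card_univ, Fintype.card_fin] at h1
  exact mul_le_mul (hM x hx) h1 (Finset.prod_nonneg fun i _ => abs_nonneg _) hM0

/-- The 2k differences cancel all but one power of the distance. The bound does not depend on δ, so
it also serves as the dominating function as δ → 0. -/
theorem exists_abs_diffProd_mul_le {k : ℕ} {G : E3 → ℝ} {g : Fin (2 * k) → E3 → ℝ}
    (hG : ContinuousOn G (frontier Ω)) (hg : ∀ i, ContDiffOn ℝ ∞ (g i) (frontier Ω)) {y : E3}
    (hy : y ∈ frontier Ω) {s : ℝ → ℝ} {Q : ℝ → ℝ} (hs : IsGaussProfile s k Q) :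
    ∃ C, ∀ δ : ℝ, 0 < δ → ∀ x ∈ frontier Ω, x ≠ y →
      |diffProd G g y x * ((s (‖y - x‖ / δ) - 1) / ‖y - x‖ ^ (2 * k + 1))| ≤ C * ‖y - x‖⁻¹ := by
  obtain ⟨C, hC0, hC⟩ := hΩ.exists_abs_diffProd_le_pow hG hg hy
  obtain ⟨A, hA0, hA⟩ := hs.exists_abs_le
  refine ⟨C * (A + 1), fun δ hδ x hx hxy => ?_⟩
  have hr : 0 < ‖y - x‖ := norm_pos_iff.2 (sub_ne_zero.2 hxy.symm)
  have h1 : |s (‖y - x‖ / δ) - 1| ≤ A + 1 :=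
    (abs_sub _ _).trans (by simpa using hA _ (by positivity))
  rw [abs_mul, abs_div, abs_of_pos (pow_pos hr _)]
  calc _ ≤ C * ‖y - x‖ ^ (2 * k) * ((A + 1) / ‖y - x‖ ^ (2 * k + 1)) := by
        gcongr
        exact hC x hx
    _ = _ := by rw [pow_succ]; field_simp

theorem integrable_diffProd_mul {k : ℕ} {G : E3 → ℝ} {g : Fin (2 * k) → E3 → ℝ}
    (hG : ContinuousOn G (frontier Ω)) (hg : ∀ i, ContDiffOn ℝ ∞ (g i) (frontier Ω)) {y : E3}
    (hy : y ∈ frontier Ω) {s : ℝ → ℝ} {Q : ℝ → ℝ} (hs : IsGaussProfile s k Q) {δ : ℝ}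
    (hδ : 0 < δ) : Integrable (fun x => diffProd G g y x *
      ((s (‖y - x‖ / δ) - 1) / ‖y - x‖ ^ (2 * k + 1))) (surfaceMeasure Ω) := by
  obtain ⟨C, hC⟩ := hΩ.exists_abs_diffProd_mul_le hG hg hy hs
  exact hΩ.integrable_of_norm_le (aestronglyMeasurable_diffProd_mul hG
    (fun i => (hg i).continuousOn) hy hs δ) hy (hC δ hδ)

theorem tendsto_integral_diffProd_mul {k : ℕ} {G : E3 → ℝ} {g : Fin (2 * k) → E3 → ℝ}
    (hG : ContinuousOn G (frontier Ω)) (hg : ∀ i, ContDiffOn ℝ ∞ (g i) (frontier Ω)) {y : E3}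
    (hy : y ∈ frontier Ω) {s : ℝ → ℝ} {Q : ℝ → ℝ} (hs : IsGaussProfile s k Q) :
    Tendsto (fun δ => ∫ x, diffProd G g y x *
      ((s (‖y - x‖ / δ) - 1) / ‖y - x‖ ^ (2 * k + 1)) ∂(surfaceMeasure Ω)) (𝓝[>] 0) (𝓝 0) := by
  obtain ⟨C, hC⟩ := hΩ.exists_abs_diffProd_mul_le hG hg hy hs
  have h := tendsto_integral_filter_of_dominated_convergence (μ := surfaceMeasure Ω)
    (l := 𝓝[>] (0 : ℝ)) (F := fun δ x => diffProd G g y x *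
      ((s (‖y - x‖ / δ) - 1) / ‖y - x‖ ^ (2 * k + 1))) (f := fun _ => 0) (fun x => C * ‖y - x‖⁻¹)
    (Eventually.of_forall fun δ => aestronglyMeasurable_diffProd_mul hG
      (fun i => (hg i).continuousOn) hy hs δ) ?_ ((hΩ.integrable_inv_dist hy).const_mul C) ?_
  · simpa using h
  · filter_upwards [self_mem_nhdsWithin] with δ hδ
    filter_upwards [ae_mem_frontier Ω, ae_ne_surfaceMeasure Ω y] with x hx hxy
      using hC δ hδ x hx hxy
  · filter_upwards [ae_ne_surfaceMeasure Ω y] with x hxy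
    have hr : 0 < ‖y - x‖ := norm_pos_iff.2 (sub_ne_zero.2 hxy.symm)
    have h1 : Tendsto (fun δ : ℝ => ‖y - x‖ / δ) (𝓝[>] 0) atTop :=
      tendsto_inv_nhdsGT_zero.const_mul_atTop hr
    have h2 := (((hs.tendsto.comp h1).sub_const 1).div_const
      (‖y - x‖ ^ (2 * k + 1))).const_mul (diffProd G g y x)
    simpa using h2

/-- The integrand is singular at y, but its δ-derivative is a kernel bounded for δ away from zero,
so differentiation under the integral is harmless. -/
theorem hasDerivAt_integral_diffProd_mul {k : ℕ} {G : E3 → ℝ} {g : Fin (2 * k) → E3 → ℝ}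
    (hG : ContinuousOn G (frontier Ω)) (hg : ∀ i, ContDiffOn ℝ ∞ (g i) (frontier Ω)) {y : E3}
    (hy : y ∈ frontier Ω) {s : ℝ → ℝ} {c : ℝ} (hs : IsGaussProfile s k (highFactor k c)) {δ : ℝ}
    (hδ : 0 < δ) :
    HasDerivAt (fun δ => ∫ x, diffProd G g y x *
      ((s (‖y - x‖ / δ) - 1) / ‖y - x‖ ^ (2 * k + 1)) ∂(surfaceMeasure Ω))
      (∫ x, diffProd G g y x * (-c * δ ^ 4 * gaussKer (k + 1) (‖y - x‖ ^ 2) (δ ^ 2))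
        ∂(surfaceMeasure Ω)) δ := by
  have hfin := hΩ.isFiniteMeasure
  obtain ⟨B, hB0, hB⟩ := exists_abs_gaussKer_le (k + 1)
  obtain ⟨M, hM0, hM⟩ := hΩ.exists_abs_diffProd_le hG (fun i => (hg i).continuousOn)
  have hgm := (aestronglyMeasurable_diffProd hG (fun i => (hg i).continuousOn) hy)
  have hker : ∀ τ : ℝ, Continuous fun x : E3 => gaussKer (k + 1) (‖y - x‖ ^ 2) τ := fun τ =>
    (continuous_gaussKer (k + 1) τ).comp (by fun_prop)
  refine (hasDerivAt_integral_of_dominated_loc_of_deriv_le (s := Ioo (δ / 2) (2 * δ))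
    (bound := fun _ => M * (|c| * (2 * δ) ^ 4 * (B / ((δ / 2) ^ 2) ^ (k + 1 + 2))))
    (F' := fun δ x => diffProd G g y x *
      (-c * δ ^ 4 * gaussKer (k + 1) (‖y - x‖ ^ 2) (δ ^ 2)))
    (Ioo_mem_nhds (by linarith) (by linarith))
    (Eventually.of_forall fun δ => aestronglyMeasurable_diffProd_mul hG
      (fun i => (hg i).continuousOn) hy hs δ) (hΩ.integrable_diffProd_mul hG hg hy hs hδ)
    (hgm.mul ((hker _).const_mul _).aestronglyMeasurable) ?_ (integrable_const _) ?_).2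
  · filter_upwards [ae_mem_frontier Ω] with x hx ε hε
    have hε0 : 0 < ε := by linarith [hε.1]
    rw [Real.norm_eq_abs, abs_mul, abs_mul, abs_mul, abs_neg, abs_of_nonneg (pow_nonneg hε0.le 4)]
    have h1 := hε.1.le
    have h2 := hε.2.le
    gcongr
    · exact hM y hy x hx
    · refine (hB _ _ (by positivity) (by positivity)).trans ?_
      gcongr
  · filter_upwards [ae_ne_surfaceMeasure Ω y] with x hxy ε hε
    have hr : 0 < ‖y - x‖ := norm_pos_iff.2 (sub_ne_zero.2 hxy.symm)
    exact (hs.hasDerivAt_div hr (by linarith [hε.1])).const_mul _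

/-- The error of a regularized surface integral with a high-order smoothing factor. -/
theorem exists_abs_integral_diffProd_mul_le {k : ℕ} {G : E3 → ℝ} {g : Fin (2 * k) → E3 → ℝ}
    (hG : ContDiffOn ℝ ∞ G (frontier Ω)) (hg : ∀ i, ContDiffOn ℝ ∞ (g i) (frontier Ω))
    {s : ℝ → ℝ} {c : ℝ} (hs : IsGaussProfile s k (highFactor k c)) :
    ∃ C, ∀ δ : ℝ, 0 < δ → ∀ y ∈ frontier Ω, |∫ x, diffProd G g y x *
      ((s (‖y - x‖ / δ) - 1) / ‖y - x‖ ^ (2 * k + 1)) ∂(surfaceMeasure Ω)| ≤ C * δ ^ 5 := by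
  obtain ⟨C, hC⟩ := hΩ.exists_abs_integral_diffProd_mul_gaussKer_le hG hg
  refine ⟨|c| * |C|, fun δ hδ y hy => ?_⟩
  set H : ℝ → ℝ := fun δ => ∫ x, diffProd G g y x *
      ((s (‖y - x‖ / δ) - 1) / ‖y - x‖ ^ (2 * k + 1)) ∂(surfaceMeasure Ω)
  have hH0 : Tendsto H (𝓝[>] 0) (𝓝 0) := hΩ.tendsto_integral_diffProd_mul hG.continuousOn hg hy hs
  have hlim : Tendsto (fun ε => |H δ - H ε|) (𝓝[>] 0) (𝓝 |H δ|) := by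
    simpa using (tendsto_const_nhds.sub hH0).abs
  refine le_of_tendsto hlim ?_
  filter_upwards [Ioo_mem_nhdsGT hδ] with ε hε
  -- The mean value inequality is used on [ε, δ] with ε > 0, where the derivative is O(δ⁴); letting
  -- ε → 0 removes the lower endpoint.
  have hmv := Convex.norm_image_sub_le_of_norm_hasDerivWithin_le (s := Icc ε δ) (f := H)
    (C := |c| * |C| * δ ^ 4) (x := ε) (y := δ)
    (fun t ht => (hΩ.hasDerivAt_integral_diffProd_mul hG.continuousOn hg hy hs
      (hε.1.trans_le ht.1)).hasDerivWithinAt) (fun t ht => ?_) (convex_Icc _ _)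
    ⟨le_rfl, hε.2.le⟩ ⟨hε.2.le, le_rfl⟩
  · refine hmv.trans ?_
    rw [Real.norm_of_nonneg (by linarith [hε.2])]
    have : |c| * |C| * δ ^ 4 * (δ - ε) ≤ |c| * |C| * δ ^ 4 * δ := by
      gcongr
      linarith [hε.1]
    linarith
  · have ht0 : 0 < t := hε.1.trans_le ht.1
    have : ∫ x, diffProd G g y x * (-c * t ^ 4 * gaussKer (k + 1) (‖y - x‖ ^ 2) (t ^ 2))
        ∂(surfaceMeasure Ω) = -c * t ^ 4 * ∫ x, diffProd G g y x *
          gaussKer (k + 1) (‖y - x‖ ^ 2) (t ^ 2) ∂(surfaceMeasure Ω) := by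
      rw [← integral_const_mul]
      refine integral_congr_ae (Eventually.of_forall fun x => ?_)
      ring
    rw [this, Real.norm_eq_abs, abs_mul, abs_mul, abs_neg, abs_of_nonneg (pow_nonneg ht0.le 4)]
    have h1 := (hC y hy (t ^ 2) (by positivity)).trans (le_abs_self C)
    calc _ ≤ |c| * δ ^ 4 * |C| := by
          gcongr
          exact ht.2
      _ = _ := by ring

end IsSmoothBoundedRegion

/-! ### The divergence theorem -/

theorem integral_fderiv_eq_zero {E : Type*} [NormedAddCommGroup E] [NormedSpace ℝ E]
    [FiniteDimensional ℝ E] [MeasurableSpace E] [BorelSpace E] (μ : Measure E)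
    [μ.IsAddHaarMeasure] {G : E → ℝ} (hG : ContDiff ℝ ∞ G) (hGs : HasCompactSupport G) (v : E) :
    ∫ x, fderiv ℝ G x v ∂μ = 0 := by
  have h1 : Continuous fun x => fderiv ℝ G x v :=
    (hG.continuous_fderiv (by simp)).clm_apply continuous_const
  have h2 : HasCompactSupport fun x => fderiv ℝ G x v := hGs.fderiv_apply ℝ v
  have := integral_mul_fderiv_eq_neg_fderiv_mul_of_integrable (μ := μ) (f := fun _ : E => (1 : ℝ))
    (g := G) (v := v) (by simp) (by simpa using h1.integrable_of_hasCompactSupport h2)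
    (by simpa using hG.continuous.integrable_of_hasCompactSupport hGs)
    (fun x _ => by fun_prop) (fun x _ => (hG.differentiable (by simp)) x)
  simpa using this

/-- By Fubini, the planar derivative integrates to zero over each horizontal slice and the vertical
one to the boundary value along each vertical line. The coefficient `c` depends on the planar
variable only and passes through the vertical integral. -/
theorem setIntegral_lowerHalf_fderiv {G : E2 × ℝ → ℝ} (hG : ContDiff ℝ ∞ G)
    (hGs : HasCompactSupport G) (b : E2) {c : E2 → ℝ} (hc : Continuous c) :
    ∫ z in {z : E2 × ℝ | z.2 < 0}, (fderiv ℝ G z (b, 0) + c z.1 * fderiv ℝ G z (0, 1))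
      = ∫ a, c a * G (a, 0) := by
  have hGd := hasFDerivAt_of_contDiff hG
  have hcont : ∀ v : E2 × ℝ, Continuous fun z => fderiv ℝ G z v := fun v =>
    (hG.continuous_fderiv (by simp)).clm_apply continuous_const
  have hsupp : ∀ v : E2 × ℝ, HasCompactSupport fun z => fderiv ℝ G z v := fun v =>
    hGs.fderiv_apply ℝ v
  have i1 : Integrable fun z => fderiv ℝ G z (b, (0 : ℝ)) :=
    (hcont _).integrable_of_hasCompactSupport (hsupp _)
  have i2 : Integrable fun z : E2 × ℝ => c z.1 * fderiv ℝ G z (0, 1) :=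
    ((hc.comp continuous_fst).mul (hcont _)).integrable_of_hasCompactSupport (hsupp _).mul_left
  have hset : {z : E2 × ℝ | z.2 < 0} = univ ×ˢ Iio 0 := by ext; simp
  have cs1 : ∀ t : ℝ, HasCompactSupport fun a => G (a, t) := fun t =>
    HasCompactSupport.intro (hGs.isCompact.image continuous_fst) fun a ha => by
      by_contra hne
      exact ha ⟨(a, t), subset_tsupport G hne, rfl⟩
  have cs2 : ∀ a : E2, HasCompactSupport fun t => G (a, t) := fun a =>
    HasCompactSupport.intro (hGs.isCompact.image continuous_snd) fun t ht => by
      by_contra hne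
      exact ht ⟨(a, t), subset_tsupport G hne, rfl⟩
  rw [integral_add i1.integrableOn i2.integrableOn]
  have e1 : ∫ z in {z : E2 × ℝ | z.2 < 0}, fderiv ℝ G z (b, 0) = 0 := by
    rw [hset, Measure.volume_eq_prod, ← Measure.prod_restrict, integral_prod_symm]
    · refine integral_eq_zero_of_ae (Eventually.of_forall fun t => ?_)
      have := integral_fderiv_eq_zero (volume : Measure E2) (G := fun a => G (a, t))
        (hG.comp (contDiff_id.prodMk contDiff_const)) (cs1 t) b
      rw [Measure.restrict_univ]
      refine Eq.trans (integral_congr_ae (Eventually.of_forall fun a => ?_)) this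
      have hd : HasFDerivAt (fun a => G (a, t)) _ a :=
        (hGd (a, t)).comp a (hasFDerivAt_prodMk_left a t)
      simp only [hd.fderiv]
      simp
    · rw [Measure.prod_restrict, ← Measure.volume_eq_prod]
      exact i1.integrableOn
  have e2 : ∫ z in {z : E2 × ℝ | z.2 < 0}, c z.1 * fderiv ℝ G z (0, 1) = ∫ a, c a * G (a, 0) := by
    rw [hset, Measure.volume_eq_prod, setIntegral_prod]
    · rw [Measure.restrict_univ]
      refine integral_congr_ae (Eventually.of_forall fun a => ?_)
      simp only
      rw [integral_const_mul, ← integral_Iic_eq_integral_Iio]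
      have hcd : ContDiff ℝ ∞ fun t => G (a, t) := hG.comp (contDiff_const.prodMk contDiff_id)
      rw [← HasCompactSupport.integral_Iic_deriv_eq (f := fun t => G (a, t))
        (hcd.of_le (by simp)) (cs2 a) 0]
      congr 2
      funext t
      have hd : HasDerivAt (fun t => G (a, t)) _ t :=
        (hGd (a, t)).comp_hasDerivAt t ((hasDerivAt_const t a).prodMk (hasDerivAt_id t))
      rw [hd.deriv]
    · rw [← Measure.volume_eq_prod]
      exact i2.integrableOn
  rw [e1, e2, zero_add]

/-- Coordinates in which the graph of `h` is flat. -/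
noncomputable def flatPoint (Φ : Frame) (p : E3) (h : E2 → ℝ) (z : E2 × ℝ) : E3 :=
  framePoint Φ p (z.1, h z.1 + z.2)

section Flat

variable (Φ : Frame) (p : E3) {h : E2 → ℝ} (hh : ContDiff ℝ ∞ h)

include hh

theorem contDiff_flatPoint : ContDiff ℝ ∞ (flatPoint Φ p h) :=
  (contDiff_framePoint Φ p).comp (contDiff_fst.prodMk ((hh.comp contDiff_fst).add contDiff_snd))

theorem measurableEmbedding_flatPoint : MeasurableEmbedding (flatPoint Φ p h) := by
  refine (contDiff_flatPoint Φ p hh).continuous.measurableEmbedding fun z w hzw => ?_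
  have h1 := congrArg (planeCoord Φ p) hzw
  have h2 := congrArg (heightCoord Φ p) hzw
  simp only [flatPoint, planeCoord_framePoint, heightCoord_framePoint] at h1 h2
  rw [h1] at h2
  exact Prod.ext h1 (add_left_cancel h2)

/-- The map is a vertical shear followed by an isometry. -/
theorem measurePreserving_flatPoint : MeasurePreserving (flatPoint Φ p h) := by
  have h1 : MeasurePreserving (fun z : E2 × ℝ => (z.1, h z.1 + z.2)) :=
    (MeasurePreserving.id (volume : Measure E2)).skew_product (g := fun a t => h a + t)
      (μc := (volume : Measure ℝ)) (μd := (volume : Measure ℝ))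
      ((hh.continuous.measurable.comp measurable_fst).add measurable_snd)
      (Eventually.of_forall fun a => map_add_left_eq_self volume (h a))
  have h2 : MeasurePreserving fun z : E2 × ℝ => Φ (WithLp.toLp 2 z) :=
    Φ.measurePreserving.comp (WithLp.volume_preserving_toLp (U := E2) (V := ℝ))
  exact ((measurePreserving_add_left volume p).comp h2).comp h1

theorem fderiv_flatPoint (z : E2 × ℝ) (b : E2) (t : ℝ) :
    fderiv ℝ (flatPoint Φ p h) z (b, t) = Φ (WithLp.toLp 2 (b, fderiv ℝ h z.1 b + t)) := by
  have h0 : HasFDerivAt (fun z : E2 × ℝ => h z.1) _ z :=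
    (hasFDerivAt_of_contDiff hh z.1).comp z hasFDerivAt_fst
  have h1 : HasFDerivAt (fun z : E2 × ℝ => (z.1, h z.1 + z.2)) _ z :=
    hasFDerivAt_fst.prodMk (h0.fun_add hasFDerivAt_snd)
  have h2 : HasFDerivAt (flatPoint Φ p h) _ z := (hasFDerivAt_framePoint Φ p _).comp z h1
  rw [h2.fderiv]
  rfl

theorem hasCompactSupport_comp_flatPoint {F : E3 → ℝ} (hF : HasCompactSupport F) :
    HasCompactSupport fun z => F (flatPoint Φ p h z) := by
  have hc : Continuous fun x => (planeCoord Φ p x, heightCoord Φ p x - h (planeCoord Φ p x)) :=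
    (contDiff_planeCoord Φ p).continuous.prodMk ((contDiff_heightCoord Φ p).continuous.sub
      (hh.continuous.comp (contDiff_planeCoord Φ p).continuous))
  refine HasCompactSupport.intro (hF.isCompact.image hc) fun z hz => ?_
  by_contra hne
  refine hz ⟨flatPoint Φ p h z, subset_tsupport F hne, ?_⟩
  simp [flatPoint, planeCoord_framePoint, heightCoord_framePoint]

end Flat

/-- The identity `∫_Ω ∂ₑF = ∫_{∂Ω} F ⟨e, n⟩`. -/
def HasGaussGreen (Ω : Set E3) (e : E3) (F : E3 → ℝ) : Prop :=
  ∫ x in Ω, fderiv ℝ F x e = ∫ x, F x * ⟪e, outwardNormal Ω x⟫_ℝ ∂(surfaceMeasure Ω)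

/-- In flattened coordinates the derivative along e = (b, σ) is the planar derivative along b plus σ
- dh(b) times the vertical one, and σ - dh(b) is also the area density times ⟪e, n⟫. -/
theorem IsGraphChart.hasGaussGreen {Ω : Set E3} {p : E3} {Φ : Frame} {h : E2 → ℝ} {V : Set E3}
    (hc : IsGraphChart Ω p Φ h V) (hΩ : IsOpen Ω) {F : E3 → ℝ} (hF : ContDiff ℝ ∞ F)
    (hFs : HasCompactSupport F) (hFV : tsupport F ⊆ V) (e : E3) : HasGaussGreen Ω e F := by
  have hh := hc.contDiff
  set b : E2 := (Φ.symm e).fst with hb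
  set σ : ℝ := (Φ.symm e).snd with hσ
  have he : e = Φ (WithLp.toLp 2 (b, σ)) := (Φ.apply_symm_apply e).symm
  have hFV0 : ∀ x ∉ V, F x = 0 := fun x hx => image_eq_zero_of_notMem_tsupport fun h => hx (hFV h)
  have hF'V0 : ∀ x ∉ V, fderiv ℝ F x = 0 := fun x hx =>
    image_eq_zero_of_notMem_tsupport fun h => hx (hFV (tsupport_fderiv_subset ℝ h))
  have hFd := hasFDerivAt_of_contDiff hF
  have hPd := hasFDerivAt_of_contDiff (contDiff_flatPoint Φ p hh)
  have hG : ContDiff ℝ ∞ fun z => F (flatPoint Φ p h z) := hF.comp (contDiff_flatPoint Φ p hh)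
  have hGd : ∀ z v, fderiv ℝ (fun z => F (flatPoint Φ p h z)) z v
      = fderiv ℝ F (flatPoint Φ p h z) (fderiv ℝ (flatPoint Φ p h) z v) := fun z v => by
    have : HasFDerivAt (fun z => F (flatPoint Φ p h z)) _ z := (hFd _).comp z (hPd z)
    rw [this.fderiv]
    rfl
  have hmem : ∀ z, flatPoint Φ p h z ∈ V → (flatPoint Φ p h z ∈ Ω ↔ z.2 < 0) := fun z hz => by
    rw [hc.mem_iff _ hz, flatPoint, planeCoord_framePoint, heightCoord_framePoint]
    exact add_lt_iff_neg_left
  have hcc : Continuous fun a => σ - fderiv ℝ h a b :=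
    continuous_const.sub ((hh.continuous_fderiv (by simp)).clm_apply continuous_const)
  have key := setIntegral_lowerHalf_fderiv hG (hasCompactSupport_comp_flatPoint Φ p hh hFs) b hcc
  have hpt : ∀ z, fderiv ℝ (fun z => F (flatPoint Φ p h z)) z (b, 0)
      + (σ - fderiv ℝ h z.1 b) * fderiv ℝ (fun z => F (flatPoint Φ p h z)) z (0, 1)
      = fderiv ℝ F (flatPoint Φ p h z) e := fun z => by
    rw [← smul_eq_mul, ← map_smul, ← map_add, hGd]
    congr 1
    rw [he]
    have : ((b, 0) + (σ - fderiv ℝ h z.1 b) • ((0 : E2), (1 : ℝ)))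
      = (b, σ - fderiv ℝ h z.1 b) := by simp
    rw [this, fderiv_flatPoint Φ p hh]
    simp
  simp only [hpt] at key
  rw [HasGaussGreen, ← (measurePreserving_flatPoint Φ p hh).setIntegral_preimage_emb
    (measurableEmbedding_flatPoint Φ p hh)]
  have eset : ∫ z in flatPoint Φ p h ⁻¹' Ω, fderiv ℝ F (flatPoint Φ p h z) e
      = ∫ z in {z : E2 × ℝ | z.2 < 0}, fderiv ℝ F (flatPoint Φ p h z) e := by
    rw [← integral_indicator ((contDiff_flatPoint Φ p hh).continuous.measurable hΩ.measurableSet),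
      ← integral_indicator (measurableSet_lt measurable_snd measurable_const)]
    refine integral_congr_ae (Eventually.of_forall fun z => ?_)
    by_cases hz : flatPoint Φ p h z ∈ V
    · by_cases hz2 : z.2 < 0
      · rw [indicator_of_mem (s := flatPoint Φ p h ⁻¹' Ω) ((hmem z hz).2 hz2),
          indicator_of_mem (s := {z : E2 × ℝ | z.2 < 0}) hz2]
      · rw [indicator_of_notMem (s := flatPoint Φ p h ⁻¹' Ω) (fun h => hz2 ((hmem z hz).1 h)),
          indicator_of_notMem (s := {z : E2 × ℝ | z.2 < 0}) hz2]
    · simp [indicator_apply, hF'V0 _ hz]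
  rw [eset, key, hc.setIntegral_surfaceMeasure hΩ (fun x hx => by rw [hFV0 x hx, zero_mul])]
  refine integral_congr_ae (Eventually.of_forall fun a => ?_)
  have ha : flatPoint Φ p h (a, 0) = graphMap Φ p h a := by simp [flatPoint, graphMap]
  simp only [ha]
  by_cases hz : graphMap Φ p h a ∈ V
  · have hJ := areaDensity_pos h a
    rw [hc.outwardNormal_eq hΩ hz (hc.graphMap_mem_frontier hΩ hz)]
    rw [show planeCoord Φ p (graphMap Φ p h a) = a from planeCoord_framePoint Φ p _]
    have : ⟪e, graphNormal Φ h a⟫_ℝ = σ - fderiv ℝ h a b := by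
      rw [he, graphNormal, Φ.inner_map_map, WithLp.prod_inner_apply]
      simp only [inner_neg_right, real_inner_comm, gradient_inner]
      simp
      ring
    rw [inner_smul_right, this, smul_eq_mul]
    field_simp
  · simp [hFV0 _ hz]

theorem hasGaussGreen_of_tsupport_subset {Ω : Set E3} (hΩ : IsOpen Ω) {F : E3 → ℝ}
    (hF : ContDiff ℝ ∞ F) (hFs : HasCompactSupport F) (hFV : tsupport F ⊆ Ω) (e : E3) :
    HasGaussGreen Ω e F := by
  rw [HasGaussGreen, setIntegral_eq_integral_of_forall_compl_eq_zero, integral_fderiv_eq_zero _ hF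
    hFs]
  · refine (integral_eq_zero_of_ae ?_).symm
    filter_upwards [ae_mem_frontier Ω] with x hx
    rw [hΩ.frontier_eq] at hx
    rw [image_eq_zero_of_notMem_tsupport fun h => hx.2 (hFV h), zero_mul, Pi.zero_apply]
  · intro x hx
    rw [image_eq_zero_of_notMem_tsupport fun h => hx (hFV (tsupport_fderiv_subset ℝ h))]
    simp

/-- The divergence theorem on a smooth bounded region. -/
theorem IsSmoothBoundedRegion.hasGaussGreen {Ω : Set E3} (hΩ : IsSmoothBoundedRegion Ω)
    {F : E3 → ℝ} (hF : ContDiff ℝ ∞ F) (e : E3) : HasGaussGreen Ω e F := by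
  have hfin := hΩ.isFiniteMeasure
  have hloc : ∀ x ∈ closure Ω, ∃ U, IsOpen U ∧ x ∈ U ∧ Bornology.IsBounded U ∧
      ∀ F : E3 → ℝ, ContDiff ℝ ∞ F → HasCompactSupport F → tsupport F ⊆ U →
        HasGaussGreen Ω e F := by
    intro x hx
    by_cases hxΩ : x ∈ Ω
    · exact ⟨Ω, hΩ.isOpen, hxΩ, hΩ.isBounded, fun F h1 h2 h3 =>
        hasGaussGreen_of_tsupport_subset hΩ.isOpen h1 h2 h3 e⟩
    · have hxf : x ∈ frontier Ω := by
        rw [hΩ.isOpen.frontier_eq]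
        exact ⟨hx, hxΩ⟩
      obtain ⟨Φ, h, V, hc⟩ := hΩ.exists_isGraphChart hxf
      exact ⟨V ∩ Metric.ball x 1, hc.isOpen.inter Metric.isOpen_ball,
        ⟨hc.mem, Metric.mem_ball_self one_pos⟩, Metric.isBounded_ball.subset inter_subset_right,
        fun F h1 h2 h3 => hc.hasGaussGreen hΩ.isOpen h1 h2 (h3.trans inter_subset_left) e⟩
  choose! U hUo hxU hUb hUG using hloc
  have hcpt : IsCompact (closure Ω) := hΩ.isBounded.isCompact_closure
  obtain ⟨t, ht, hcov⟩ := hcpt.elim_nhds_subcover U fun x hx => (hUo x hx).mem_nhds (hxU x hx)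
  obtain ⟨ρ, hρ⟩ := SmoothPartitionOfUnity.exists_isSubordinate (modelWithCornersSelf ℝ E3)
    isClosed_closure (fun i : t => U i) (fun i => hUo i (ht i i.2))
    (hcov.trans (iUnion₂_subset fun i hi => subset_iUnion (fun i : t => U i) ⟨i, hi⟩))
  have hρd : ∀ i, ContDiff ℝ ∞ (ρ i) := fun i => (ρ i).contMDiff.contDiff
  have hsum : ∀ x ∈ closure Ω, ∑ i, ρ i x = 1 := fun x hx => by
    rw [← finsum_eq_sum_of_fintype]
    exact ρ.sum_eq_one hx
  have hcd : ∀ i, ContDiff ℝ ∞ fun x => ρ i x * F x := fun i => (hρd i).mul hF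
  have hcs : ∀ i, HasCompactSupport (ρ i) := fun i =>
    Metric.isCompact_of_isClosed_isBounded isClosed_closure
      ((hUb i (ht i i.2)).subset (hρ i))
  have hGG : ∀ i, HasGaussGreen Ω e fun x => ρ i x * F x := fun i =>
    hUG i (ht i i.2) _ (hcd i) (hcs i).mul_right ((tsupport_mul_subset_left).trans (hρ i))
  have hνc := hΩ.contDiffOn_outwardNormal.continuousOn
  have hν : ContinuousOn (fun x => ⟪e, outwardNormal Ω x⟫_ℝ) (frontier Ω) :=
    continuousOn_const.inner hνc
  calc ∫ x in Ω, fderiv ℝ F x e = ∫ x in Ω, ∑ i, fderiv ℝ (fun x => ρ i x * F x) x e := by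
        refine setIntegral_congr_fun hΩ.isOpen.measurableSet fun x hx => ?_
        -- The partition sums to one on Ω, a neighbourhood of x, so the derivatives agree there.
        have h1 : (fun x => ∑ i, ρ i x * F x) =ᶠ[𝓝 x] F := by
          filter_upwards [hΩ.isOpen.mem_nhds hx] with z hz
          rw [← Finset.sum_mul, hsum z (subset_closure hz), one_mul]
        rw [← h1.fderiv_eq, fderiv_fun_sum fun i _ => ((hcd i).differentiable (by simp)) x]
        simp
    _ = ∑ i, ∫ x in Ω, fderiv ℝ (fun x => ρ i x * F x) x e := by
        refine integral_finsetSum _ fun i _ => Integrable.integrableOn ?_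
        exact (((hcd i).continuous_fderiv (by simp)).clm_apply
          continuous_const).integrable_of_hasCompactSupport ((hcs i).mul_right.fderiv_apply ℝ e)
    _ = ∑ i, ∫ x, ρ i x * F x * ⟪e, outwardNormal Ω x⟫_ℝ ∂(surfaceMeasure Ω) :=
        Finset.sum_congr rfl fun i _ => hGG i
    _ = ∫ x, ∑ i, ρ i x * F x * ⟪e, outwardNormal Ω x⟫_ℝ ∂(surfaceMeasure Ω) := by
        refine (integral_finsetSum _ fun i _ => ?_).symm
        have hcont : ContinuousOn (fun x => ρ i x * F x * ⟪e, outwardNormal Ω x⟫_ℝ) (frontier Ω) :=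
          (hcd i).continuous.continuousOn.mul hν
        obtain ⟨M, hM⟩ := hΩ.isCompact_frontier.exists_bound_of_continuousOn hcont
        exact hΩ.integrable_of_abs_le (aestronglyMeasurable_surfaceMeasure hcont) hM
    _ = ∫ x, F x * ⟪e, outwardNormal Ω x⟫_ℝ ∂(surfaceMeasure Ω) := by
        refine integral_congr_ae ?_
        filter_upwards [ae_mem_frontier Ω] with x hx
        simp only [mul_assoc]
        rw [← Finset.sum_mul, hsum x (frontier_subset_closure hx), one_mul]

/-! ### Gaussian moments -/

theorem integral_gaussian_norm : ∫ z : E3, Real.exp (-‖z‖ ^ 2) = √Real.pi ^ 3 := by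
  have := GaussianFourier.integral_rexp_neg_mul_sq_norm (V := E3) (b := 1) one_pos
  simp only [neg_mul, one_mul, div_one] at this
  rw [this, Real.rpow_div_two_eq_sqrt _ Real.pi_pos.le, finrank_euclideanSpace_fin]
  norm_cast

theorem integrable_exp_neg_mul_norm_sq {b : ℝ} (hb : 0 < b) :
    Integrable fun z : E3 => Real.exp (-b * ‖z‖ ^ 2) := by
  by_contra h
  have := integral_undef h
  rw [GaussianFourier.integral_rexp_neg_mul_sq_norm hb] at this
  have : 0 < (Real.pi / b) ^ ((Module.finrank ℝ E3 : ℝ) / 2) := by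
    have := Real.pi_pos
    positivity
  linarith

theorem integrable_mul_exp_neg_norm_sq {f : E3 → ℝ} (hf : Continuous f) {A : ℝ}
    (h : ∀ z, |f z| ≤ A * (1 + ‖z‖ ^ 2)) : Integrable fun z => f z * Real.exp (-‖z‖ ^ 2) := by
  have hA : 0 ≤ A := by simpa using (abs_nonneg _).trans (h 0)
  refine ((integrable_exp_neg_mul_norm_sq (b := 1 / 2) (by norm_num)).const_mul (A * 3)).mono'
    (by fun_prop) (Eventually.of_forall fun z => ?_)
  rw [Real.norm_eq_abs, abs_mul, abs_of_pos (Real.exp_pos _)]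
  have h1 := pow_mul_exp_neg_le 1 (X := ‖z‖ ^ 2 / 2) (by positivity)
  have h2 : Real.exp (-(‖z‖ ^ 2 / 2)) ≤ 1 := Real.exp_le_one_iff.2 (by nlinarith [sq_nonneg ‖z‖])
  have e1 : Real.exp (-‖z‖ ^ 2) = Real.exp (-(‖z‖ ^ 2 / 2)) * Real.exp (-(1 / 2) * ‖z‖ ^ 2) := by
    rw [← Real.exp_add]; congr 1; ring
  rw [e1]
  simp only [pow_one, Nat.factorial_one, Nat.cast_one] at h1
  calc _ ≤ A * (1 + ‖z‖ ^ 2) * (Real.exp (-(‖z‖ ^ 2 / 2)) * Real.exp (-(1 / 2) * ‖z‖ ^ 2)) := by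
        gcongr; exact h z
    _ = A * ((1 + ‖z‖ ^ 2) * Real.exp (-(‖z‖ ^ 2 / 2))) * Real.exp (-(1 / 2) * ‖z‖ ^ 2) := by ring
    _ ≤ _ := by gcongr; linarith

theorem abs_coord_le (z : E3) (i : Fin 3) : |z i| ≤ ‖z‖ := PiLp.norm_apply_le z i

theorem abs_coord_mul_coord_le (z : E3) (i j : Fin 3) : |z i * z j| ≤ ‖z‖ ^ 2 := by
  rw [abs_mul, sq]
  exact mul_le_mul (abs_coord_le z i) (abs_coord_le z j) (abs_nonneg _) (norm_nonneg _)

theorem integrable_coord_mul_coord_mul_exp (i j : Fin 3) :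
    Integrable fun z : E3 => z i * z j * Real.exp (-‖z‖ ^ 2) :=
  integrable_mul_exp_neg_norm_sq (by fun_prop) (A := 1) fun z => by
    linarith [abs_coord_mul_coord_le z i j]

/-- Integrate z_i by parts against ∂_j exp(-‖z‖²) = -2 z_j exp(-‖z‖²). -/
theorem integral_coord_mul_coord_mul_exp (i j : Fin 3) :
    ∫ z : E3, z i * z j * Real.exp (-‖z‖ ^ 2) = if i = j then √Real.pi ^ 3 / 2 else 0 := by
  have hd1 : ∀ z : E3, HasFDerivAt (fun z : E3 => z i) (EuclideanSpace.proj i : E3 →L[ℝ] ℝ) z :=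
    fun z => (EuclideanSpace.proj i : E3 →L[ℝ] ℝ).hasFDerivAt
  have hd2 : ∀ z : E3, HasFDerivAt (fun z : E3 => Real.exp (-‖z‖ ^ 2))
      (Real.exp (-‖z‖ ^ 2) • -((2 : ℕ) • (innerSL ℝ z : E3 →L[ℝ] ℝ))) z := fun z =>
    (hasStrictFDerivAt_norm_sq z).hasFDerivAt.fun_neg.exp
  have e1 : ∀ z : E3, fderiv ℝ (fun z : E3 => z i) z (EuclideanSpace.single j 1)
      = if i = j then 1 else 0 := fun z => by
    rw [(hd1 z).fderiv]
    simp
  have e2 : ∀ z : E3, fderiv ℝ (fun z : E3 => Real.exp (-‖z‖ ^ 2)) z (EuclideanSpace.single j 1)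
      = -2 * (z j * Real.exp (-‖z‖ ^ 2)) := fun z => by
    rw [(hd2 z).fderiv]
    simp [EuclideanSpace.inner_single_right]
    ring
  have i0 : Integrable fun z : E3 => z i * Real.exp (-‖z‖ ^ 2) :=
    integrable_mul_exp_neg_norm_sq (by fun_prop) (A := 1) fun z => by
      nlinarith [abs_coord_le z i, sq_nonneg (‖z‖ - 1)]
  have i1 : Integrable fun z : E3 => Real.exp (-‖z‖ ^ 2) := by
    simpa using integrable_exp_neg_mul_norm_sq one_pos
  have key := integral_mul_fderiv_eq_neg_fderiv_mul_of_integrable (μ := (volume : Measure E3))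
    (f := fun z : E3 => z i) (g := fun z : E3 => Real.exp (-‖z‖ ^ 2))
    (v := EuclideanSpace.single j 1) (by simp only [e1]; exact i1.const_mul _)
    (by
      simp only [e2]
      refine ((integrable_coord_mul_coord_mul_exp i j).const_mul (-2)).congr
        (Eventually.of_forall fun z => ?_)
      simp only
      ring) i0
    (fun z _ => (hd1 z).differentiableAt) (fun z _ => (hd2 z).differentiableAt)
  simp only [e1, e2] at key
  rw [integral_const_mul, integral_gaussian_norm] at key
  have e3 : ∫ z : E3, z i * (-2 * (z j * Real.exp (-‖z‖ ^ 2)))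
      = -2 * ∫ z : E3, z i * z j * Real.exp (-‖z‖ ^ 2) := by
    rw [← integral_const_mul]
    refine integral_congr_ae (Eventually.of_forall fun z => ?_)
    simp only
    ring
  rw [e3] at key
  split_ifs at key ⊢ <;> linarith

theorem volume_inner_eq_zero {ν : E3} (hν : ν ≠ 0) : volume {z : E3 | ⟪z, ν⟫_ℝ = 0} = 0 := by
  have h1 : {z : E3 | ⟪z, ν⟫_ℝ = 0} = ((LinearMap.ker (innerSL ℝ ν).toLinearMap :
      Submodule ℝ E3) : Set E3) := by
    ext z
    simp [real_inner_comm]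
  rw [h1]
  refine Measure.addHaar_submodule _ _ fun h => ?_
  have : ν ∈ LinearMap.ker (innerSL ℝ ν).toLinearMap := by rw [h]; trivial
  simp at this
  exact hν this

theorem ae_inner_ne_zero {ν : E3} (hν : ν ≠ 0) : ∀ᵐ z : E3, ⟪z, ν⟫_ℝ ≠ 0 := by
  rw [ae_iff]
  simpa using volume_inner_eq_zero hν

/-- The reflection z ↦ -z exchanges the two open half-spaces, and the hyperplane between them is
null. -/
theorem setIntegral_inner_neg {ν : E3} (hν : ν ≠ 0) {g : E3 → ℝ} (hg : Integrable g)
    (heven : ∀ z, g (-z) = g z) :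
    ∫ z in {z : E3 | ⟪z, ν⟫_ℝ < 0}, g z = (∫ z, g z) / 2 := by
  have hm : MeasurableSet {z : E3 | ⟪z, ν⟫_ℝ < 0} :=
    measurableSet_lt (by fun_prop) measurable_const
  have h1 := integral_add_compl hm hg
  have h2 : ∫ z in {z : E3 | ⟪z, ν⟫_ℝ < 0}ᶜ, g z = ∫ z in {z : E3 | ⟪z, ν⟫_ℝ < 0}, g z := by
    rw [← integral_indicator hm, ← integral_indicator hm.compl, ← integral_neg_eq_self]
    refine integral_congr_ae ?_
    filter_upwards [ae_inner_ne_zero hν] with z hz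
    simp only [indicator_apply, mem_compl_iff, mem_ofPred_eq, inner_neg_left, heven]
    rcases lt_or_gt_of_ne hz with h | h
    · rw [if_pos h, if_pos (by linarith)]
    · rw [if_neg (by simpa using h), if_neg (not_lt.2 h.le)]
  linarith

/-! ### The rescaled volume integrals -/

/-- The two ray conditions on the outward normal say that the indicator of (Ω - y)/δ converges
pointwise to that of the half-space, off the hyperplane; dominated convergence does the rest. -/
theorem tendsto_setIntegral_rescale {Ω : Set E3} (hΩ : IsOpen Ω) {y ν : E3}
    (hν : IsOutwardUnitNormal Ω y ν) {g : E3 → ℝ} (hg : Integrable g) :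
    Tendsto (fun δ : ℝ => ∫ z in {z : E3 | y + δ • z ∈ Ω}, g z) (𝓝[>] 0)
      (𝓝 (∫ z in {z : E3 | ⟪z, ν⟫_ℝ < 0}, g z)) := by
  have hm : MeasurableSet {z : E3 | ⟪z, ν⟫_ℝ < 0} :=
    measurableSet_lt (by fun_prop) measurable_const
  have hmδ : ∀ δ : ℝ, MeasurableSet {z : E3 | y + δ • z ∈ Ω} := fun δ =>
    (hΩ.preimage (by fun_prop : Continuous fun z : E3 => y + δ • z)).measurableSet
  have hν0 : ν ≠ 0 := fun h => by simpa [h] using hν.1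
  simp_rw [← integral_indicator (hmδ _), ← integral_indicator hm]
  refine tendsto_integral_filter_of_dominated_convergence (fun z => ‖g z‖)
    (Eventually.of_forall fun δ => (hg.indicator (hmδ δ)).aestronglyMeasurable)
    (Eventually.of_forall fun δ => Eventually.of_forall fun z => norm_indicator_le_norm_self _ _)
    hg.norm ?_
  filter_upwards [ae_inner_ne_zero hν0] with z hz
  refine tendsto_const_nhds.congr' ?_
  rcases lt_or_gt_of_ne hz with h | h
  · filter_upwards [hν.2.1 z h] with δ hδ
    rw [indicator_of_mem (s := {z : E3 | ⟪z, ν⟫_ℝ < 0}) h,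
      indicator_of_mem (s := {z : E3 | y + δ • z ∈ Ω}) hδ]
  · filter_upwards [hν.2.2 z h] with δ hδ
    rw [indicator_of_notMem (s := {z : E3 | ⟪z, ν⟫_ℝ < 0}) (not_lt.2 h.le),
      indicator_of_notMem (s := {z : E3 | y + δ • z ∈ Ω}) fun h => hδ (subset_closure h)]

theorem setIntegral_rescale {Ω : Set E3} (hΩ : IsOpen Ω) (y : E3) (g : E3 → ℝ) {δ : ℝ}
    (hδ : 0 < δ) : ∫ z in {z : E3 | y + δ • z ∈ Ω}, g z
      = (δ ^ 3)⁻¹ * ∫ x in Ω, g (δ⁻¹ • (x - y)) := by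
  have hmδ : MeasurableSet {z : E3 | y + δ • z ∈ Ω} :=
    (hΩ.preimage (by fun_prop : Continuous fun z : E3 => y + δ • z)).measurableSet
  rw [← integral_indicator hmδ, ← integral_indicator hΩ.measurableSet,
    ← integral_add_left_eq_self (fun x => Ω.indicator (fun x => g (δ⁻¹ • (x - y))) x) y]
  have h := Measure.integral_comp_smul_of_nonneg (volume : Measure E3)
    (fun x => Ω.indicator (fun x => g (δ⁻¹ • (x - y))) (y + x)) δ (hR := hδ.le)
  rw [finrank_euclideanSpace_fin, smul_eq_mul] at h
  rw [← h]
  refine integral_congr_ae (Eventually.of_forall fun z => ?_)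
  beta_reduce
  by_cases hz : y + δ • z ∈ Ω
  · rw [indicator_of_mem hz, indicator_of_mem (s := {z : E3 | y + δ • z ∈ Ω}) hz,
      add_sub_cancel_left, smul_smul, inv_mul_cancel₀ hδ.ne', one_smul]
  · rw [indicator_of_notMem hz, indicator_of_notMem (s := {z : E3 | y + δ • z ∈ Ω}) hz]

/-! ### The normal component of a chord -/

/-- Up to sign this is the Taylor remainder at 0 of the expansion of `h` about a, and the derivative
of `h` is Lipschitz near 0. -/
theorem exists_abs_sub_fderiv_le {h : E2 → ℝ} (hh : ContDiff ℝ ∞ h) (h0 : h 0 = 0) :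
    ∃ C, ∃ ρ > 0, 0 ≤ C ∧ ∀ a, ‖a‖ < ρ → |h a - fderiv ℝ h a a| ≤ C * ‖a‖ ^ 2 := by
  have hh2 : ContDiff ℝ 2 h := contDiff_infty.1 hh 2
  obtain ⟨K, t, ht, hK⟩ := ((hh2.fderiv_right (m := 1) (by norm_num)).contDiffAt
    (x := (0 : E2))).exists_lipschitzOnWith
  obtain ⟨ρ, hρ, hρt⟩ := Metric.mem_nhds_iff.1 ht
  refine ⟨K * 2, ρ, hρ, by positivity, fun a ha => ?_⟩
  have hsub : Metric.closedBall (0 : E2) ‖a‖ ⊆ t := fun z hz => hρt <| by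
    rw [mem_closedBall_zero_iff] at hz
    rw [mem_ball_zero_iff]
    exact hz.trans_lt ha
  have hamem : a ∈ Metric.closedBall (0 : E2) ‖a‖ := by simp
  have := (convex_closedBall (0 : E2) ‖a‖).norm_image_sub_le_of_norm_hasFDerivWithin_le'
    (f := h) (f' := fderiv ℝ h) (φ := fderiv ℝ h a) (C := K * (2 * ‖a‖)) (x := 0) (y := a)
    (fun z _ => (hasFDerivAt_of_contDiff hh z).hasFDerivWithinAt) (fun z hz => by
      refine (hK.norm_sub_le (hsub hz) (hsub hamem)).trans ?_
      gcongr
      rw [mem_closedBall_zero_iff] at hz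
      linarith [norm_sub_le z a]) (by simp) hamem
  rw [sub_zero, h0, sub_zero, Real.norm_eq_abs] at this
  refine this.trans (le_of_eq ?_)
  ring

theorem one_le_areaDensity (h : E2 → ℝ) (a : E2) : 1 ≤ areaDensity h a := by
  rw [areaDensity]
  exact Real.one_le_sqrt.2 (by linarith [sq_nonneg ‖gradient h a‖])

namespace IsSmoothBoundedRegion

variable {Ω : Set E3} (hΩ : IsSmoothBoundedRegion Ω)

include hΩ

theorem isOutwardUnitNormal_outwardNormal {x : E3} (hx : x ∈ frontier Ω) :
    IsOutwardUnitNormal Ω x (outwardNormal Ω x) := by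
  obtain ⟨ν, hν⟩ := hΩ.exists_normal hx
  rwa [hν.outwardNormal_eq]

/-- In the chart at y the chord paired with the unnormalized normal at x is h(a) - dh_a(a), which is
quadratic. The extra order makes the Gauss integrand absolutely integrable. -/
theorem exists_abs_inner_outwardNormal_le {y : E3} (hy : y ∈ frontier Ω) :
    ∃ C, 0 ≤ C ∧ ∀ x ∈ frontier Ω, |⟪x - y, outwardNormal Ω x⟫_ℝ| ≤ C * ‖x - y‖ ^ 2 := by
  obtain ⟨Φ, h, V, hc⟩ := hΩ.exists_isGraphChart hy
  obtain ⟨C, ρ, hρ, hC0, hC⟩ :=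
    exists_abs_sub_fderiv_le hc.contDiff (hc.height_zero hΩ.isOpen hy)
  obtain ⟨ε, hε, hεV⟩ := Metric.isOpen_iff.1 hc.isOpen y hc.mem
  refine ⟨max C (min ε ρ)⁻¹, le_max_of_le_left hC0, fun x hx => ?_⟩
  rcases lt_or_ge ‖x - y‖ (min ε ρ) with hxy | hxy
  · have hxV : x ∈ V := hεV (by
      rw [Metric.mem_ball, dist_eq_norm]; exact hxy.trans_le (min_le_left _ _))
    set a := planeCoord Φ y x with ha
    have hax : ‖a‖ ≤ ‖x - y‖ := norm_planeCoord_le Φ y x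
    have hJ := areaDensity_pos h a
    have e1 : ⟪x - y, graphNormal Φ h a⟫_ℝ = h a - fderiv ℝ h a a := by
      have hxa : x - y = Φ (WithLp.toLp 2 (a, h a)) := by
        rw [← (hc.mem_frontier_iff hΩ.isOpen hxV).1 hx]
        exact (Φ.apply_symm_apply (x - y)).symm
      rw [hxa, graphNormal, Φ.inner_map_map, WithLp.prod_inner_apply]
      simp only [inner_neg_right, real_inner_comm]
      simp
      ring
    rw [hc.outwardNormal_eq hΩ.isOpen hxV hx, inner_smul_right, e1, abs_mul, abs_inv,
      abs_of_pos hJ]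
    calc _ ≤ 1 * (C * ‖a‖ ^ 2) := by
          gcongr
          · exact inv_le_one_of_one_le₀ (one_le_areaDensity h a)
          · exact hC a (hax.trans_lt (hxy.trans_le (min_le_right _ _)))
      _ ≤ max C (min ε ρ)⁻¹ * ‖x - y‖ ^ 2 := by
          rw [one_mul]
          gcongr
          exact le_max_left _ _
  · have hm : 0 < min ε ρ := lt_min hε hρ
    have h1 := abs_real_inner_le_norm (x - y) (outwardNormal Ω x)
    rw [(hΩ.isOutwardUnitNormal_outwardNormal hx).1, mul_one] at h1
    calc _ ≤ ‖x - y‖ := h1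
      _ = (min ε ρ)⁻¹ * (min ε ρ * ‖x - y‖) := by field_simp
      _ ≤ max C (min ε ρ)⁻¹ * (‖x - y‖ * ‖x - y‖) := by
          gcongr
          exact le_max_right _ _
      _ = _ := by ring

/-! ### The Gauss identity -/

/-- The divergence of φ(x)(x - y) is 3φ + dφ(x - y); the divergence theorem is applied to each
coordinate of the field. -/
theorem integral_mul_inner_sub {φ : E3 → ℝ} (hφ : ContDiff ℝ ∞ φ) (y : E3) :
    ∫ x, φ x * ⟪x - y, outwardNormal Ω x⟫_ℝ ∂(surfaceMeasure Ω)
      = ∫ x in Ω, (3 * φ x + fderiv ℝ φ x (x - y)) := by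
  have hfin := hΩ.isFiniteMeasure
  have hFc : ∀ m : Fin 3, ContDiff ℝ ∞ fun x : E3 => (x - y) m * φ x := fun m =>
    ((EuclideanSpace.proj m : E3 →L[ℝ] ℝ).contDiff.comp (contDiff_id.sub contDiff_const)).mul hφ
  have hd : ∀ (m : Fin 3) (x : E3), fderiv ℝ (fun x : E3 => (x - y) m * φ x) x
      (EuclideanSpace.single m 1) = φ x + (x - y) m * fderiv ℝ φ x (EuclideanSpace.single m 1) := by
    intro m x
    have h1 : HasFDerivAt (fun x : E3 => (x - y) m) (EuclideanSpace.proj m : E3 →L[ℝ] ℝ) x :=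
      (EuclideanSpace.proj m : E3 →L[ℝ] ℝ).hasFDerivAt.comp x ((hasFDerivAt_id x).sub_const y)
    rw [(h1.fun_mul (hasFDerivAt_of_contDiff hφ x)).fderiv]
    simp
    ring
  have hsum : ∀ v : E3, v = ∑ m, v m • EuclideanSpace.single m (1 : ℝ) := fun v => by
    ext i
    simp [Finset.sum_apply, Pi.single_apply]
  have hnc := hΩ.contDiffOn_outwardNormal.continuousOn
  calc _ = ∫ x, ∑ m, (x - y) m * φ x * ⟪EuclideanSpace.single m 1, outwardNormal Ω x⟫_ℝ
        ∂(surfaceMeasure Ω) := by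
        refine integral_congr_ae (Eventually.of_forall fun x => ?_)
        simp only
        conv_lhs => rw [hsum (x - y), sum_inner, Finset.mul_sum]
        refine Finset.sum_congr rfl fun m _ => ?_
        rw [real_inner_smul_left]
        ring
    _ = ∑ m, ∫ x, (x - y) m * φ x * ⟪EuclideanSpace.single m 1, outwardNormal Ω x⟫_ℝ
        ∂(surfaceMeasure Ω) := by
        refine integral_finsetSum _ fun m _ => ?_
        have hcont : ContinuousOn (fun x => (x - y) m * φ x *
            ⟪EuclideanSpace.single m 1, outwardNormal Ω x⟫_ℝ) (frontier Ω) :=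
          (hFc m).continuous.continuousOn.mul (continuousOn_const.inner hnc)
        obtain ⟨M, hM⟩ := hΩ.isCompact_frontier.exists_bound_of_continuousOn hcont
        exact hΩ.integrable_of_abs_le (aestronglyMeasurable_surfaceMeasure hcont) hM
    _ = ∑ m, ∫ x in Ω, (φ x + (x - y) m * fderiv ℝ φ x (EuclideanSpace.single m 1)) := by
        refine Finset.sum_congr rfl fun m _ => ?_
        rw [← hΩ.hasGaussGreen (hFc m) (EuclideanSpace.single m 1)]
        simp only [hd]
    _ = ∫ x in Ω, ∑ m, (φ x + (x - y) m * fderiv ℝ φ x (EuclideanSpace.single m 1)) := by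
        refine (integral_finsetSum _ fun m _ => ?_).symm
        have hcont : Continuous fun x =>
            φ x + (x - y) m * fderiv ℝ φ x (EuclideanSpace.single m 1) := by
          have h1 : Continuous fun x => fderiv ℝ φ x (EuclideanSpace.single m 1) :=
            (hφ.continuous_fderiv (by simp)).clm_apply continuous_const
          have h2 := hφ.continuous
          fun_prop
        exact (hcont.continuousOn.integrableOn_compact hΩ.isBounded.isCompact_closure).mono_set
          subset_closure
    _ = _ := by
        refine integral_congr_ae (Eventually.of_forall fun x => ?_)
        simp only
        conv_rhs => rw [hsum (x - y), map_sum]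
        simp [Finset.sum_add_distrib]

end IsSmoothBoundedRegion

/-- The radial divergence of `w i * w j * s (|w| / δ) / |w| ^ 5`, where `w = x - y`. -/
theorem IsGaussProfile.three_mul_add_fderiv {s : ℝ → ℝ} {c : ℝ}
    (hs : IsGaussProfile s 2 fun _ => c) {δ : ℝ} (hδ : 0 < δ) {K : E3 → ℝ} (hK : ContDiff ℝ ∞ K)
    (hKs : ∀ z, z ≠ 0 → K z = s (‖z‖ / δ) / ‖z‖ ^ 5) {y x : E3} (hxy : x ≠ y) (i j : Fin 3) :
    3 * ((x - y) i * (x - y) j * K (x - y))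
      + fderiv ℝ (fun x : E3 => (x - y) i * (x - y) j * K (x - y)) x (x - y)
      = c * (δ ^ 3)⁻¹ * ((δ⁻¹ • (x - y)) i * (δ⁻¹ • (x - y)) j *
        Real.exp (-‖δ⁻¹ • (x - y)‖ ^ 2)) := by
  set φ : E3 → ℝ := fun x => (x - y) i * (x - y) j * K (x - y) with hφ
  have hcoord : ∀ m : Fin 3, ContDiff ℝ ∞ fun x : E3 => (x - y) m := fun m =>
    (EuclideanSpace.proj m : E3 →L[ℝ] ℝ).contDiff.comp (contDiff_id.sub contDiff_const)
  have hφd : ContDiff ℝ ∞ φ :=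
    ((hcoord i).mul (hcoord j)).mul (hK.comp (contDiff_id.sub contDiff_const))
  set w := x - y with hw
  have hw0 : w ≠ 0 := sub_ne_zero.2 hxy
  have hr : 0 < ‖w‖ := norm_pos_iff.2 hw0
  have hray : HasDerivAt (fun t : ℝ => φ (y + t • w)) (fderiv ℝ φ x w) 1 := by
    have h1 : HasDerivAt (fun t : ℝ => y + t • w) w 1 := by
      simpa using ((hasDerivAt_id (1 : ℝ)).smul_const w).const_add y
    have h2 : HasFDerivAt φ (fderiv ℝ φ x) (y + (1 : ℝ) • w) := by
      rw [one_smul, hw, add_sub_cancel]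
      exact hasFDerivAt_of_contDiff hφd x
    exact h2.comp_hasDerivAt 1 h1
  -- Along the ray the function is a constant times s(t‖w‖/δ)/t³, since the degree is 2 - 5 = -3.
  -- Differentiating t⁻³ cancels the term 3φ, so that only s' survives.
  have hφt : ∀ t : ℝ, 0 < t →
      φ (y + t • w) = w i * w j / ‖w‖ ^ 5 * (s (t * (‖w‖ / δ)) / t ^ 3) := fun t ht => by
    simp only [hφ, add_sub_cancel_left]
    rw [hKs _ (smul_ne_zero ht.ne' hw0), norm_smul, Real.norm_of_nonneg ht.le]
    simp only [PiLp.smul_apply, smul_eq_mul]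
    rw [mul_div_assoc]
    field_simp
  have hs1 : HasDerivAt (fun t : ℝ => s (t * (‖w‖ / δ))) _ 1 :=
    (hs.hasDerivAt (1 * (‖w‖ / δ))).comp (1 : ℝ) ((hasDerivAt_id (1 : ℝ)).mul_const (‖w‖ / δ))
  have hray2 := ((hs1.fun_div (hasDerivAt_pow 3 (1 : ℝ)) (by norm_num)).const_mul
    (w i * w j / ‖w‖ ^ 5))
  have heq : (fun t : ℝ => φ (y + t • w)) =ᶠ[𝓝 1]
      fun t => w i * w j / ‖w‖ ^ 5 * (s (t * (‖w‖ / δ)) / t ^ 3) := by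
    filter_upwards [lt_mem_nhds one_pos] with t ht using hφt t ht
  have hval := hray.unique (hray2.congr_of_eventuallyEq heq)
  have hφ1 := hφt 1 one_pos
  simp only [one_smul, hw, add_sub_cancel] at hφ1
  rw [← hw] at hφ1
  change 3 * φ x + _ = _
  rw [hval, hφ1, norm_smul, norm_inv, Real.norm_of_nonneg hδ.le]
  simp only [PiLp.smul_apply, smul_eq_mul, one_mul]
  rw [show δ⁻¹ * ‖w‖ = ‖w‖ / δ by ring, show (‖w‖ / δ) ^ (2 * 2) = ‖w‖ ^ 4 / δ ^ 4 by ring]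
  generalize Real.exp (-(‖w‖ / δ) ^ 2) = E
  push_cast
  field_simp
  ring

/-! ### The regularized Gauss identity and its limit. -/

namespace IsSmoothBoundedRegion

variable {Ω : Set E3} (hΩ : IsSmoothBoundedRegion Ω)

include hΩ

theorem integral_regularized_gauss {s : ℝ → ℝ} {c : ℝ} (hs : IsGaussProfile s 2 fun _ => c)
    {δ : ℝ} (hδ : 0 < δ) (y : E3) (i j : Fin 3) :
    ∫ x, (x - y) i * (x - y) j * ⟪x - y, outwardNormal Ω x⟫_ℝ * (s (‖x - y‖ / δ) / ‖x - y‖ ^ 5)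
      ∂(surfaceMeasure Ω)
      = c * ∫ z in {z : E3 | y + δ • z ∈ Ω}, z i * z j * Real.exp (-‖z‖ ^ 2) := by
  obtain ⟨K, hK, hKs⟩ := (hs.isSmoothingFactor contDiff_const).2.2 δ hδ
  have hcoord : ∀ m : Fin 3, ContDiff ℝ ∞ fun x : E3 => (x - y) m := fun m =>
    (EuclideanSpace.proj m : E3 →L[ℝ] ℝ).contDiff.comp (contDiff_id.sub contDiff_const)
  have hφd : ContDiff ℝ ∞ fun x : E3 => (x - y) i * (x - y) j * K (x - y) :=
    ((hcoord i).mul (hcoord j)).mul (hK.comp (contDiff_id.sub contDiff_const))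
  have h1 := hΩ.integral_mul_inner_sub hφd y
  rw [setIntegral_rescale hΩ.isOpen y _ hδ, ← mul_assoc, ← integral_const_mul]
  have h2 : ∫ x in Ω, (3 * ((x - y) i * (x - y) j * K (x - y))
      + fderiv ℝ (fun x : E3 => (x - y) i * (x - y) j * K (x - y)) x (x - y))
      = ∫ x in Ω, c * (δ ^ 3)⁻¹ * ((δ⁻¹ • (x - y)) i * (δ⁻¹ • (x - y)) j *
        Real.exp (-‖δ⁻¹ • (x - y)‖ ^ 2)) := by
    refine integral_congr_ae (ae_restrict_of_ae ?_)
    have : ∀ᵐ x : E3, x ≠ y := by simp [ae_iff]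
    filter_upwards [this] with x hx
    exact hs.three_mul_add_fderiv hδ hK hKs hx i j
  rw [← h2, ← h1]
  refine integral_congr_ae ?_
  filter_upwards [ae_ne_surfaceMeasure Ω y] with x hx
  rw [hKs _ (sub_ne_zero.2 hx)]
  ring

theorem exists_abs_gauss_integrand_le {y : E3} (hy : y ∈ frontier Ω) (i j : Fin 3) :
    ∃ C, 0 ≤ C ∧ ∀ x ∈ frontier Ω, x ≠ y →
      |(x - y) i * (x - y) j * ⟪x - y, outwardNormal Ω x⟫_ℝ| * (1 / ‖x - y‖ ^ 5)
        ≤ C * ‖y - x‖⁻¹ := by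
  obtain ⟨C, hC0, hC⟩ := hΩ.exists_abs_inner_outwardNormal_le hy
  refine ⟨C, hC0, fun x hx hxy => ?_⟩
  have hr : 0 < ‖x - y‖ := norm_pos_iff.2 (sub_ne_zero.2 hxy)
  rw [abs_mul, norm_sub_rev y x]
  calc _ ≤ ‖x - y‖ ^ 2 * (C * ‖x - y‖ ^ 2) * (1 / ‖x - y‖ ^ 5) := by
        gcongr
        · exact abs_coord_mul_coord_le _ i j
        · exact hC x hx
    _ = _ := by field_simp

theorem aestronglyMeasurable_gauss_integrand (y : E3) (i j : Fin 3) {f : E3 → ℝ}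
    (hf : Measurable f) : AEStronglyMeasurable
      (fun x => (x - y) i * (x - y) j * ⟪x - y, outwardNormal Ω x⟫_ℝ * f x)
      (surfaceMeasure Ω) := by
  have hnc := hΩ.contDiffOn_outwardNormal.continuousOn
  have hcont : ContinuousOn (fun x => (x - y) i * (x - y) j * ⟪x - y, outwardNormal Ω x⟫_ℝ)
      (frontier Ω) := by
    have h1 : ContinuousOn (fun x => ⟪x - y, outwardNormal Ω x⟫_ℝ) (frontier Ω) :=
      (continuousOn_id.sub continuousOn_const).inner hnc
    have h2 : Continuous fun x : E3 => (x - y) i * (x - y) j := by fun_prop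
    exact h2.continuousOn.mul h1
  exact (aestronglyMeasurable_surfaceMeasure hcont).mul hf.aestronglyMeasurable

theorem integrable_gauss_integrand {y : E3} (hy : y ∈ frontier Ω) (i j : Fin 3) :
    Integrable (fun x => (x - y) i * (x - y) j * ⟪x - y, outwardNormal Ω x⟫_ℝ *
      (1 / ‖x - y‖ ^ 5)) (surfaceMeasure Ω) := by
  obtain ⟨C, -, hC⟩ := hΩ.exists_abs_gauss_integrand_le hy i j
  refine hΩ.integrable_of_norm_le (hΩ.aestronglyMeasurable_gauss_integrand y i j (by fun_prop)) hy
    (C := C) fun x hx hxy => ?_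
  rw [Real.norm_eq_abs, abs_mul, abs_of_nonneg (a := 1 / ‖x - y‖ ^ 5) (by positivity)]
  exact hC x hx hxy

/-- The Gauss identity for the stresslet at a point of the surface. -/
theorem integral_gauss {y : E3} (hy : y ∈ frontier Ω) (i j : Fin 3) :
    ∫ x, (x - y) i * (x - y) j * ⟪x - y, outwardNormal Ω x⟫_ℝ * (1 / ‖x - y‖ ^ 5)
      ∂(surfaceMeasure Ω) = if i = j then 2 * Real.pi / 3 else 0 := by
  -- The basic factor s₃ is used because its constant derivative factor makes the divergence a pure
  -- second Gaussian moment. Its constant 8/(3√π) times a quarter of π^(3/2) gives 2π/3.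
  have hs := isGaussProfile_s₃
  obtain ⟨C, hC0, hC⟩ := hΩ.exists_abs_gauss_integrand_le hy i j
  obtain ⟨A, hA0, hA⟩ := hs.exists_abs_le
  have hν := hΩ.isOutwardUnitNormal_outwardNormal hy
  have hν0 : outwardNormal Ω y ≠ 0 := fun h => by simpa [h] using hν.1
  have hlim1 : Tendsto (fun δ : ℝ => ∫ x, (x - y) i * (x - y) j * ⟪x - y, outwardNormal Ω x⟫_ℝ *
      (s₃ (‖x - y‖ / δ) / ‖x - y‖ ^ 5) ∂(surfaceMeasure Ω)) (𝓝[>] 0)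
      (𝓝 (∫ x, (x - y) i * (x - y) j * ⟪x - y, outwardNormal Ω x⟫_ℝ * (1 / ‖x - y‖ ^ 5)
        ∂(surfaceMeasure Ω))) := by
    have hsm := hs.continuous.measurable
    refine tendsto_integral_filter_of_dominated_convergence (fun x => A * (C * ‖y - x‖⁻¹))
      (Eventually.of_forall fun δ =>
        hΩ.aestronglyMeasurable_gauss_integrand y i j (by fun_prop)) ?_
      (((hΩ.integrable_inv_dist hy).const_mul C).const_mul A) ?_
    · filter_upwards [self_mem_nhdsWithin] with δ hδ
      have hδ0 : (0 : ℝ) < δ := hδ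
      filter_upwards [ae_mem_frontier Ω, ae_ne_surfaceMeasure Ω y] with x hx hxy
      have h1 := mul_le_mul (hA (‖x - y‖ / δ) (by positivity)) (hC x hx hxy) (by positivity) hA0
      rw [Real.norm_eq_abs, abs_mul, abs_div, abs_of_nonneg (pow_nonneg (norm_nonneg (x - y)) 5)]
      refine le_trans (le_of_eq ?_) h1
      ring
    · filter_upwards [ae_ne_surfaceMeasure Ω y] with x hxy
      have hr : 0 < ‖x - y‖ := norm_pos_iff.2 (sub_ne_zero.2 hxy)
      have h1 : Tendsto (fun δ : ℝ => ‖x - y‖ / δ) (𝓝[>] 0) atTop :=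
        tendsto_inv_nhdsGT_zero.const_mul_atTop hr
      exact ((hs.tendsto.comp h1).div_const _).const_mul _
  have hlim2 := (tendsto_setIntegral_rescale hΩ.isOpen hν
    (integrable_coord_mul_coord_mul_exp i j)).const_mul (8 / (3 * √Real.pi))
  have heq : (fun δ : ℝ => 8 / (3 * √Real.pi) * ∫ z in {z : E3 | y + δ • z ∈ Ω},
      z i * z j * Real.exp (-‖z‖ ^ 2)) =ᶠ[𝓝[>] 0] fun δ => ∫ x, (x - y) i * (x - y) j *
        ⟪x - y, outwardNormal Ω x⟫_ℝ * (s₃ (‖x - y‖ / δ) / ‖x - y‖ ^ 5) ∂(surfaceMeasure Ω) := by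
    filter_upwards [self_mem_nhdsWithin] with δ hδ
    exact (hΩ.integral_regularized_gauss hs hδ y i j).symm
  rw [tendsto_nhds_unique hlim1 (hlim2.congr' heq),
    setIntegral_inner_neg hν0 (integrable_coord_mul_coord_mul_exp i j) (fun z => by simp),
    integral_coord_mul_coord_mul_exp]
  split_ifs with hij
  · have hp := Real.sq_sqrt Real.pi_pos.le
    have hp0 : √Real.pi ≠ 0 := (Real.sqrt_pos.2 Real.pi_pos).ne'
    field_simp
    rw [hp]
    ring
  · simp

end IsSmoothBoundedRegion

/-! ### Vector-valued integrals and their components -/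

theorem eq_sum_smul_single (v : E3) : v = ∑ m, v m • EuclideanSpace.single m (1 : ℝ) := by
  ext i
  simp [Finset.sum_apply, Pi.single_apply]

theorem norm_le_sum_abs (v : E3) : ‖v‖ ≤ ∑ i, |v i| := by
  conv_lhs => rw [eq_sum_smul_single v]
  refine (norm_sum_le _ _).trans (Finset.sum_le_sum fun i _ => ?_)
  rw [norm_smul]
  simp

theorem inner_eq_sum (v w : E3) : ⟪v, w⟫_ℝ = ∑ j, v j * w j := by
  rw [PiLp.inner_apply]
  refine Finset.sum_congr rfl fun j _ => ?_
  simp [mul_comm]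

theorem integrable_of_coords {X : Type*} [MeasurableSpace X] {μ : Measure X} {F : X → E3}
    (hF : ∀ i, Integrable (fun x => F x i) μ) : Integrable F μ := by
  have : F = fun x => ∑ m, F x m • EuclideanSpace.single m (1 : ℝ) :=
    funext fun x => eq_sum_smul_single (F x)
  rw [this]
  exact integrable_finsetSum _ fun i _ => (hF i).smul_const _

theorem integral_coord {X : Type*} [MeasurableSpace X] {μ : Measure X} {F : X → E3}
    (hF : Integrable F μ) (i : Fin 3) : (∫ x, F x ∂μ) i = ∫ x, F x i ∂μ :=
  ((EuclideanSpace.proj i : E3 →L[ℝ] ℝ).integral_comp_comm hF).symm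

theorem norm_integral_le_sum {X : Type*} [MeasurableSpace X] {μ : Measure X} {F : X → E3}
    (hF : Integrable F μ) : ‖∫ x, F x ∂μ‖ ≤ ∑ i, |∫ x, F x i ∂μ| := by
  refine (norm_le_sum_abs _).trans (le_of_eq ?_)
  simp only [integral_coord hF]

theorem diffProd_zero (G : E3 → ℝ) (g : Fin 0 → E3 → ℝ) (y x : E3) : diffProd G g y x = G x := by
  simp [diffProd]

theorem diffProd_two (G a b : E3 → ℝ) (y x : E3) :
    diffProd G ![a, b] y x = G x * ((a x - a y) * (b x - b y)) := by
  simp [diffProd, Fin.prod_univ_two]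

theorem diffProd_four (G a b c d : E3 → ℝ) (y x : E3) : diffProd G ![a, b, c, d] y x
    = G x * ((a x - a y) * (b x - b y) * (c x - c y) * (d x - d y)) := by
  simp [diffProd, Fin.prod_univ_four]

theorem contDiff_apply_E3 (i : Fin 3) : ContDiff ℝ ∞ fun x : E3 => x i :=
  (EuclideanSpace.proj i : E3 →L[ℝ] ℝ).contDiff

theorem contDiffOn_coord {S : Set E3} {f : E3 → E3} (hf : ContDiffOn ℝ ∞ f S) (i : Fin 3) :
    ContDiffOn ℝ ∞ (fun x => f x i) S :=
  (contDiff_apply_E3 i).comp_contDiffOn hf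

/-! ### The single layer -/

/-- Viewing the exact integrand as the regularized one with both factors equal to 1 lets one
integrability lemma serve both, and makes s - 1 appear in their difference. -/
theorem singleLayerIntegrand_eq (δ : ℝ) (f : E3 → E3) (y x : E3) :
    singleLayerIntegrand f y x
      = regSingleLayerIntegrand (fun _ => 1) (fun _ => 1) δ f y x := by
  ext i
  simp only [singleLayerIntegrand, stokeslet, regSingleLayerIntegrand, inner_eq_sum,
    PiLp.add_apply, PiLp.smul_apply, PiLp.sub_apply, smul_eq_mul, add_mul,
    Finset.sum_add_distrib, Finset.sum_mul]
  congr 1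
  · simp [ite_div, ite_mul]
  · exact Finset.sum_congr rfl fun j _ => by ring

namespace IsSmoothBoundedRegion

variable {Ω : Set E3} (hΩ : IsSmoothBoundedRegion Ω)

include hΩ

theorem integrable_regSingleLayerIntegrand {f : E3 → E3} (hf : ContinuousOn f (frontier Ω))
    {σ₁ σ₂ : ℝ → ℝ} (h₁ : Measurable σ₁) (h₂ : Measurable σ₂) {A₁ A₂ : ℝ}
    (hA₁ : ∀ r, 0 ≤ r → |σ₁ r| ≤ A₁) (hA₂ : ∀ r, 0 ≤ r → |σ₂ r| ≤ A₂) {δ : ℝ} (hδ : 0 < δ) {y : E3}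
    (hy : y ∈ frontier Ω) :
    Integrable (regSingleLayerIntegrand σ₁ σ₂ δ f y) (surfaceMeasure Ω) := by
  obtain ⟨M, hM⟩ := hΩ.isCompact_frontier.exists_bound_of_continuousOn hf
  have hM0 : 0 ≤ M := (norm_nonneg _).trans (hM y hy)
  have hA₁0 : 0 ≤ A₁ := (abs_nonneg _).trans (hA₁ 0 le_rfl)
  have hA₂0 : 0 ≤ A₂ := (abs_nonneg _).trans (hA₂ 0 le_rfl)
  have hfm : AEStronglyMeasurable f (surfaceMeasure Ω) := aestronglyMeasurable_surfaceMeasure hf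
  have m1 : Measurable fun x : E3 => σ₁ (‖y - x‖ / δ) / ‖y - x‖ := by fun_prop
  have m2 : Measurable fun x : E3 => σ₂ (‖y - x‖ / δ) / ‖y - x‖ ^ 3 := by fun_prop
  have m3 : AEStronglyMeasurable (fun x : E3 => y - x) (surfaceMeasure Ω) :=
    (by fun_prop : Continuous fun x : E3 => y - x).aestronglyMeasurable
  refine hΩ.integrable_of_norm_le ((m1.aestronglyMeasurable.smul hfm).add
    (((hfm.inner m3).mul m2.aestronglyMeasurable).smul m3)) hy (C := A₁ * M + M * A₂)
    fun x hx hxy => ?_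
  have hr : 0 < ‖y - x‖ := norm_pos_iff.2 (sub_ne_zero.2 hxy.symm)
  rw [regSingleLayerIntegrand]
  refine (norm_add_le _ _).trans ?_
  rw [norm_smul, norm_smul, norm_mul, norm_div, norm_div, norm_pow, norm_norm, add_mul]
  refine add_le_add ?_ ?_
  · calc _ ≤ A₁ / ‖y - x‖ * M := by
          gcongr
          · exact hA₁ _ (by positivity)
          · exact hM x hx
      _ = _ := by ring
  · calc _ ≤ M * ‖y - x‖ * (A₂ / ‖y - x‖ ^ 3) * ‖y - x‖ := by
          gcongr
          · exact (norm_inner_le_norm _ _).trans (by gcongr; exact hM x hx)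
          · exact hA₂ _ (by positivity)
      _ = _ := by field_simp

theorem integrable_singleLayerIntegrand {f : E3 → E3} (hf : ContinuousOn f (frontier Ω)) {y : E3}
    (hy : y ∈ frontier Ω) : Integrable (singleLayerIntegrand f y) (surfaceMeasure Ω) := by
  rw [funext fun x => singleLayerIntegrand_eq 1 f y x]
  exact hΩ.integrable_regSingleLayerIntegrand hf measurable_const measurable_const
    (A₁ := 1) (A₂ := 1) (by simp) (by simp) one_pos hy

/-- The i-th component of the difference splits into f_i with no differences (k = 0) and the terms
f_j (x_j - y_j)(x_i - y_i) with two (k = 1). -/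
theorem exists_norm_regSingleLayer_sub_le {f : E3 → E3} (hf : ContDiffOn ℝ ∞ f (frontier Ω))
    {σ₁ σ₂ : ℝ → ℝ} {c₁ c₂ : ℝ} (h₁ : IsGaussProfile σ₁ 0 (highFactor 0 c₁))
    (h₂ : IsGaussProfile σ₂ 1 (highFactor 1 c₂)) :
    ∃ C : ℝ, ∀ δ : ℝ, 0 < δ → ∀ y ∈ frontier Ω,
      ‖regSingleLayer σ₁ σ₂ δ Ω f y - singleLayer Ω f y‖ ≤ C * δ ^ 5 := by
  have hg₁ : ∀ m : Fin (2 * 0), ContDiffOn ℝ ∞ ((fun _ _ => 0 : Fin (2 * 0) → E3 → ℝ) m)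
    (frontier Ω) := fun m => contDiffOn_const
  have hg₂ : ∀ i j : Fin 3, ∀ m : Fin (2 * 1), ContDiffOn ℝ ∞
      ((![fun x => x j, fun x => x i] : Fin 2 → E3 → ℝ) m) (frontier Ω) := fun i j m => by
    fin_cases m
    exacts [(contDiff_apply_E3 j).contDiffOn, (contDiff_apply_E3 i).contDiffOn]
  choose C₁ hC₁ using fun i : Fin 3 =>
    hΩ.exists_abs_integral_diffProd_mul_le (k := 0) (contDiffOn_coord hf i) hg₁ h₁
  choose C₂ hC₂ using fun i j : Fin 3 =>
    hΩ.exists_abs_integral_diffProd_mul_le (k := 1) (contDiffOn_coord hf j) (hg₂ i j) h₂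
  obtain ⟨A₁, -, hA₁⟩ := h₁.exists_abs_le
  obtain ⟨A₂, -, hA₂⟩ := h₂.exists_abs_le
  refine ⟨1 / (8 * Real.pi) * ∑ i, (C₁ i + ∑ j, C₂ i j), fun δ hδ y hy => ?_⟩
  have hi₁ := hΩ.integrable_regSingleLayerIntegrand hf.continuousOn h₁.continuous.measurable
    h₂.continuous.measurable hA₁ hA₂ hδ hy
  have hi₂ := hΩ.integrable_singleLayerIntegrand hf.continuousOn hy
  have hpi := Real.pi_pos
  rw [regSingleLayer, singleLayer, ← smul_sub, ← integral_sub hi₁ hi₂, norm_smul,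
    Real.norm_of_nonneg (by positivity), mul_assoc]
  refine mul_le_mul_of_nonneg_left ((norm_integral_le_sum (hi₁.sub hi₂)).trans ?_) (by positivity)
  rw [Finset.sum_mul]
  refine Finset.sum_le_sum fun i _ => ?_
  have hcomp : ∀ x, (regSingleLayerIntegrand σ₁ σ₂ δ f y x - singleLayerIntegrand f y x) i
      = diffProd (fun x => f x i) (fun (_ : Fin (2 * 0)) _ => 0) y x *
          ((σ₁ (‖y - x‖ / δ) - 1) / ‖y - x‖ ^ (2 * 0 + 1))
        + ∑ j, diffProd (n := 2 * 1) (fun x => f x j) ![fun x => x j, fun x => x i] y x *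
          ((σ₂ (‖y - x‖ / δ) - 1) / ‖y - x‖ ^ (2 * 1 + 1)) := fun x => by
    have e2 : ∀ j, diffProd (n := 2 * 1) (fun x => f x j) ![fun x => x j, fun x => x i] y x
        = f x j * ((x j - y j) * (x i - y i)) := fun j => diffProd_two _ _ _ _ _
    have e1 : diffProd (fun x => f x i) (fun (_ : Fin (2 * 0)) _ => 0) y x = f x i :=
      diffProd_zero _ _ _ _
    rw [singleLayerIntegrand_eq δ, e1]
    simp only [e2, regSingleLayerIntegrand, inner_eq_sum, PiLp.sub_apply, PiLp.add_apply,
      PiLp.smul_apply, smul_eq_mul, Finset.sum_mul]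
    rw [add_sub_add_comm, ← Finset.sum_sub_distrib]
    congr 1
    · ring
    · exact Finset.sum_congr rfl fun j _ => by ring
  have i1 := hΩ.integrable_diffProd_mul (k := 0) (contDiffOn_coord hf i).continuousOn hg₁ hy h₁ hδ
  have i2 := fun j => hΩ.integrable_diffProd_mul (k := 1) (contDiffOn_coord hf j).continuousOn
    (hg₂ i j) hy h₂ hδ
  simp only [Pi.sub_apply, hcomp]
  rw [integral_add i1 (integrable_finsetSum _ fun j _ => i2 j),
    integral_finsetSum _ fun j _ => i2 j, add_mul, Finset.sum_mul]
  refine (abs_add_le _ _).trans (add_le_add (hC₁ i δ hδ y hy) ?_)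
  exact (Finset.abs_sum_le_sum_abs _ _).trans
    (Finset.sum_le_sum fun j _ => hC₂ i j δ hδ y hy)

end IsSmoothBoundedRegion

/-! ### The double layer -/

theorem doubleLayerIntegrand_eq (Ω : Set E3) (q : E3 → E3) (y x : E3) :
    doubleLayerIntegrand Ω q y x
      = (-6 : ℝ) • regDoubleLayerIntegrand (fun _ => 1) 1 Ω q y y x
        + (-6 : ℝ) • ((⟪y - x, q y⟫_ℝ * ⟪y - x, outwardNormal Ω x⟫_ℝ * (1 / ‖y - x‖ ^ 5)) •
          (y - x)) := by
  rw [regDoubleLayerIntegrand, ← smul_add, ← add_smul, ← add_mul, ← add_mul, ← inner_add_right,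
    sub_add_cancel]
  ext i
  simp only [doubleLayerIntegrand, stresslet, inner_eq_sum, PiLp.smul_apply, PiLp.sub_apply,
    smul_eq_mul]
  rw [Finset.sum_mul_sum, Finset.sum_mul, Finset.sum_mul, Finset.mul_sum]
  refine Finset.sum_congr rfl fun j _ => ?_
  rw [Finset.sum_mul, Finset.sum_mul, Finset.mul_sum]
  exact Finset.sum_congr rfl fun k _ => by ring

namespace IsSmoothBoundedRegion

variable {Ω : Set E3} (hΩ : IsSmoothBoundedRegion Ω)

include hΩ

/-- The subtraction in q supplies one order of vanishing, so the trivial bound ‖y - x‖ for the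
normal component already leaves only 1/‖y - x‖. -/
theorem integrable_regDoubleLayerIntegrand {q : E3 → E3} (hq : ContDiffOn ℝ ∞ q (frontier Ω))
    {σ : ℝ → ℝ} (hσ : Measurable σ) {A : ℝ} (hA : ∀ r, 0 ≤ r → |σ r| ≤ A) {δ : ℝ} (hδ : 0 < δ)
    {y : E3} (hy : y ∈ frontier Ω) :
    Integrable (regDoubleLayerIntegrand σ δ Ω q y y) (surfaceMeasure Ω) := by
  obtain ⟨C, hC0, hC⟩ := hΩ.exists_norm_sub_le hq hy
  have hA0 : 0 ≤ A := (abs_nonneg _).trans (hA 0 le_rfl)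
  have hn : AEStronglyMeasurable (outwardNormal Ω) (surfaceMeasure Ω) :=
    aestronglyMeasurable_surfaceMeasure hΩ.contDiffOn_outwardNormal.continuousOn
  have hqm : AEStronglyMeasurable (fun x => q x - q y) (surfaceMeasure Ω) :=
    aestronglyMeasurable_surfaceMeasure (hq.continuousOn.sub continuousOn_const)
  have m1 : Measurable fun x : E3 => σ (‖y - x‖ / δ) / ‖y - x‖ ^ 5 := by fun_prop
  have m3 : AEStronglyMeasurable (fun x : E3 => y - x) (surfaceMeasure Ω) :=
    (by fun_prop : Continuous fun x : E3 => y - x).aestronglyMeasurable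
  refine hΩ.integrable_of_norm_le ((((m3.inner hqm).mul (m3.inner hn)).mul
    m1.aestronglyMeasurable).smul m3) hy (C := C * A) fun x hx hxy => ?_
  have hr : 0 < ‖y - x‖ := norm_pos_iff.2 (sub_ne_zero.2 hxy.symm)
  rw [regDoubleLayerIntegrand, norm_smul, norm_mul, norm_mul, norm_div, norm_pow, norm_norm]
  have h1 : ‖⟪y - x, q x - q y⟫_ℝ‖ ≤ ‖y - x‖ * (C * ‖y - x‖) :=
    (norm_inner_le_norm _ _).trans (by gcongr; exact hC x hx)
  have h2 : ‖⟪y - x, outwardNormal Ω x⟫_ℝ‖ ≤ ‖y - x‖ := by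
    have := norm_inner_le_norm (𝕜 := ℝ) (y - x) (outwardNormal Ω x)
    rwa [(hΩ.isOutwardUnitNormal_outwardNormal hx).1, mul_one] at this
  calc _ ≤ ‖y - x‖ * (C * ‖y - x‖) * ‖y - x‖ * (A / ‖y - x‖ ^ 5) * ‖y - x‖ := by
        gcongr
        exact hA _ (by positivity)
    _ = _ := by field_simp

theorem gauss_vector {y : E3} (hy : y ∈ frontier Ω) (v : E3) :
    Integrable (fun x => (⟪y - x, v⟫_ℝ * ⟪y - x, outwardNormal Ω x⟫_ℝ * (1 / ‖y - x‖ ^ 5)) •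
      (y - x)) (surfaceMeasure Ω) ∧
    ∫ x, (⟪y - x, v⟫_ℝ * ⟪y - x, outwardNormal Ω x⟫_ℝ * (1 / ‖y - x‖ ^ 5)) • (y - x)
      ∂(surfaceMeasure Ω) = -(2 * Real.pi / 3) • v := by
  have hcomp : ∀ i : Fin 3, (fun x => ((⟪y - x, v⟫_ℝ * ⟪y - x, outwardNormal Ω x⟫_ℝ *
      (1 / ‖y - x‖ ^ 5)) • (y - x)) i) = fun x => ∑ j, -v j * ((x - y) i * (x - y) j *
        ⟪x - y, outwardNormal Ω x⟫_ℝ * (1 / ‖x - y‖ ^ 5)) := fun i => by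
    funext x
    rw [← neg_sub x y, norm_neg, inner_neg_left, inner_neg_left, inner_eq_sum (x - y) v]
    simp only [PiLp.smul_apply, PiLp.neg_apply, smul_eq_mul, neg_mul_neg, Finset.sum_mul]
    exact Finset.sum_congr rfl fun j _ => by ring
  have hint : ∀ i j : Fin 3, Integrable (fun x => -v j * ((x - y) i * (x - y) j *
        ⟪x - y, outwardNormal Ω x⟫_ℝ * (1 / ‖x - y‖ ^ 5))) (surfaceMeasure Ω) := fun i j =>
    (hΩ.integrable_gauss_integrand hy i j).const_mul _
  have hF : Integrable (fun x => (⟪y - x, v⟫_ℝ * ⟪y - x, outwardNormal Ω x⟫_ℝ *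
      (1 / ‖y - x‖ ^ 5)) • (y - x)) (surfaceMeasure Ω) := integrable_of_coords fun i => by
    rw [hcomp i]
    exact integrable_finsetSum _ fun j _ => hint i j
  refine ⟨hF, ?_⟩
  ext i
  rw [integral_coord hF, hcomp i, integral_finsetSum _ fun j _ => hint i j]
  simp only [integral_const_mul, hΩ.integral_gauss hy, mul_ite, mul_zero, Finset.sum_ite_eq,
    Finset.mem_univ, if_true, PiLp.smul_apply, smul_eq_mul]
  ring

theorem integrable_doubleLayerIntegrand {q : E3 → E3} (hq : ContDiffOn ℝ ∞ q (frontier Ω)) {y : E3}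
    (hy : y ∈ frontier Ω) : Integrable (doubleLayerIntegrand Ω q y) (surfaceMeasure Ω) := by
  rw [funext fun x => doubleLayerIntegrand_eq Ω q y x]
  exact ((hΩ.integrable_regDoubleLayerIntegrand hq measurable_const (A := 1) (by simp) one_pos
    hy).smul (-6 : ℝ)).add ((hΩ.gauss_vector hy (q y)).1.smul (-6 : ℝ))

/-- The part of the density frozen at y contributes (1/8π)(-6)(-2π/3) q(y) = q(y)/2 by the Gauss
identity, which is the on-surface value of the `chi` term. With constant factor the parameter δ = 1
plays no role. -/
theorem doubleLayer_eq {q : E3 → E3} (hq : ContDiffOn ℝ ∞ q (frontier Ω)) {y : E3}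
    (hy : y ∈ frontier Ω) : doubleLayer Ω q y = regDoubleLayer (fun _ => 1) 1 Ω q y y := by
  have h1 := hΩ.integrable_regDoubleLayerIntegrand hq measurable_const (A := 1)
    (σ := fun _ => 1) (by simp) one_pos hy
  obtain ⟨h2, h3⟩ := hΩ.gauss_vector hy (q y)
  have hpi := Real.pi_ne_zero
  rw [doubleLayer, regDoubleLayer, chi, if_pos hy]
  simp_rw [doubleLayerIntegrand_eq]
  rw [integral_add (h1.fun_smul (-6 : ℝ)) (h2.fun_smul (-6 : ℝ)), integral_smul, integral_smul, h3,
    smul_add, smul_smul, smul_smul, smul_smul]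
  congr 2
  · field_simp
    norm_num
  · field_simp
    norm_num

/-- The terms q(y)/2 cancel. What remains has n_k as coefficient and the four differences of x_j,
q_j, x_k and x_i, so 2k = 4; the subtraction of q(y) is what provides the fourth. -/
theorem exists_norm_regDoubleLayer_sub_le {q : E3 → E3} (hq : ContDiffOn ℝ ∞ q (frontier Ω))
    {σ : ℝ → ℝ} {c : ℝ} (hσ : IsGaussProfile σ 2 (highFactor 2 c)) :
    ∃ C : ℝ, ∀ δ : ℝ, 0 < δ → ∀ y ∈ frontier Ω,
      ‖regDoubleLayer σ δ Ω q y y - doubleLayer Ω q y‖ ≤ C * δ ^ 5 := by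
  have hn := hΩ.contDiffOn_outwardNormal
  have hg : ∀ i j k : Fin 3, ∀ m : Fin (2 * 2), ContDiffOn ℝ ∞
      ((![fun x => x j, fun x => q x j, fun x => x k, fun x => x i] : Fin 4 → E3 → ℝ) m)
      (frontier Ω) := fun i j k m => by
    fin_cases m
    exacts [(contDiff_apply_E3 j).contDiffOn, contDiffOn_coord hq j,
      (contDiff_apply_E3 k).contDiffOn, (contDiff_apply_E3 i).contDiffOn]
  choose C hC using fun i j k : Fin 3 =>
    hΩ.exists_abs_integral_diffProd_mul_le (k := 2) (contDiffOn_coord hn k) (hg i j k) hσ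
  obtain ⟨A, -, hA⟩ := hσ.exists_abs_le
  refine ⟨3 / (4 * Real.pi) * ∑ i, ∑ j, ∑ k, C i j k, fun δ hδ y hy => ?_⟩
  have hi₁ := hΩ.integrable_regDoubleLayerIntegrand hq hσ.continuous.measurable hA hδ hy
  have hi₂ := hΩ.integrable_regDoubleLayerIntegrand hq measurable_const (A := 1)
    (σ := fun _ => 1) (by simp) one_pos hy
  have hpi := Real.pi_pos
  rw [hΩ.doubleLayer_eq hq hy, regDoubleLayer, regDoubleLayer, add_sub_add_right_eq_sub,
    ← smul_sub, ← integral_sub hi₁ hi₂, norm_smul, norm_neg,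
    Real.norm_of_nonneg (by positivity), mul_assoc]
  refine mul_le_mul_of_nonneg_left ((norm_integral_le_sum (hi₁.sub hi₂)).trans ?_) (by positivity)
  rw [Finset.sum_mul]
  refine Finset.sum_le_sum fun i _ => ?_
  have hcomp : ∀ x, (regDoubleLayerIntegrand σ δ Ω q y y x
      - regDoubleLayerIntegrand (fun _ => 1) 1 Ω q y y x) i
      = -∑ j, ∑ k, diffProd (n := 2 * 2) (fun x => outwardNormal Ω x k)
          ![fun x => x j, fun x => q x j, fun x => x k, fun x => x i] y x *
          ((σ (‖y - x‖ / δ) - 1) / ‖y - x‖ ^ (2 * 2 + 1)) := fun x => by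
    have e : ∀ j k, diffProd (n := 2 * 2) (fun x => outwardNormal Ω x k)
        ![fun x => x j, fun x => q x j, fun x => x k, fun x => x i] y x
        = outwardNormal Ω x k * ((x j - y j) * (q x j - q y j) * (x k - y k) * (x i - y i)) :=
      fun j k => diffProd_four _ _ _ _ _ _ _
    simp only [e, regDoubleLayerIntegrand, inner_eq_sum, PiLp.sub_apply, PiLp.smul_apply,
      smul_eq_mul]
    rw [← sub_mul, ← mul_sub, ← sub_div, Finset.sum_mul_sum, Finset.sum_mul, Finset.sum_mul,
      ← Finset.sum_neg_distrib]
    refine Finset.sum_congr rfl fun j _ => ?_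
    rw [Finset.sum_mul, Finset.sum_mul, ← Finset.sum_neg_distrib]
    exact Finset.sum_congr rfl fun k _ => by ring
  have i1 := fun j k => hΩ.integrable_diffProd_mul (k := 2) (contDiffOn_coord hn k).continuousOn
    (hg i j k) hy hσ hδ
  simp only [Pi.sub_apply, hcomp]
  rw [integral_neg, abs_neg, integral_finsetSum _ fun j _ =>
    integrable_finsetSum _ fun k _ => i1 j k, Finset.sum_mul]
  refine (Finset.abs_sum_le_sum_abs _ _).trans (Finset.sum_le_sum fun j _ => ?_)
  rw [integral_finsetSum _ fun k _ => i1 j k, Finset.sum_mul]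
  exact (Finset.abs_sum_le_sum_abs _ _).trans
    (Finset.sum_le_sum fun k _ => hC i j k δ hδ y hy)

end IsSmoothBoundedRegion

end StokesReg

theorem mainTheorem3 :
    (StokesReg.IsHighOrderModification StokesReg.s₁ StokesReg.s₁High 1 ∧
      StokesReg.IsHighOrderModification StokesReg.s₂ StokesReg.s₂High 3 ∧
      StokesReg.IsHighOrderModification StokesReg.s₃ StokesReg.s₃High 5) ∧
    (StokesReg.IsSmoothingFactor StokesReg.s₁High 1 ∧
      StokesReg.IsSmoothingFactor StokesReg.s₂High 3 ∧
      StokesReg.IsSmoothingFactor StokesReg.s₃High 5) ∧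
    (∀ (Ω : Set StokesReg.E3), StokesReg.IsSmoothBoundedRegion Ω →
      ∀ (f : StokesReg.E3 → StokesReg.E3), ContDiffOn ℝ ∞ f (frontier Ω) →
        (∀ y ∈ frontier Ω,
          Integrable (StokesReg.singleLayerIntegrand f y) (StokesReg.surfaceMeasure Ω)) ∧
        (∀ δ : ℝ, 0 < δ → ∀ y ∈ frontier Ω,
          Integrable (StokesReg.regSingleLayerIntegrand StokesReg.s₁High StokesReg.s₂High δ f y)
            (StokesReg.surfaceMeasure Ω)) ∧
        ∃ C : ℝ, ∀ δ : ℝ, 0 < δ → ∀ y ∈ frontier Ω,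
          ‖StokesReg.regSingleLayer StokesReg.s₁High StokesReg.s₂High δ Ω f y
            - StokesReg.singleLayer Ω f y‖ ≤ C * δ ^ 5) ∧
    (∀ (Ω : Set StokesReg.E3), StokesReg.IsSmoothBoundedRegion Ω →
      ∀ (q : StokesReg.E3 → StokesReg.E3), ContDiffOn ℝ ∞ q (frontier Ω) →
        (∀ y ∈ frontier Ω,
          Integrable (StokesReg.doubleLayerIntegrand Ω q y) (StokesReg.surfaceMeasure Ω)) ∧
        (∀ δ : ℝ, 0 < δ → ∀ y ∈ frontier Ω,
          Integrable (StokesReg.regDoubleLayerIntegrand StokesReg.s₃High δ Ω q y y)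
            (StokesReg.surfaceMeasure Ω)) ∧
        ∃ C : ℝ, ∀ δ : ℝ, 0 < δ → ∀ y ∈ frontier Ω,
          ‖StokesReg.regDoubleLayer StokesReg.s₃High δ Ω q y y
            - StokesReg.doubleLayer Ω q y‖ ≤ C * δ ^ 5) := by
  open StokesReg in
  refine ⟨⟨isHighOrderModification_s₁, isHighOrderModification_s₂, isHighOrderModification_s₃⟩,
    ⟨isGaussProfile_s₁High.isSmoothingFactor (contDiff_highFactor _ _),
      isGaussProfile_s₂High.isSmoothingFactor (contDiff_highFactor _ _),
      isGaussProfile_s₃High.isSmoothingFactor (contDiff_highFactor _ _)⟩,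
    fun Ω hΩ f hf => ⟨fun y hy => hΩ.integrable_singleLayerIntegrand hf.continuousOn hy,
      fun δ hδ y hy => ?_, hΩ.exists_norm_regSingleLayer_sub_le hf isGaussProfile_s₁High
        isGaussProfile_s₂High⟩,
    fun Ω hΩ q hq => ⟨fun y hy => hΩ.integrable_doubleLayerIntegrand hq hy,
      fun δ hδ y hy => ?_, hΩ.exists_norm_regDoubleLayer_sub_le hq isGaussProfile_s₃High⟩⟩
  · obtain ⟨A₁, -, hA₁⟩ := StokesReg.isGaussProfile_s₁High.exists_abs_le
    obtain ⟨A₂, -, hA₂⟩ := StokesReg.isGaussProfile_s₂High.exists_abs_le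
    exact hΩ.integrable_regSingleLayerIntegrand hf.continuousOn
      StokesReg.isGaussProfile_s₁High.continuous.measurable
      StokesReg.isGaussProfile_s₂High.continuous.measurable hA₁ hA₂ hδ hy
  · obtain ⟨A, -, hA⟩ := StokesReg.isGaussProfile_s₃High.exists_abs_le
    exact hΩ.integrable_regDoubleLayerIntegrand hq
      StokesReg.isGaussProfile_s₃High.continuous.measurable hA hδ hy
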